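/- **Setting.** Let $k\ge 1$ be an integer, $\kappa\ge 6$ an integer, $\lambda>0$. Write $\mathbf x=(\mathbf x(1),\mathbf x(2))\in\mathbb R^2$, $\mathbb H^+(t)=\{\mathbf x:\mathbf x(2)\ge t\}$ and $B^+(\mathbf x,r)=B(\mathbf x,r)\cap\mathbb H^+(\mathbf x(2))$ with $B(\mathbf x,r)$ the closed Euclidean ball. For $S\subset\mathbb R^2$ let $h(\mathbf x,S)$ be the point of $\{\mathbf y\in S:\mathbf y(2)>\mathbf x(2)\}$ closest to $\mathbf x$ (the leftmost one in case of ties). The height of a bounded set $\Delta$ is $L(\Delta)=\sup\{\mathbf y(2)-\mathbf x(2):\mathbf x,\mathbf y\in\Delta\}$, with $L(\emptyset)=0$. Let $\mathcal N$ be a homogeneous Poisson point process on $\mathbb R^2$ with intensity $\lambda$. Let $\mathbf u_1,\dots,\mathbf u_k\in\mathbb R^2$ be deterministic points, not necessarily distinct, with $|\mathbf u_i(2)-\mathbf u_j(2)|\le\kappa$ for all $i,j$, and put $w_0=\min_i\mathbf u_i(2)$. Let $H_0\subset\mathbb R\times[w_0,w_0+1]$ be a deterministic compact set, and let $\mathcal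 N_0^{\rm extra}\subset H_0$ be a random set with at most $k$ points, independent of $\mathcal N$. Throughout, $\mathcal N$ is conditioned on $\mathcal N\cap H_0=\emptyset$ (for instance, $H_0=\mathcal N_0^{\rm extra}=\emptyset$), and $\mathbb P$ is the conditioned law. **Joint exploration process.** Put $g_0(\mathbf u_i)=\mathbf u_i$. Given $g_n(\mathbf u_1),\dots,g_n(\mathbf u_k)$ and $H_n$, let $W_n^{\rm move}$ be the lowest of the points $g_n(\mathbf u_i)$ (the leftmost among the lowest ones), and let $W_n^{\rm stay}=\{g_n(\mathbf u_i):1\le i\le k\}\setminus\{W_n^{\rm move}\}$. Put $g_{n+1}(\mathbf u_i)=h\big(g_n(\mathbf u_i),(\mathcal N\setminus H_n)\cup W_n^{\rm stay}\cup\mathcal N_0^{\rm extra}\big)$ if $g_n(\mathbf u_i)=W_n^{\rm move}$, put $g_{n+1}(\mathbf u_i)=g_n(\mathbf u_i)$ otherwise, and let $$H_{n+1}=\Big(H_n\cup\bigcup_{i=1}^kB^+\big(g_n(\mathbf u_i),\|g_{n+1}(\mathbf u_i)-g_n(\mathbf u_i)\|_2\big)\Big)\cap\mathbb H^+\big(W^{\rm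 move}_{n+1}(2)\big).$$ **Good steps and the first renewal step.** Let $\tau_0=0$ and, for $j\ge 1$, $$\tau_j=\inf\{kn>\tau_{j-1}:n\ge1,\ L(H_{kn})\le\kappa,\ W^{\rm move}_{kn}(2)\ge W^{\rm move}_{\tau_{j-1}}(2)+\kappa+1\}.$$ At a step $n$ let $g^{\downarrow}_n(\mathbf u_i)=(g_n(\mathbf u_i)(1),W_n^{\rm move}(2))$ and $g^{\uparrow}_n(\mathbf u_i)=(g_n(\mathbf u_i)(1),W_n^{\rm move}(2)+\kappa)$. For $j\ge1$ let $A_j$ be the event that $\tau_j<\infty$ and, for every $i$, $$\mathrm{Card}\big((B^+(g^{\downarrow}_{\tau_j}(\mathbf u_i),\kappa+1)\setminus H_{\tau_j})\cap\mathcal N\big)=\mathrm{Card}\big(B^+(g^{\uparrow}_{\tau_j}(\mathbf u_i),1)\cap\mathcal N\big)=1.$$ The first renewal step is $\beta=\inf\{\tau_j: j\ge1,\ A_j\text{ occurs}\}$. **Successive renewal steps.** Start from $\mathbf u_i^{(0)}=\mathbf u_i$, $H_0^{(0)}=H_0$ and $\mathcal N_0^{{\rm extra},(0)}=\mathcal N_0^{\rm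 extra}$. For $\ell\ge1$ let $\beta_\ell$ be the first renewal step of the exploration process, driven by the same $\mathcal N$, that starts from the points $\mathbf u_i^{(\ell-1)}$ with initial history set $H_0^{(\ell-1)}$ and extra points $\mathcal N_0^{{\rm extra},(\ell-1)}$. Then set $\mathbf u_i^{(\ell)}=g^{\uparrow}_{\beta_\ell}(\mathbf u_i^{(\ell-1)})$, $$H_0^{(\ell)}=\Big(\bigcup_iB^+\big(g^{\downarrow}_{\beta_\ell}(\mathbf u_i^{(\ell-1)}),\kappa+1\big)\Big)\cap\mathbb H^+\big(\mathbf u_1^{(\ell)}(2)\big),\qquad \mathcal N_0^{{\rm extra},(\ell)}=\mathcal N\cap\bigcup_iB^+(\mathbf u_i^{(\ell)},1).$$ Let $\mathcal G_\ell$ be the $\sigma$-field generated by the following data of the $m$-th of these processes, for $1\le m\le\ell$: its positions up to step $\beta_m$, the number $\beta_m$, its extra points, its good steps up to $\beta_m$, and the indicators of its events $A_j$ with $\tau_j\le\beta_m$. ($\mathcal G_0$ is trivial.) **Proposition.** There are a random variable $\mathcal R$ with values in $\mathbb N$ and constants $C_0,C_1>0$, where the law of $\mathcal R$ and the constants depend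 only on $\lambda$, $k$ and $\kappa$, such that for every choice of $\mathbf u_1,\dots,\mathbf u_k$, $H_0$ and $\mathcal N_0^{\rm extra}$ as above, all $\ell\ge0$ and all $n\ge1$, almost surely $$\mathbb P(\beta_{\ell+1}\ge n\mid\mathcal G_\ell)\ \le\ \mathbb P(\mathcal R\ge n)\ \le\ C_0e^{-C_1n}.$$ (In particular $\beta_{\ell+1}$ is a random variable and $\mathcal G_\ell$ consists of events.) -/

import Mathlib

open MeasureTheory ProbabilityTheory Set

noncomputable section

namespace DSF

/-- The plane with its Euclidean distance; `x 0` is the abscissa and `x 1` the ordinate. -/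
abbrev Plane : Type := EuclideanSpace ℝ (Fin 2)

/-- The closed upper half plane above level `l`. -/
def upperHalf (l : ℝ) : Set Plane := {x | l ≤ x 1}

/-- The closed semi-ball `B⁺(x, r)`. -/
def semiBall (x : Plane) (r : ℝ) : Set Plane := Metric.closedBall x r ∩ upperHalf (x 1)

/-- The height of a bounded planar set; the height of the empty set is `0`. -/
def height (D : Set Plane) : ℝ := sSup {t | ∃ x ∈ D, ∃ y ∈ D, t = y 1 - x 1}

/-- The smallest sigma-field making all the counting variables of a random set measurable. -/
@[reducible]
def pointSigma {Ω : Type*} (N : Ω → Set Plane) : MeasurableSpace Ω :=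
  ⨆ (B : Set Plane) (_ : MeasurableSet B),
    MeasurableSpace.comap (fun ω => (N ω ∩ B).encard) inferInstance

/-- `N` is a homogeneous Poisson point process on the plane with intensity `lam`, given as a random
locally finite set of points. -/
structure IsPoissonProcess {Ω : Type*} [MeasurableSpace Ω] (P : Measure Ω) (lam : ℝ)
    (N : Ω → Set Plane) : Prop where
  locallyFinite : ∀ ω, ∀ B : Set Plane, Bornology.IsBounded B → (N ω ∩ B).Finite
  measurable_count : ∀ B : Set Plane, MeasurableSet B → Measurable fun ω => (N ω ∩ B).encard
  law_count : ∀ B : Set Plane, MeasurableSet B → Bornology.IsBounded B →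
    P.map (fun ω => (N ω ∩ B).ncard) = poissonMeasure (lam * volume.real B).toNNReal
  indep_count : ∀ (m : ℕ) (B : Fin m → Set Plane), (∀ i, MeasurableSet (B i)) →
    (Pairwise fun i j => Disjoint (B i) (B j)) →
    iIndepFun (fun i ω => (N ω ∩ B i).encard) P

/-- `y` is the point of `S` strictly above `x` that is closest to `x` (the leftmost one, should
there be several). -/
def IsAncestor (S : Set Plane) (x y : Plane) : Prop :=
  y ∈ S ∧ x 1 < y 1 ∧
    ∀ z ∈ S, x 1 < z 1 → dist x y ≤ dist x z ∧ (dist x z = dist x y → y 0 ≤ z 0)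

open Classical in
/-- The ancestor `h(x, S)`; it is `x` itself if there is no point of `S` above `x`. -/
def ancestor (S : Set Plane) (x : Plane) : Plane :=
  if hx : ∃ y, IsAncestor S x y then hx.choose else x

/-- Positions of the `k` trajectories together with the history set. -/
structure State (k : ℕ) where
  pos : Fin k → Plane
  hist : Set Plane

/-- A starting configuration: the starting points, the initial history set and the extra points. -/
structure Start (k : ℕ) where
  pts : Fin k → Plane
  hist : Set Plane
  extra : Set Plane

/-- The ordinate of the moving vertex, i.e. the lowest ordinate. -/
def level {k : ℕ} (g : Fin k → Plane) : ℝ := ⨅ i, g i 1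

/-- `g i` is the moving vertex: the leftmost vertex among those with the lowest ordinate. -/
def IsMoving {k : ℕ} (g : Fin k → Plane) (i : Fin k) : Prop :=
  (∀ j, g i 1 ≤ g j 1) ∧ ∀ j, g j 1 = g i 1 → g i 0 ≤ g j 0

/-- The set of vertices that stay. -/
def staySet {k : ℕ} (g : Fin k → Plane) : Set Plane := {x | ∃ j, ¬ IsMoving g j ∧ g j = x}

open Classical in
/-- The positions after one more move, with Poisson points `N` and extra points `X`. -/
def nextPos {k : ℕ} (N X : Set Plane) (s : State k) (i : Fin k) : Plane :=
  if IsMoving s.pos i then ancestor ((N \ s.hist) ∪ (staySet s.pos ∪ X)) (s.pos i) else s.pos i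

/-- One step of the joint exploration process. -/
def nextState {k : ℕ} (N X : Set Plane) (s : State k) : State k where
  pos := nextPos N X s
  hist := (s.hist ∪ ⋃ i, semiBall (s.pos i) (dist (nextPos N X s i) (s.pos i))) ∩
    upperHalf (level (nextPos N X s))

/-- The joint exploration process `(g_n, H_n)` started from `a`. -/
def explore {k : ℕ} (N : Set Plane) (a : Start k) : ℕ → State k
  | 0 => ⟨a.pts, a.hist⟩
  | n + 1 => nextState N a.extra (explore N a n)

/-- The ordinate of the moving vertex after `n` steps. -/
def moveLevel {k : ℕ} (N : Set Plane) (a : Start k) (n : ℕ) : ℝ := level (explore N a n).pos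

/-- The good steps `τ_j`. -/
def goodStep {k : ℕ} (κ : ℕ) (N : Set Plane) (a : Start k) : ℕ → ℕ∞
  | 0 => 0
  | j + 1 => sInf {t : ℕ∞ | ∃ n : ℕ, 1 ≤ n ∧ t = ((k * n : ℕ) : ℕ∞) ∧ goodStep κ N a j < t ∧
      height (explore N a (k * n)).hist ≤ κ ∧
      moveLevel N a (goodStep κ N a j).toNat + κ + 1 ≤ moveLevel N a (k * n)}

/-- The projection of `g i` on the horizontal line through the moving vertex. -/
def down {k : ℕ} (g : Fin k → Plane) (i : Fin k) : Plane := !₂[g i 0, level g]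

/-- The projection of `g i` on the horizontal line at distance `κ` above the moving vertex. -/
def up {k : ℕ} (κ : ℕ) (g : Fin k → Plane) (i : Fin k) : Plane := !₂[g i 0, level g + κ]

/-- The event `A_j`, that the `j`-th good step (is finite and) is a renewal step. -/
def RenewalEvent {k : ℕ} (κ : ℕ) (N : Set Plane) (a : Start k) (j : ℕ) : Prop :=
  goodStep κ N a j ≠ ⊤ ∧
    let s := explore N a (goodStep κ N a j).toNat
    ∀ i, ((semiBall (down s.pos i) (κ + 1) \ s.hist) ∩ N).encard = 1 ∧
      (semiBall (up κ s.pos i) 1 ∩ N).encard = 1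

/-- The first renewal step `β`. -/
def firstRenewal {k : ℕ} (κ : ℕ) (N : Set Plane) (a : Start k) : ℕ∞ :=
  sInf {t : ℕ∞ | 0 < t ∧ ∃ j, t = goodStep κ N a j ∧ RenewalEvent κ N a j}

/-- The starting configuration of the regenerated paths after the first renewal step. -/
def regenerate {k : ℕ} (κ : ℕ) (N : Set Plane) (a : Start k) : Start k :=
  let g := (explore N a (firstRenewal κ N a).toNat).pos
  { pts := up κ g
    hist := (⋃ i, semiBall (down g i) (κ + 1)) ∩ upperHalf (level g + κ)
    extra := N ∩ ⋃ i, semiBall (up κ g i) 1 }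

/-- The starting configuration of the regenerated paths after the `ℓ`-th renewal step. -/
def regenStart {k : ℕ} (κ : ℕ) (N : Set Plane) (a : Start k) : ℕ → Start k
  | 0 => a
  | l + 1 => regenerate κ N (regenStart κ N a l)

/-- The number `β_ℓ` of steps between the `(ℓ-1)`-th and the `ℓ`-th renewal steps (`ℓ ≥ 1`). -/
def renewalGap {k : ℕ} (κ : ℕ) (N : Set Plane) (a : Start k) (l : ℕ) : ℕ∞ :=
  firstRenewal κ N (regenStart κ N a (l - 1))

/-- The sigma-field of the information brought by the exploration process with (random) starting
configuration `a` until its first renewal step `β`: the positions up to step `β`, the step `β`, the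
extra points, the good steps up to `β`, and the occurrence of the events `A_j` up to `β`. -/
@[reducible]
def blockSigma {Ω : Type*} {k : ℕ} (κ : ℕ) (N : Ω → Set Plane) (a : Ω → Start k) :
    MeasurableSpace Ω :=
  (⨆ (n : ℕ) (i : Fin k), MeasurableSpace.comap
      (fun ω => (explore (N ω) (a ω) (min (n : ℕ∞) (firstRenewal κ (N ω) (a ω))).toNat).pos i)
      inferInstance) ⊔
  MeasurableSpace.comap (fun ω => firstRenewal κ (N ω) (a ω)) inferInstance ⊔
  pointSigma (fun ω => (a ω).extra) ⊔
  (⨆ j : ℕ, MeasurableSpace.comap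
      (fun ω => min (goodStep κ (N ω) (a ω) j) (firstRenewal κ (N ω) (a ω))) inferInstance) ⊔
  MeasurableSpace.generateFrom {S | ∃ j : ℕ, 1 ≤ j ∧ S = {ω |
      goodStep κ (N ω) (a ω) j ≤ firstRenewal κ (N ω) (a ω) ∧ RenewalEvent κ (N ω) (a ω) j}}

/-- The sigma-field `𝒢_ℓ` generated by the blocks up to the `ℓ`-th renewal step (`𝒢_0` is
trivial). -/
@[reducible]
def renewalSigma {Ω : Type*} {k : ℕ} (κ : ℕ) (N : Ω → Set Plane) (a : Ω → Start k) (l : ℕ) :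
    MeasurableSpace Ω :=
  ⨆ m ∈ Finset.Icc 1 l, blockSigma κ N (fun ω => regenStart κ (N ω) (a ω) (m - 1))

end DSF

end

noncomputable section

set_option linter.unusedSectionVars false

namespace DSF

/-! ### Planar preliminaries -/

/-! The proof combines a strong Markov property, a Lyapunov function for the exploration, and a
renewal trial at each good step.

Strong Markov property. The first `n` steps read only the points of a random region: the half-plane
below the current level, the initial history set and the explored balls. Up to a renewal step, the
region is the `zone` of the regenerated start. Such a region is the limit from outside of countably
valued ones, and it is decided by the points that it contains (`Explorable`). The restrictions of a
Poisson process to a set and to its complement are independent (`measure_restrict_inter`), so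
replacing the points outside the region by those of an independent copy does not change the law
(`Explorable.map_resample`). Conditional estimates become estimates on the copy, the explored part
being frozen.

Good steps are frequent. Let `D` be the distance from the current level to the top of the explored
region, or `6` if that is smaller. A moving vertex that is neither a starting point nor an extra
point is in the interior of no earlier ball, so there is an unexplored disc of radius `D / 10` above
it (`Nice.fresh_cusp`). With probability bounded below, this disc contains a point while a thin slab
over the vertex contains none; the step then has length at most `3 D / 5` and, unless it is special,
raises the vertex by at least `ε / D`. Steps from starting or extra points, and steps to extra
points or to other vertices, number at most `4 k` (`Nice.specialCount_le`). The energy is the sum of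
the depths of the vertices below the top, times `4 k` to the number of special steps still possible.
While the gap is at least `6`, a success lowers its square by at least `ε` (`Nice.energy_sq_succ`).
Long steps require empty discs of radius proportional to `D`, which have Gaussian probability, so
`exp (α * energy ^ 2)` contracts in mean up to an additive constant. A run of `M` successes started
at low energy contains a good step (`exists_run`). The potential `DriftParams.pot` combines this
exponential, a reward for the run in progress and a factor `1 / 2` per completed run; its mean is
multiplied by at most `γ < 1` at each step (`DriftParams.drift`). Hence the `J`-th good step exceeds
`n` with probability at most a constant times `2 ^ J * γ ^ n`.

Renewal trials. At a good step everything more than `κ` above the level is unexplored. A pigeonhole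
over scales groups the abscissas into well separated clusters; one point just below the top of one
semi-ball per cluster, and no other point in the semi-balls, forces a renewal, with probability
bounded below (`exists_pattern_prob`). Good steps are `κ + 1` apart in height, so successive trials
use new points and `J` failures have probability at most `(1 - p) ^ J`. Taking `J` proportional to
`n` gives a tail that is uniform in the start (`exists_renewal_tail`).

Conditioning. The zone of the `l`-th regenerated start decides both the sigma-field of the blocks
and the event that the process avoids the initial history set, while the next gap depends only on
the points outside that zone. So the uniform tail applies conditionally, and a shifted geometric law
dominates it. -/

/-- A set of points without accumulation points in bounded regions. -/
def LocFin (S : Set Plane) : Prop := ∀ B : Set Plane, Bornology.IsBounded B → (S ∩ B).Finite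

theorem LocFin.mono {S S' : Set Plane} (h : LocFin S') (hs : S ⊆ S') : LocFin S :=
  fun B hB => (h B hB).subset (inter_subset_inter_left _ hs)

theorem LocFin.union {S S' : Set Plane} (h : LocFin S) (h' : LocFin S') : LocFin (S ∪ S') := by
  intro B hB
  rw [union_inter_distrib_right]
  exact (h B hB).union (h' B hB)

theorem locFin_of_finite {S : Set Plane} (h : S.Finite) : LocFin S :=
  fun _ _ => h.inter_of_left _

theorem dist_sq (x y : Plane) : dist x y ^ 2 = (x 0 - y 0) ^ 2 + (x 1 - y 1) ^ 2 := by
  rw [EuclideanSpace.dist_eq, Real.sq_sqrt (by positivity), Fin.sum_univ_two]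
  simp [Real.dist_eq, sq_abs]

theorem plane_ext {x y : Plane} (h0 : x 0 = y 0) (h1 : x 1 = y 1) : x = y := by
  ext i
  fin_cases i <;> assumption

theorem dist_le_iff {x y : Plane} {r : ℝ} (hr : 0 ≤ r) :
    dist x y ≤ r ↔ (x 0 - y 0) ^ 2 + (x 1 - y 1) ^ 2 ≤ r ^ 2 := by
  rw [← dist_sq, sq_le_sq₀ dist_nonneg hr]

theorem le_dist_iff {x y : Plane} {r : ℝ} (hr : 0 ≤ r) :
    r ≤ dist x y ↔ r ^ 2 ≤ (x 0 - y 0) ^ 2 + (x 1 - y 1) ^ 2 := by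
  rw [← dist_sq, sq_le_sq₀ hr dist_nonneg]

theorem abs_coord_le_dist (x y : Plane) (i : Fin 2) : |x i - y i| ≤ dist x y := by
  have h := dist_sq x y
  have : |x i - y i| ^ 2 ≤ dist x y ^ 2 := by
    rw [sq_abs, h]
    fin_cases i
    · simp; positivity
    · simp; positivity
  exact (sq_le_sq₀ (abs_nonneg _) dist_nonneg).1 this

theorem coord_sub_le_dist (x y : Plane) (i : Fin 2) : x i - y i ≤ dist x y :=
  (le_abs_self _).trans (abs_coord_le_dist x y i)

/-! ### Ancestors -/

/-- Equal distances and equal abscissas leave two ordinates, symmetric about that of `x`; only one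
of them is above `x`. -/
theorem isAncestor_unique {S : Set Plane} {x y z : Plane} (hy : IsAncestor S x y)
    (hz : IsAncestor S x z) : y = z := by
  have h1 := hy.2.2 z hz.1 hz.2.1
  have h2 := hz.2.2 y hy.1 hy.2.1
  have hd : dist x y = dist x z := le_antisymm h1.1 h2.1
  have h0 : y 0 = z 0 := le_antisymm (h1.2 hd.symm) (h2.2 hd)
  have e1 := dist_sq x y
  have e2 := dist_sq x z
  rw [hd, e2, h0] at e1
  have : (x 1 - z 1) ^ 2 = (x 1 - y 1) ^ 2 := by linarith
  refine plane_ext h0 ?_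
  have hy1 := hy.2.1
  have hz1 := hz.2.1
  nlinarith

/-- Only the finitely many points within distance `dist x z` compete, and the lexicographic minimum
of (distance, abscissa) wins. -/
theorem exists_isAncestor {S : Set Plane} (hS : LocFin S) {x : Plane}
    (h : ∃ z ∈ S, x 1 < z 1) : ∃ y, IsAncestor S x y := by
  obtain ⟨z, hz, hxz⟩ := h
  set F : Set Plane := {y | y ∈ S ∧ x 1 < y 1 ∧ dist x y ≤ dist x z} with hF
  have hfin : F.Finite := by
    refine (hS (Metric.closedBall x (dist x z)) Metric.isBounded_closedBall).subset ?_
    rintro y ⟨h1, -, h2⟩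
    exact ⟨h1, by rwa [Metric.mem_closedBall, dist_comm]⟩
  obtain ⟨y, hyF, hy⟩ := hfin.exists_minimalFor (fun y => toLex (dist x y, y 0)) F
    ⟨z, hz, hxz, le_rfl⟩
  have hy' : ∀ v ∈ F, toLex (dist x y, y 0) ≤ toLex (dist x v, v 0) := by
    intro v hv
    rcases le_total (toLex (dist x y, y 0)) (toLex (dist x v, v 0)) with h | h
    · exact h
    · exact hy hv h
  refine ⟨y, hyF.1, hyF.2.1, fun v hv hxv => ?_⟩
  by_cases hd : dist x v ≤ dist x z
  · have := hy' v ⟨hv, hxv, hd⟩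
    rw [Prod.Lex.toLex_le_toLex] at this
    rcases this with h | ⟨h, h'⟩
    · exact ⟨h.le, fun e => absurd e (ne_of_gt h)⟩
    · exact ⟨h.le, fun _ => h'⟩
  · push Not at hd
    have := hyF.2.2
    exact ⟨by linarith, fun e => by linarith⟩

theorem ancestor_eq {S : Set Plane} {x y : Plane} (h : IsAncestor S x y) : ancestor S x = y := by
  have hx : ∃ y, IsAncestor S x y := ⟨y, h⟩
  rw [ancestor, dif_pos hx]
  exact isAncestor_unique hx.choose_spec h

theorem ancestor_of_not {S : Set Plane} {x : Plane} (h : ¬ ∃ y, IsAncestor S x y) :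
    ancestor S x = x := by
  rw [ancestor, dif_neg h]

/-- The source of the locality statements: the choice of `y` only consults the upper half-ball
around `x` through `y`. -/
theorem isAncestor_congr {S S' : Set Plane} {x y : Plane} (h : IsAncestor S x y)
    (hS : ∀ z, x 1 < z 1 → dist x z ≤ dist x y → (z ∈ S ↔ z ∈ S')) : IsAncestor S' x y := by
  refine ⟨(hS y h.2.1 le_rfl).1 h.1, h.2.1, fun z hz hxz => ?_⟩
  by_cases hd : dist x z ≤ dist x y
  · exact h.2.2 z ((hS z hxz hd).2 hz) hxz
  · push Not at hd
    exact ⟨hd.le, fun e => by linarith⟩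

/-- The ancestor depends only on the points strictly above the vertex. -/
theorem ancestor_congr {S S' : Set Plane} {x : Plane}
    (hS : ∀ z, x 1 < z 1 → (z ∈ S ↔ z ∈ S')) : ancestor S x = ancestor S' x := by
  by_cases h : ∃ y, IsAncestor S x y
  · obtain ⟨y, hy⟩ := h
    rw [ancestor_eq hy, ancestor_eq (isAncestor_congr hy fun z hz _ => hS z hz)]
  · have h' : ¬ ∃ y, IsAncestor S' x y := fun ⟨y, hy⟩ =>
      h ⟨y, isAncestor_congr hy fun z hz _ => (hS z hz).symm⟩
    rw [ancestor_of_not h, ancestor_of_not h']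

theorem le_ancestor (S : Set Plane) (x : Plane) : x 1 ≤ ancestor S x 1 := by
  by_cases h : ∃ y, IsAncestor S x y
  · obtain ⟨y, hy⟩ := h
    rw [ancestor_eq hy]
    exact hy.2.1.le
  · rw [ancestor_of_not h]

/-- Either the ancestor is a genuine one, or there is none. -/
theorem ancestor_cases (S : Set Plane) (x : Plane) :
    IsAncestor S x (ancestor S x) ∨ ancestor S x = x := by
  by_cases h : ∃ y, IsAncestor S x y
  · obtain ⟨y, hy⟩ := h
    rw [ancestor_eq hy]
    exact Or.inl hy
  · exact Or.inr (ancestor_of_not h)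

theorem dist_ancestor_le {S : Set Plane} {x z : Plane} (hz : z ∈ S) (hxz : x 1 < z 1) :
    dist x (ancestor S x) ≤ dist x z := by
  rcases ancestor_cases S x with h | h
  · exact (h.2.2 z hz hxz).1
  · rw [h, dist_self]; exact dist_nonneg

/-! ### Levels and moving vertices -/

section Level

variable {k : ℕ} [NeZero k]

theorem level_le (g : Fin k → Plane) (i : Fin k) : level g ≤ g i 1 :=
  ciInf_le (Set.finite_range _).bddBelow i

theorem le_level {g : Fin k → Plane} {t : ℝ} (h : ∀ i, t ≤ g i 1) : t ≤ level g :=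
  le_ciInf h

theorem exists_isMoving (g : Fin k → Plane) : ∃ i, IsMoving g i := by
  obtain ⟨i, hi⟩ := Finite.exists_min (fun i => toLex (g i 1, g i 0))
  refine ⟨i, fun j => ?_, fun j hj => ?_⟩
  · have := hi j
    rw [Prod.Lex.toLex_le_toLex] at this
    rcases this with h | h
    · exact h.le
    · exact h.1.le
  · have := hi j
    rw [Prod.Lex.toLex_le_toLex] at this
    rcases this with h | h
    · exact absurd hj (ne_of_gt h)
    · exact h.2

theorem IsMoving.level_eq {g : Fin k → Plane} {i : Fin k} (h : IsMoving g i) : g i 1 = level g :=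
  le_antisymm (le_level h.1) (level_le g i)

theorem IsMoving.eq {g : Fin k → Plane} {i j : Fin k} (hi : IsMoving g i) (hj : IsMoving g j) :
    g i = g j := by
  have h1 : g i 1 = g j 1 := by rw [hi.level_eq, hj.level_eq]
  exact plane_ext (le_antisymm (hi.2 j h1.symm) (hj.2 i h1)) h1

theorem isMoving_of_eq {g : Fin k → Plane} {i j : Fin k} (hi : IsMoving g i) (h : g j = g i) :
    IsMoving g j := by
  unfold IsMoving
  rw [h]
  exact hi

end Level

theorem staySet_subset {k : ℕ} (g : Fin k → Plane) : staySet g ⊆ range g := by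
  rintro x ⟨j, -, rfl⟩
  exact ⟨j, rfl⟩

theorem staySet_finite {k : ℕ} (g : Fin k → Plane) : (staySet g).Finite :=
  (finite_range g).subset (staySet_subset g)

/-! ### One step of the exploration process -/

section Explore

variable {k : ℕ} (N : Set Plane) (a : Start k)

/-- The position of the `i`-th trajectory after `n` steps. -/
def pos (n : ℕ) (i : Fin k) : Plane := (explore N a n).pos i

/-- The history set after `n` steps. -/
def hist (n : ℕ) : Set Plane := (explore N a n).hist

/-- The set of candidates for the next ancestor. -/
def cand (n : ℕ) : Set Plane := (N \ hist N a n) ∪ (staySet (pos N a n) ∪ a.extra)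

theorem pos_zero : pos N a 0 = a.pts := rfl

theorem hist_zero : hist N a 0 = a.hist := rfl

theorem pos_succ (n : ℕ) (i : Fin k) : pos N a (n + 1) i =
    nextPos N a.extra (explore N a n) i := rfl

theorem pos_succ_of_not {n : ℕ} {i : Fin k} (h : ¬ IsMoving (pos N a n) i) :
    pos N a (n + 1) i = pos N a n i := by
  exact if_neg h

theorem pos_succ_of_moving {n : ℕ} {i : Fin k} (h : IsMoving (pos N a n) i) :
    pos N a (n + 1) i = ancestor (cand N a n) (pos N a n i) := by
  exact if_pos h

theorem hist_succ (n : ℕ) : hist N a (n + 1) = (hist N a n ∪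
    ⋃ i, semiBall (pos N a n i) (dist (pos N a (n + 1) i) (pos N a n i))) ∩
      upperHalf (moveLevel N a (n + 1)) := rfl

theorem pos_le_succ (n : ℕ) (i : Fin k) : pos N a n i 1 ≤ pos N a (n + 1) i 1 := by
  by_cases h : IsMoving (pos N a n) i
  · rw [pos_succ_of_moving N a h]
    exact le_ancestor _ _
  · rw [pos_succ_of_not N a h]

variable [NeZero k]

theorem moveLevel_le_pos (n : ℕ) (i : Fin k) : moveLevel N a n ≤ pos N a n i 1 :=
  level_le _ i

theorem moveLevel_mono : Monotone (moveLevel N a) :=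
  monotone_nat_of_le_succ fun n =>
    le_level fun i => (moveLevel_le_pos N a n i).trans (pos_le_succ N a n i)

theorem IsMoving.moveLevel_eq {n : ℕ} {i : Fin k} (h : IsMoving (pos N a n) i) :
    pos N a n i 1 = moveLevel N a n := h.level_eq

/-- The length of the step `n → n + 1`. -/
def stepLen (n : ℕ) : ℝ := ⨆ i, dist (pos N a (n + 1) i) (pos N a n i)

theorem stepLen_eq {n : ℕ} {i : Fin k} (h : IsMoving (pos N a n) i) :
    stepLen N a n = dist (pos N a (n + 1) i) (pos N a n i) := by
  refine le_antisymm (ciSup_le fun j => ?_) (le_ciSup (f := fun i => dist (pos N a (n + 1) i)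
    (pos N a n i)) (Set.finite_range _).bddAbove i)
  by_cases hj : IsMoving (pos N a n) j
  · rw [pos_succ_of_moving N a hj, pos_succ_of_moving N a h, h.eq hj]
  · rw [pos_succ_of_not N a hj, dist_self]
    exact dist_nonneg

theorem dist_le_stepLen (n : ℕ) (i : Fin k) :
    dist (pos N a (n + 1) i) (pos N a n i) ≤ stepLen N a n :=
  le_ciSup (f := fun i => dist (pos N a (n + 1) i) (pos N a n i))
    (Set.finite_range _).bddAbove i

theorem stepLen_nonneg (n : ℕ) : 0 ≤ stepLen N a n :=
  dist_nonneg.trans (dist_le_stepLen N a n 0)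

/-- A candidate strictly above the current level bounds the length of the step. -/
theorem stepLen_le {n : ℕ} {i : Fin k} (h : IsMoving (pos N a n) i) {y : Plane}
    (hy : y ∈ cand N a n) (hl : moveLevel N a n < y 1) :
    stepLen N a n ≤ dist (pos N a n i) y := by
  rw [stepLen_eq N a h, pos_succ_of_moving N a h, dist_comm]
  exact dist_ancestor_le hy (by rwa [h.moveLevel_eq])

theorem cand_locFin (hN : LocFin N) (hX : LocFin a.extra) (n : ℕ) : LocFin (cand N a n) :=
  (hN.mono sdiff_subset).union ((locFin_of_finite (staySet_finite _)).union hX)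

/-- If there is a candidate, then the moving vertex goes to its ancestor. -/
theorem isAncestor_pos_succ (hN : LocFin N) (hX : LocFin a.extra) {n : ℕ} {i : Fin k}
    (h : IsMoving (pos N a n) i) (hy : ∃ y ∈ cand N a n, moveLevel N a n < y 1) :
    IsAncestor (cand N a n) (pos N a n i) (pos N a (n + 1) i) := by
  rw [pos_succ_of_moving N a h]
  obtain ⟨z, hz⟩ := exists_isAncestor (cand_locFin N a hN hX n) (x := pos N a n i)
    (by rwa [h.moveLevel_eq])
  rw [ancestor_eq hz]
  exact hz

/-- The history set, explicitly. -/
theorem hist_eq (h0 : ∀ x ∈ a.hist, level a.pts ≤ x 1) (n : ℕ) : hist N a n = (a.hist ∪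
    ⋃ j : Fin n, ⋃ i, semiBall (pos N a j i) (dist (pos N a (j + 1) i) (pos N a j i))) ∩
      upperHalf (moveLevel N a n) := by
  induction n with
  | zero =>
    ext x
    simp only [hist_zero, iUnion_of_empty, union_empty, mem_inter_iff]
    exact ⟨fun h => ⟨h, h0 x h⟩, fun h => h.1⟩
  | succ n ih =>
    rw [hist_succ, ih]
    ext x
    simp only [mem_inter_iff, mem_union, mem_iUnion, upperHalf, mem_ofPred_eq]
    have hm := moveLevel_mono N a (Nat.le_succ n)
    constructor
    · rintro ⟨(⟨h | ⟨j, i, h⟩, -⟩ | ⟨i, h⟩), hx⟩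
      · exact ⟨Or.inl h, hx⟩
      · exact ⟨Or.inr ⟨j.castSucc, i, h⟩, hx⟩
      · exact ⟨Or.inr ⟨Fin.last n, i, h⟩, hx⟩
    · rintro ⟨h | ⟨j, i, h⟩, hx⟩
      · exact ⟨Or.inl ⟨Or.inl h, hm.trans hx⟩, hx⟩
      · induction j using Fin.lastCases with
        | last => exact ⟨Or.inr ⟨i, h⟩, hx⟩
        | cast j => exact ⟨Or.inl ⟨Or.inr ⟨j, i, h⟩, hm.trans hx⟩, hx⟩

theorem mem_hist_iff (h0 : ∀ x ∈ a.hist, level a.pts ≤ x 1) {n : ℕ} {x : Plane} :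
    x ∈ hist N a n ↔ (x ∈ a.hist ∨ ∃ j < n, ∃ i, dist x (pos N a j i) ≤
      dist (pos N a (j + 1) i) (pos N a j i) ∧ pos N a j i 1 ≤ x 1) ∧ moveLevel N a n ≤ x 1 := by
  rw [hist_eq N a h0]
  simp only [mem_inter_iff, mem_union, mem_iUnion, upperHalf, mem_ofPred_eq, semiBall,
    Metric.mem_closedBall]
  constructor
  · rintro ⟨h | ⟨j, i, h⟩, hx⟩
    · exact ⟨Or.inl h, hx⟩
    · exact ⟨Or.inr ⟨j, j.2, i, h⟩, hx⟩
  · rintro ⟨h | ⟨j, hj, i, h⟩, hx⟩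
    · exact ⟨Or.inl h, hx⟩
    · exact ⟨Or.inr ⟨⟨j, hj⟩, i, h⟩, hx⟩

/-- After the first step, the current positions belong to the history set. -/
theorem pos_mem_hist (n : ℕ) (i : Fin k) : pos N a (n + 1) i ∈ hist N a (n + 1) := by
  rw [hist_succ]
  refine ⟨Or.inr (mem_iUnion.2 ⟨i, ?_, ?_⟩), moveLevel_le_pos N a _ i⟩
  · exact Metric.mem_closedBall.2 le_rfl
  · exact pos_le_succ N a n i

/-! ### The top of the explored region -/

variable (κ : ℕ)

/-- An upper bound for the ordinates explored in the first `n` steps. -/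
def top : ℕ → ℝ
  | 0 => level a.pts + κ
  | n + 1 => max (top n) (moveLevel N a n + stepLen N a n)

theorem top_succ (n : ℕ) : top N a κ (n + 1) =
    max (top N a κ n) (moveLevel N a n + stepLen N a n) := rfl

theorem top_mono : Monotone (top N a κ) :=
  monotone_nat_of_le_succ fun _ => le_max_left _ _

theorem ball_le_top {j n : ℕ} (h : j < n) : moveLevel N a j + stepLen N a j ≤ top N a κ n :=
  (le_max_right _ _).trans (top_mono N a κ h)

variable {κ}

theorem pos_le_top (hu : ∀ i j, |a.pts i 1 - a.pts j 1| ≤ κ) (n : ℕ) (i : Fin k) :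
    pos N a n i 1 ≤ top N a κ n := by
  induction n generalizing i with
  | zero =>
    obtain ⟨j, hj⟩ := exists_isMoving a.pts
    have := (abs_le.1 (hu i j)).2
    rw [hj.level_eq] at this
    simp only [pos_zero, top]
    linarith
  | succ n ih =>
    by_cases h : IsMoving (pos N a n) i
    · rw [top_succ]
      refine le_max_of_le_right ?_
      rw [stepLen_eq N a h, ← h.moveLevel_eq]
      have := coord_sub_le_dist (pos N a (n + 1) i) (pos N a n i) 1
      linarith
    · rw [pos_succ_of_not N a h]
      exact (ih i).trans (top_mono N a κ (Nat.le_succ n))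

theorem moveLevel_le_top (hu : ∀ i j, |a.pts i 1 - a.pts j 1| ≤ κ) (n : ℕ) :
    moveLevel N a n ≤ top N a κ n :=
  (moveLevel_le_pos N a n 0).trans (pos_le_top N a hu n 0)

theorem hist_le_top (hu : ∀ i j, |a.pts i 1 - a.pts j 1| ≤ κ) (hκ : 1 ≤ κ)
    (h0 : ∀ x ∈ a.hist, level a.pts ≤ x 1 ∧ x 1 ≤ level a.pts + 1) {n : ℕ} {x : Plane}
    (hx : x ∈ hist N a n) : x 1 ≤ top N a κ n := by
  have hκ' : (1 : ℝ) ≤ κ := by exact_mod_cast hκ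
  rcases ((mem_hist_iff N a fun x hx => (h0 x hx).1).1 hx).1 with h | ⟨j, hj, i, h, -⟩
  · have h1 := (h0 x h).2
    have h2 : level a.pts + κ ≤ top N a κ n := top_mono N a κ (Nat.zero_le n)
    linarith
  · by_cases hm : IsMoving (pos N a j) i
    · have h1 := ball_le_top N a κ hj
      rw [stepLen_eq N a hm, ← hm.moveLevel_eq] at h1
      have h2 := coord_sub_le_dist x (pos N a j i) 1
      linarith
    · rw [pos_succ_of_not N a hm, dist_self] at h
      have : x = pos N a j i := dist_le_zero.1 h
      rw [this]
      exact (pos_le_top N a hu j i).trans (top_mono N a κ hj.le)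

theorem le_of_mem_hist (h0 : ∀ x ∈ a.hist, level a.pts ≤ x 1) {n : ℕ} {x : Plane}
    (hx : x ∈ hist N a n) : moveLevel N a n ≤ x 1 :=
  ((mem_hist_iff N a h0).1 hx).2

theorem height_hist_le (hu : ∀ i j, |a.pts i 1 - a.pts j 1| ≤ κ) (hκ : 1 ≤ κ)
    (h0 : ∀ x ∈ a.hist, level a.pts ≤ x 1 ∧ x 1 ≤ level a.pts + 1) (n : ℕ) :
    height (hist N a n) ≤ top N a κ n - moveLevel N a n := by
  refine Real.sSup_le ?_ (sub_nonneg.2 (moveLevel_le_top N a hu n))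
  rintro t ⟨x, hx, y, hy, rfl⟩
  have h1 := hist_le_top N a hu hκ h0 hy
  have h2 := le_of_mem_hist N a (fun x hx => (h0 x hx).1) hx
  linarith

/-- `sSup` of an unbounded set is `0`, so without this bound `height ≤ κ` would say nothing about
individual points. -/
theorem bddAbove_height (hu : ∀ i j, |a.pts i 1 - a.pts j 1| ≤ κ) (hκ : 1 ≤ κ)
    (h0 : ∀ x ∈ a.hist, level a.pts ≤ x 1 ∧ x 1 ≤ level a.pts + 1) (n : ℕ) :
    BddAbove {t | ∃ x ∈ hist N a n, ∃ y ∈ hist N a n, t = y 1 - x 1} := by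
  refine ⟨top N a κ n - moveLevel N a n, ?_⟩
  rintro t ⟨x, hx, y, hy, rfl⟩
  have h1 := hist_le_top N a hu hκ h0 hy
  have h2 := le_of_mem_hist N a (fun x hx => (h0 x hx).1) hx
  linarith

/-- The top point of a semi-ball. -/
theorem top_mem_semiBall (x : Plane) {r : ℝ} (hr : 0 ≤ r) :
    (!₂[x 0, x 1 + r] : Plane) ∈ semiBall x r := by
  refine ⟨?_, ?_⟩
  · rw [Metric.mem_closedBall, dist_le_iff hr]
    simp
  · simp [upperHalf, hr]

/-- After the first step, the height of the history set is at most `κ` iff no explored semi-ball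
reaches more than `κ` above the current level. -/
theorem height_hist_le_iff (hu : ∀ i j, |a.pts i 1 - a.pts j 1| ≤ κ) (hκ : 1 ≤ κ)
    (h0 : ∀ x ∈ a.hist, level a.pts ≤ x 1 ∧ x 1 ≤ level a.pts + 1) {n : ℕ} (hn : 1 ≤ n) :
    height (hist N a n) ≤ κ ↔ ∀ j < n, ∀ i, pos N a j i 1 +
      dist (pos N a (j + 1) i) (pos N a j i) ≤ moveLevel N a n + κ := by
  have hκ' : (1 : ℝ) ≤ κ := by exact_mod_cast hκ
  have h0' : ∀ x ∈ a.hist, level a.pts ≤ x 1 := fun x hx => (h0 x hx).1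
  constructor
  · intro h j hj i
    by_contra! hlt
    obtain ⟨m, rfl⟩ : ∃ m, n = m + 1 := ⟨n - 1, by omega⟩
    obtain ⟨i0, hi0⟩ := exists_isMoving (pos N a (m + 1))
    -- The top of an offending ball and the moving vertex both lie in the history set, and their
    -- ordinates differ by more than `κ`.
    have ht : (!₂[pos N a j i 0, pos N a j i 1 + dist (pos N a (j + 1) i) (pos N a j i)] : Plane)
        ∈ hist N a (m + 1) := by
      have := top_mem_semiBall (pos N a j i)
        (dist_nonneg (x := pos N a (j + 1) i) (y := pos N a j i))
      refine (mem_hist_iff N a h0').2 ⟨Or.inr ⟨j, hj, i, this.1, this.2⟩, ?_⟩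
      simp
      linarith
    have := le_csSup (bddAbove_height N a hu hκ h0 (m + 1))
      ⟨_, pos_mem_hist N a m i0, _, ht, rfl⟩
    rw [hi0.moveLevel_eq] at this
    have h2 : height (hist N a (m + 1)) = sSup _ := rfl
    rw [h2] at h
    simp at this
    linarith
  · intro h
    refine Real.sSup_le ?_ (by positivity)
    rintro t ⟨x, hx, y, hy, rfl⟩
    have hxl := le_of_mem_hist N a h0' hx
    rcases ((mem_hist_iff N a h0').1 hy).1 with hy | ⟨j, hj, i, hd, -⟩
    · have h1 := (h0 y hy).2
      have h2 : level a.pts ≤ moveLevel N a n := moveLevel_mono N a (Nat.zero_le n)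
      linarith
    · have h1 := h j hj i
      have h2 := coord_sub_le_dist y (pos N a j i) 1
      linarith

end Explore

/-! ### The space of locally finite configurations -/

/-- The space of locally finite configurations of points in the plane. -/
structure Conf : Type where
  /-- the set of points -/
  carrier : Set Plane
  locFin : LocFin carrier

instance instMeasurableSpaceConf : MeasurableSpace Conf := pointSigma (fun c : Conf => c.1)

theorem Conf.ext {c c' : Conf} (h : ∀ y, y ∈ c.1 ↔ y ∈ c'.1) : c = c' := by
  obtain ⟨S, hS⟩ := c
  obtain ⟨S', hS'⟩ := c'
  obtain rfl : S = S' := Set.ext h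
  rfl

theorem measurable_count {B : Set Plane} (hB : MeasurableSet B) :
    Measurable fun c : Conf => (c.1 ∩ B).encard :=
  Measurable.of_comap_le (le_iSup₂_of_le (f := fun (B : Set Plane) (_ : MeasurableSet B) =>
    MeasurableSpace.comap (fun c : Conf => (c.1 ∩ B).encard) inferInstance) B hB le_rfl)

theorem measurable_conf {Ω : Type*} [MeasurableSpace Ω] {f : Ω → Conf}
    (h : ∀ B : Set Plane, MeasurableSet B → Measurable fun ω => ((f ω).1 ∩ B).encard) :
    Measurable f := by
  refine Measurable.of_comap_le ?_
  change MeasurableSpace.comap f (⨆ (B : Set Plane) (_ : MeasurableSet B), _) ≤ _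
  simp only [MeasurableSpace.comap_iSup, MeasurableSpace.comap_comp]
  exact iSup₂_le fun B hB => (h B hB).comap_le

/-- Restriction of a configuration to a set. -/
def Conf.restrict (K : Set Plane) (c : Conf) : Conf := ⟨c.1 ∩ K, c.2.mono inter_subset_left⟩

theorem measurable_restrict {K : Set Plane} (hK : MeasurableSet K) :
    Measurable (Conf.restrict K) := by
  refine measurable_conf fun B hB => ?_
  simp only [Conf.restrict, inter_assoc]
  exact measurable_count (hK.inter hB)

theorem mem_restrict_iff {K : Set Plane} {c : Conf} {y : Plane} :
    y ∈ (Conf.restrict K c).1 ↔ y ∈ c.1 ∧ y ∈ K := Iff.rfl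

/-- The configuration that agrees with `c` in `K` and with `c'` outside `K`. -/
def Conf.glue (K : Set Plane) (c c' : Conf) : Conf :=
  ⟨(c.1 ∩ K) ∪ (c'.1 \ K), (c.2.mono inter_subset_left).union (c'.2.mono sdiff_subset)⟩

theorem mem_glue_iff {K : Set Plane} {c c' : Conf} {y : Plane} :
    y ∈ (Conf.glue K c c').1 ↔ (y ∈ K ∧ y ∈ c.1) ∨ (y ∉ K ∧ y ∈ c'.1) := by
  simp [Conf.glue, and_comm]

theorem measurable_glue {K : Set Plane} (hK : MeasurableSet K) :
    Measurable fun p : Conf × Conf => Conf.glue K p.1 p.2 := by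
  refine measurable_conf fun B hB => ?_
  have : (fun p : Conf × Conf => ((Conf.glue K p.1 p.2).1 ∩ B).encard) = fun p =>
      (p.1.1 ∩ (K ∩ B)).encard + (p.2.1 ∩ (Kᶜ ∩ B)).encard := by
    ext1 p
    rw [← encard_union_eq]
    · congr 1
      ext y
      simp only [mem_inter_iff, mem_glue_iff, mem_union, mem_compl_iff]
      tauto
    · rw [Set.disjoint_left]
      rintro y ⟨-, h, -⟩ ⟨-, h', -⟩
      exact h' h
  rw [this]
  exact ((measurable_count (hK.inter hB)).comp measurable_fst).add
    ((measurable_count (hK.compl.inter hB)).comp measurable_snd)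

/-- The events specifying finitely many counts in bounded sets. -/
def cylinders : Set (Set Conf) :=
  {E | ∃ l : List (Set Plane × ℕ∞), (∀ p ∈ l, MeasurableSet p.1 ∧ Bornology.IsBounded p.1) ∧
    E = {c | ∀ p ∈ l, (c.1 ∩ p.1).encard = p.2}}

theorem isPiSystem_cylinders : IsPiSystem cylinders := by
  rintro E ⟨l, hl, rfl⟩ E' ⟨l', hl', rfl⟩ -
  refine ⟨l ++ l', fun p hp => ?_, ?_⟩
  · rcases List.mem_append.1 hp with h | h
    · exact hl p h
    · exact hl' p h
  · ext c
    simp only [mem_inter_iff, mem_ofPred_eq, List.mem_append, or_imp, forall_and]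

/-- Reduces counts in arbitrary sets to counts in bounded ones, the only sets that cylinders see.
Testing against finite `n` also covers infinite counts, since any `n` of the points lie in one
window. -/
theorem encard_inter_eq_iSup (S B : Set Plane) :
    (S ∩ B).encard = ⨆ m : ℕ, (S ∩ (B ∩ Metric.closedBall 0 m)).encard := by
  refine le_antisymm ?_ (iSup_le fun m => encard_le_encard
    (inter_subset_inter_right _ inter_subset_left))
  refine ENat.forall_natCast_le_iff_le.1 fun n hn => ?_
  obtain ⟨t, ht, htn⟩ := exists_subset_encard_eq hn
  have hfin : t.Finite := finite_of_encard_eq_coe htn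
  obtain ⟨r, hr⟩ := hfin.isBounded.subset_closedBall (0 : Plane)
  obtain ⟨m, hm⟩ := exists_nat_ge r
  rw [← htn]
  refine le_iSup_of_le m (encard_le_encard fun y hy => ⟨(ht hy).1, (ht hy).2, ?_⟩)
  exact Metric.closedBall_subset_closedBall hm (hr hy)

/-- Every subset of the countable space `ℕ∞` is Borel; this gives access to measurability of suprema
and infima of counts and steps. -/
theorem borelSpace_enat : BorelSpace ℕ∞ := by
  refine ⟨le_antisymm (fun s _ => ?_) le_top⟩
  let _ : MeasurableSpace ℕ∞ := borel ℕ∞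
  have : BorelSpace ℕ∞ := ⟨rfl⟩
  exact (Set.to_countable s).measurableSet

theorem generateFrom_cylinders :
    instMeasurableSpaceConf = MeasurableSpace.generateFrom cylinders := by
  apply le_antisymm
  · refine iSup₂_le fun B hB => ?_
    refine Measurable.comap_le (m₁ := MeasurableSpace.generateFrom cylinders) ?_
    let _ : MeasurableSpace Conf := MeasurableSpace.generateFrom cylinders
    have key : ∀ B : Set Plane, MeasurableSet B → Bornology.IsBounded B →
        Measurable fun c : Conf => (c.1 ∩ B).encard := by
      intro B hB hb
      refine measurable_to_countable' fun n => MeasurableSpace.measurableSet_generateFrom ?_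
      refine ⟨[(B, n)], by simpa using ⟨hB, hb⟩, ?_⟩
      ext c
      simp
    have : (fun c : Conf => (c.1 ∩ B).encard) =
        fun c => ⨆ m : ℕ, (c.1 ∩ (B ∩ Metric.closedBall 0 m)).encard := by
      ext1 c
      exact encard_inter_eq_iSup _ _
    rw [this]
    have := borelSpace_enat
    refine Measurable.iSup fun m => key _ (hB.inter Metric.isClosed_closedBall.measurableSet)
      (Metric.isBounded_closedBall.subset inter_subset_right)
  · refine MeasurableSpace.generateFrom_le ?_
    rintro E ⟨l, hl, rfl⟩
    have : {c : Conf | ∀ p ∈ l, (c.1 ∩ p.1).encard = p.2} =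
        ⋂ p ∈ l, {c : Conf | (c.1 ∩ p.1).encard = p.2} := by
      ext c; simp
    rw [this]
    exact MeasurableSet.biInter (List.finite_toSet l).countable fun p hp =>
      measurable_count (hl p hp).1 (measurableSet_singleton p.2)

theorem measurableSet_cylinder {E : Set Conf} (h : E ∈ cylinders) : MeasurableSet E := by
  rw [generateFrom_cylinders]
  exact MeasurableSpace.measurableSet_generateFrom h

theorem measurable_of_cylinders {Ω : Type*} [MeasurableSpace Ω] {f : Ω → Conf}
    (h : ∀ E ∈ cylinders, MeasurableSet (f ⁻¹' E)) : Measurable f := by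
  have h' := @measurable_generateFrom Ω Conf _ cylinders f h
  rwa [← generateFrom_cylinders] at h'

/-! ### Independence of the restrictions to complementary sets -/

section Poisson

variable {L : Measure Conf} {lam : ℝ}

/-- The cells of the partition generated by a list of sets. -/
def cell (K : Set Plane) (l : List (Set Plane × ℕ∞)) (s : Fin l.length → Bool) : Set Plane :=
  {x | x ∈ K ∧ ∀ i, x ∈ (l.get i).1 ↔ s i = true}

theorem measurableSet_cell {K : Set Plane} (hK : MeasurableSet K) {l : List (Set Plane × ℕ∞)}
    (hl : ∀ p ∈ l, MeasurableSet p.1) (s : Fin l.length → Bool) : MeasurableSet (cell K l s) := by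
  refine hK.inter ?_
  change MeasurableSet {x : Plane | ∀ i, x ∈ (l.get i).1 ↔ s i = true}
  rw [ofPred_forall]
  refine MeasurableSet.iInter fun i => ?_
  cases s i
  · simp only [Bool.false_eq_true, iff_false]
    exact (hl _ (List.get_mem l i)).compl
  · simp only [iff_true]
    exact hl _ (List.get_mem l i)

theorem disjoint_cell (K : Set Plane) (l : List (Set Plane × ℕ∞)) :
    Pairwise (Function.onFun Disjoint (cell K l)) := by
  intro s t hst
  rw [Function.onFun, Set.disjoint_left]
  rintro x ⟨-, h1⟩ ⟨-, h2⟩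
  refine hst (funext fun i => ?_)
  have := (h1 i).symm.trans (h2 i)
  exact Bool.eq_iff_iff.2 this

open Classical in
-- The sets of a list may overlap, whereas independence is assumed for disjoint sets. The cells are
-- disjoint and their counts determine all the others.
theorem encard_eq_sum_cell (S K : Set Plane) (l : List (Set Plane × ℕ∞)) (i : Fin l.length) :
    (S ∩ (K ∩ (l.get i).1)).encard =
      ∑ s : Fin l.length → Bool, if s i = true then (S ∩ cell K l s).encard else 0 := by
  have : S ∩ (K ∩ (l.get i).1) = ⋃ s : Fin l.length → Bool,
      (if s i = true then S ∩ cell K l s else ∅) := by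
    ext x
    simp only [mem_inter_iff, mem_iUnion]
    constructor
    · rintro ⟨h1, h2, h3⟩
      refine ⟨fun j => decide (x ∈ (l.get j).1), ?_⟩
      rw [if_pos (by simpa using h3)]
      exact ⟨h1, h2, fun j => by simp⟩
    · rintro ⟨s, hs⟩
      by_cases h : s i = true
      · rw [if_pos h] at hs
        exact ⟨hs.1, hs.2.1, (hs.2.2 i).2 h⟩
      · rw [if_neg h] at hs
        exact absurd hs (notMem_empty x)
  rw [this, encard_iUnion_of_finite, finsum_eq_sum_of_fintype]
  · refine Finset.sum_congr rfl fun s _ => ?_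
    split_ifs <;> simp
  · intro s t hst
    have := disjoint_cell K l hst
    simp only [Function.onFun]
    split_ifs
    · exact this.mono inter_subset_right inter_subset_right
    all_goals simp

theorem iIndepFun_counts (hL : IsPoissonProcess L lam (fun c : Conf => c.1)) {ι : Type*}
    [Fintype ι] (B : ι → Set Plane) (hB : ∀ i, MeasurableSet (B i))
    (hd : Pairwise fun i j => Disjoint (B i) (B j)) :
    iIndepFun (fun i (c : Conf) => (c.1 ∩ B i).encard) L := by
  let e := Fintype.equivFin ι
  have h := hL.indep_count (Fintype.card ι) (fun i => B (e.symm i)) (fun i => hB _)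
    (fun i j hij => hd (fun h => hij (e.symm.injective h)))
  have h2 := h.precomp (g := e) e.injective
  simpa using h2

/-- Cylinders form a π-system, so it is enough to treat finitely many counts inside `K` and finitely
many outside. Cutting along cells turns these into functions of two disjoint families of independent
counts. -/
theorem measure_restrict_inter [IsProbabilityMeasure L]
    (hL : IsPoissonProcess L lam (fun c : Conf => c.1)) {K : Set Plane} (hK : MeasurableSet K) :
    IndepFun (Conf.restrict K) (Conf.restrict Kᶜ) L := by
  rw [IndepFun_iff_Indep]
  have hg : ∀ K' : Set Plane, MeasurableSpace.comap (Conf.restrict K') inferInstance =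
      MeasurableSpace.generateFrom (preimage (Conf.restrict K') '' cylinders) := by
    intro K'
    rw [← MeasurableSpace.comap_generateFrom, ← generateFrom_cylinders]
  have hpi : ∀ K' : Set Plane, IsPiSystem (preimage (Conf.restrict K') '' cylinders) :=
    fun K' => isPiSystem_cylinders.comap (Conf.restrict K')
  refine IndepSets.indep (measurable_restrict hK).comap_le (measurable_restrict hK.compl).comap_le
    (hpi K) (hpi Kᶜ) (hg K) (hg Kᶜ) ?_
  rw [IndepSets_iff]
  rintro _ _ ⟨_, ⟨l, hl, rfl⟩, rfl⟩ ⟨_, ⟨l', hl', rfl⟩, rfl⟩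
  let B : (Fin l.length → Bool) ⊕ (Fin l'.length → Bool) → Set Plane :=
    Sum.elim (cell K l) (cell Kᶜ l')
  have hB : ∀ i, MeasurableSet (B i) := by
    rintro (s | s)
    · exact measurableSet_cell hK (fun p hp => (hl p hp).1) s
    · exact measurableSet_cell hK.compl (fun p hp => (hl' p hp).1) s
  have hd : Pairwise fun i j => Disjoint (B i) (B j) := by
    rintro (s | s) (t | t) hst
    · exact disjoint_cell K l (fun h => hst (by rw [h]))
    · exact Set.disjoint_left.2 fun x h h' => h'.1 h.1
    · exact Set.disjoint_left.2 fun x h h' => h.1 h'.1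
    · exact disjoint_cell Kᶜ l' (fun h => hst (by rw [h]))
  have hind := iIndepFun_counts hL B hB hd
  classical
  have hST := hind.indepFun_finset (Finset.univ.filter fun i => i.isLeft = true)
    (Finset.univ.filter fun i => i.isRight = true) (by
      rw [Finset.disjoint_left]
      rintro (s | s) h h' <;> simp at h h') (fun i => measurable_count (hB i))
  -- The prescribed counts, rewritten as a condition on the cell counts inside `K`; `F'` below does
  -- the same outside.
  let F : ((i : {i // i ∈ (Finset.univ.filter fun i :
      (Fin l.length → Bool) ⊕ (Fin l'.length → Bool) => i.isLeft = true)}) → ℕ∞) → Prop :=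
    fun f => ∀ i : Fin l.length, (∑ s : Fin l.length → Bool,
      if s i = true then f ⟨Sum.inl s, by simp⟩ else 0) = (l.get i).2
  let F' : ((i : {i // i ∈ (Finset.univ.filter fun i :
      (Fin l.length → Bool) ⊕ (Fin l'.length → Bool) => i.isRight = true)}) → ℕ∞) → Prop :=
    fun f => ∀ i : Fin l'.length, (∑ s : Fin l'.length → Bool,
      if s i = true then f ⟨Sum.inr s, by simp⟩ else 0) = (l'.get i).2
  have hm := (indepFun_iff_measure_inter_preimage_eq_mul.1 hST) {f | F f} {f | F' f}
    (Set.to_countable _).measurableSet (Set.to_countable _).measurableSet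
  have e1 : Conf.restrict K ⁻¹' {c | ∀ p ∈ l, (c.1 ∩ p.1).encard = p.2} =
      (fun (c : Conf) (i : {i // i ∈ (Finset.univ.filter fun i :
      (Fin l.length → Bool) ⊕ (Fin l'.length → Bool) => i.isLeft = true)}) =>
        (c.1 ∩ B i).encard) ⁻¹' {f | F f} := by
    ext c
    simp only [mem_preimage, mem_ofPred_eq, F, B, Sum.elim_inl]
    rw [List.forall_mem_iff_get]
    refine forall_congr' fun i => ?_
    rw [← encard_eq_sum_cell c.1 K l i, Conf.restrict, inter_assoc]
  have e2 : Conf.restrict Kᶜ ⁻¹' {c | ∀ p ∈ l', (c.1 ∩ p.1).encard = p.2} =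
      (fun (c : Conf) (i : {i // i ∈ (Finset.univ.filter fun i :
      (Fin l.length → Bool) ⊕ (Fin l'.length → Bool) => i.isRight = true)}) =>
        (c.1 ∩ B i).encard) ⁻¹' {f | F' f} := by
    ext c
    simp only [mem_preimage, mem_ofPred_eq, F', B, Sum.elim_inr]
    rw [List.forall_mem_iff_get]
    refine forall_congr' fun i => ?_
    rw [← encard_eq_sum_cell c.1 Kᶜ l' i, Conf.restrict, inter_assoc]
  rw [e1, e2]
  exact hm

/-! ### Resampling outside a stopping region -/

/-- By independence, `c` inside `K` and `c'` outside have the joint law of the two restrictions of a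
single configuration, whose gluing is itself. The condition `D`, read inside `K`, will select the
value of a random region. -/
theorem measure_glue [IsProbabilityMeasure L]
    (hL : IsPoissonProcess L lam (fun c : Conf => c.1)) {K : Set Plane} (hK : MeasurableSet K)
    {E D : Set Conf} (hE : MeasurableSet E) (hD : MeasurableSet D) :
    (L.prod L) {p | Conf.restrict K p.1 ∈ D ∧ Conf.glue K p.1 p.2 ∈ E} =
      L {c | Conf.restrict K c ∈ D ∧ c ∈ E} := by
  have hind := measure_restrict_inter hL hK
  have hr := measurable_restrict hK
  have hr' := measurable_restrict hK.compl
  rw [indepFun_iff_map_prod_eq_prod_map_map hr.aemeasurable hr'.aemeasurable] at hind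
  set A : Set (Conf × Conf) := {p | p.1 ∈ D ∧ Conf.glue K p.1 p.2 ∈ E} with hA
  have hAm : MeasurableSet A := (measurable_fst hD).inter (measurable_glue hK hE)
  have hg : ∀ c c' : Conf, Conf.glue K (Conf.restrict K c) (Conf.restrict Kᶜ c') =
      Conf.glue K c c' := by
    intro c c'
    refine Conf.ext fun y => ?_
    simp only [mem_glue_iff, mem_restrict_iff, mem_compl_iff]
    tauto
  have hg' : ∀ c : Conf, Conf.glue K c c = c := by
    intro c
    refine Conf.ext fun y => ?_
    simp only [mem_glue_iff]
    tauto
  have h1 := congrArg (fun μ : Measure (Conf × Conf) => μ A) hind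
  rw [Measure.map_apply (hr.prodMk hr') hAm, Measure.map_prod_map _ _ hr hr',
    Measure.map_apply (hr.prodMap hr') hAm] at h1
  have e1 : Prod.map (Conf.restrict K) (Conf.restrict Kᶜ) ⁻¹' A =
      {p | Conf.restrict K p.1 ∈ D ∧ Conf.glue K p.1 p.2 ∈ E} := by
    ext p
    simp only [hA, mem_preimage, mem_ofPred_eq, Prod.map_fst, Prod.map_snd, hg]
  have e2 : (fun ω => (Conf.restrict K ω, Conf.restrict Kᶜ ω)) ⁻¹' A =
      {c | Conf.restrict K c ∈ D ∧ c ∈ E} := by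
    ext p
    simp only [hA, mem_preimage, mem_ofPred_eq, hg, hg']
  rw [e1, e2] at h1
  exact h1.symm

/-- A random region that is approximated from outside by countably valued ones, all of them
determined by the points that the region contains. -/
structure Explorable (Z : Conf → Set Plane) (Q : Type*) [MeasurableSpace Q] where
  /-- the approximating label -/
  q : ℕ → Conf → Q
  /-- the approximating region -/
  K : ℕ → Q → Set Plane
  measurable_q : ∀ m, Measurable (q m)
  measurable_K : ∀ m p, MeasurableSet (K m p)
  subset : ∀ m c, Z c ⊆ K m (q m c)
  tendsto : ∀ c y, y ∉ Z c → ∀ᶠ m in Filter.atTop, y ∉ K m (q m c)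
  locality : ∀ c c' : Conf, (∀ y ∈ Z c, y ∈ c.1 ↔ y ∈ c'.1) → ∀ m, q m c' = q m c

variable {Z : Conf → Set Plane} {Q : Type*} [MeasurableSpace Q] [Countable Q]
  [MeasurableSingletonClass Q]

/-- Keep the points of the first configuration that lie in its region `Z`, and take the points
of the second one outside. -/
def resample (Z : Conf → Set Plane) (p : Conf × Conf) : Conf := Conf.glue (Z p.1) p.1 p.2

theorem Explorable.measurable_approx (h : Explorable Z Q) (m : ℕ) :
    Measurable fun p : Conf × Conf => Conf.glue (h.K m (h.q m p.1)) p.1 p.2 := by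
  have h1 : Measurable fun x : (Conf × Conf) × Q => Conf.glue (h.K m x.2) x.1.1 x.1.2 :=
    measurable_from_prod_countable_left fun p => measurable_glue (h.measurable_K m p)
  exact h1.comp (measurable_id.prodMk ((h.measurable_q m).comp measurable_fst))

/-- If either configuration has label `p`, its region lies in `K m p`, where a configuration and its
restriction agree; locality gives the other one the same label. So the event that the label is `p`
is visible inside `K m p`. -/
theorem Explorable.q_restrict (h : Explorable Z Q) (m : ℕ) (c : Conf) (p : Q) :
    h.q m (Conf.restrict (h.K m p) c) = p ↔ h.q m c = p := by
  constructor
  · intro hp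
    have h1 := h.subset m (Conf.restrict (h.K m p) c)
    rw [hp] at h1
    have h2 := h.locality (Conf.restrict (h.K m p) c) c fun y hy => by
      simp only [Conf.restrict, mem_inter_iff, h1 hy, and_true]
    rw [← hp, h2 m]
  · intro hp
    have h1 := h.subset m c
    rw [hp] at h1
    refine (h.locality c (Conf.restrict (h.K m p) c) (fun y hy => ?_) m).trans hp
    simp only [Conf.restrict, mem_inter_iff, h1 hy, and_true]

/-- Split along the countably many labels: on each of them the region is deterministic and the label
is decided from inside, so `measure_glue` applies. -/
theorem Explorable.measure_approx [IsProbabilityMeasure L]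
    (hL : IsPoissonProcess L lam (fun c : Conf => c.1)) (h : Explorable Z Q) (m : ℕ)
    {E : Set Conf} (hE : MeasurableSet E) :
    (L.prod L) {p | Conf.glue (h.K m (h.q m p.1)) p.1 p.2 ∈ E} = L E := by
  have hm1 : Measurable fun p : Conf × Conf => h.q m p.1 := (h.measurable_q m).comp measurable_fst
  have hdec : ∀ {α : Type} [MeasurableSpace α] (μ : Measure α) (f : α → Q), Measurable f →
      ∀ A : Set α, MeasurableSet A → μ A = ∑' p, μ (f ⁻¹' {p} ∩ A) := by
    intro α _ μ f hf A hA
    rw [← measure_iUnion]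
    · congr 1
      ext x
      simp
    · intro p p' hp
      rw [Function.onFun, Set.disjoint_left]
      rintro x ⟨h1, -⟩ ⟨h2, -⟩
      exact hp (h1.symm.trans h2)
    · exact fun p => (hf (measurableSet_singleton p)).inter hA
  have hA := h.measurable_approx m hE
  rw [preimage] at hA
  rw [hdec (L.prod L) _ hm1 _ hA, hdec L _ (h.measurable_q m) E hE]
  refine tsum_congr fun p => ?_
  have := measure_glue hL (h.measurable_K m p) hE
    (h.measurable_q m (measurableSet_singleton p))
  simp only [mem_preimage, mem_singleton_iff, h.q_restrict m] at this
  rw [show h.q m ⁻¹' {p} ∩ E = {c | h.q m c = p ∧ c ∈ E} from rfl, ← this]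
  congr 1
  ext x
  simp only [mem_inter_iff, mem_preimage, mem_singleton_iff, mem_ofPred_eq]
  constructor
  · rintro ⟨h1, h2⟩
    rw [h1] at h2
    exact ⟨h1, h2⟩
  · rintro ⟨h1, h2⟩
    rw [h1]
    exact ⟨rfl, h2⟩

/-- A cylinder involves finitely many points of the two configurations, and each of them is
eventually on the same side of the approximating region as of `Z`. -/
theorem Explorable.eventually_mem (h : Explorable Z Q) (x : Conf × Conf) {E : Set Conf}
    (hE : E ∈ cylinders) : ∀ᶠ m in Filter.atTop,
      x ∈ {p : Conf × Conf | Conf.glue (h.K m (h.q m p.1)) p.1 p.2 ∈ E} ↔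
        x ∈ resample Z ⁻¹' E := by
  obtain ⟨l, hl, rfl⟩ := hE
  have key : ∀ p ∈ l, ∀ᶠ m in Filter.atTop, (Conf.glue (h.K m (h.q m x.1)) x.1 x.2).1 ∩ p.1 =
      (resample Z x).1 ∩ p.1 := by
    intro p hp
    have hfin : ((x.1.1 ∪ x.2.1) ∩ p.1).Finite := (x.1.2.union x.2.2) _ (hl p hp).2
    have h1 : ∀ᶠ m in Filter.atTop, ∀ y ∈ (x.1.1 ∪ x.2.1) ∩ p.1,
        (y ∈ h.K m (h.q m x.1) ↔ y ∈ Z x.1) := by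
      rw [Filter.eventually_all_finite hfin]
      intro y _
      by_cases hy : y ∈ Z x.1
      · exact Filter.Eventually.of_forall fun m => ⟨fun _ => hy, fun _ => h.subset m _ hy⟩
      · filter_upwards [h.tendsto x.1 y hy] with m hm
        exact ⟨fun h => absurd h hm, fun h => absurd h hy⟩
    filter_upwards [h1] with m hm
    ext y
    simp only [mem_inter_iff, mem_glue_iff, resample]
    constructor
    · rintro ⟨(⟨h1, h2⟩ | ⟨h1, h2⟩), h3⟩
      · exact ⟨Or.inl ⟨(hm y ⟨Or.inl h2, h3⟩).1 h1, h2⟩, h3⟩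
      · exact ⟨Or.inr ⟨fun h => h1 ((hm y ⟨Or.inr h2, h3⟩).2 h), h2⟩, h3⟩
    · rintro ⟨(⟨h1, h2⟩ | ⟨h1, h2⟩), h3⟩
      · exact ⟨Or.inl ⟨(hm y ⟨Or.inl h2, h3⟩).2 h1, h2⟩, h3⟩
      · exact ⟨Or.inr ⟨fun h => h1 ((hm y ⟨Or.inr h2, h3⟩).1 h), h2⟩, h3⟩
  have key' : ∀ᶠ m in Filter.atTop, ∀ p ∈ {p | p ∈ l},
      (Conf.glue (h.K m (h.q m x.1)) x.1 x.2).1 ∩ p.1 = (resample Z x).1 ∩ p.1 :=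
    (Filter.eventually_all_finite (List.finite_toSet l)).2 key
  filter_upwards [key'] with m hm
  simp only [mem_ofPred_eq, mem_preimage]
  refine forall₂_congr fun p hp => ?_
  rw [hm p hp]

theorem Explorable.measurable_resample (h : Explorable Z Q) : Measurable (resample Z) := by
  refine measurable_of_cylinders fun E hE => ?_
  exact measurableSet_of_tendsto_indicator Filter.atTop
    (fun m => h.measurable_approx m (measurableSet_cylinder hE))
    (fun x => h.eventually_mem x hE)

/-- Strong Markov property: resampling outside an explorable region does not change the law. -/
theorem Explorable.map_resample [IsProbabilityMeasure L]
    (hL : IsPoissonProcess L lam (fun c : Conf => c.1)) (h : Explorable Z Q) :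
    (L.prod L).map (resample Z) = L := by
  have hm := h.measurable_resample
  have : IsProbabilityMeasure ((L.prod L).map (resample Z)) :=
    Measure.isProbabilityMeasure_map hm.aemeasurable
  refine ext_of_generate_finite cylinders generateFrom_cylinders isPiSystem_cylinders
    (fun E hE => ?_) (by simp)
  have hEm := measurableSet_cylinder hE
  rw [Measure.map_apply hm hEm]
  have := tendsto_measure_of_tendsto_indicator (μ := L.prod L) Filter.atTop
    (fun m => h.measurable_approx m hEm) MeasurableSet.univ (measure_ne_top _ _)
    (Filter.Eventually.of_forall fun m => subset_univ _) (A := resample Z ⁻¹' E) (fun x => h.eventually_mem x hE)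
  refine tendsto_nhds_unique this ?_
  have h2 : ∀ m, (L.prod L) ((fun p : Conf × Conf =>
      Conf.glue (h.K m (h.q m p.1)) p.1 p.2) ⁻¹' E) = L E := fun m => h.measure_approx hL m hEm
  simp only [h2]
  exact tendsto_const_nhds

end Poisson

/-! ### Explorable regions made of a half plane and finitely many balls -/

/-- The union of a lower half plane, a fixed set and finitely many closed balls. -/
def region (F : Set Plane) {J : Type*} (w : ℝ) (b : J → Plane) (r : J → ℝ) : Set Plane :=
  {y | y 1 ≤ w} ∪ F ∪ ⋃ j, Metric.closedBall (b j) (r j)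

theorem measurable_coord (i : Fin 2) : Measurable fun y : Plane => y i := by fun_prop

theorem measurableSet_region {F : Set Plane} (hF : MeasurableSet F) {J : Type*} [Countable J]
    (w : ℝ) (b : J → Plane) (r : J → ℝ) : MeasurableSet (region F w b r) :=
  ((measurableSet_le (measurable_coord 1) measurable_const).union hF).union
    (MeasurableSet.iUnion fun _ => Metric.isClosed_closedBall.measurableSet)

theorem dist_le_abs_add_abs (x y : Plane) : dist x y ≤ |x 0 - y 0| + |x 1 - y 1| := by
  rw [dist_le_iff (by positivity), ← sq_abs (x 0 - y 0), ← sq_abs (x 1 - y 1)]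
  nlinarith [abs_nonneg (x 0 - y 0), abs_nonneg (x 1 - y 1)]

/-- The lattice point of mesh `1 / (m + 1)` close to a given one. -/
def gridPoint (m : ℕ) (p : ℤ × ℤ) : Plane := !₂[(p.1 : ℝ) / (m + 1), (p.2 : ℝ) / (m + 1)]

theorem dist_gridPoint_le (m : ℕ) (x : Plane) :
    dist x (gridPoint m (⌊(m + 1) * x 0⌋, ⌊(m + 1) * x 1⌋)) ≤ 2 / (m + 1) := by
  have hm : (0 : ℝ) < m + 1 := by positivity
  have key : ∀ t : ℝ, |t - (⌊(m + 1) * t⌋ : ℝ) / (m + 1)| ≤ 1 / (m + 1) := by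
    intro t
    have h1 := Int.floor_le ((m + 1) * t)
    have h2 := Int.lt_floor_add_one ((m + 1) * t)
    have : t - (⌊(m + 1) * t⌋ : ℝ) / (m + 1) = ((m + 1) * t - ⌊(m + 1) * t⌋) / (m + 1) := by
      field_simp
    rw [this, abs_of_nonneg (div_nonneg (by linarith) hm.le)]
    gcongr
    linarith
  refine (dist_le_abs_add_abs _ _).trans ?_
  have h0 := key (x 0)
  have h1 := key (x 1)
  simp only [gridPoint]
  simp only [Matrix.cons_val_zero, Matrix.cons_val_one]
  have : (2 : ℝ) / (m + 1) = 1 / (m + 1) + 1 / (m + 1) := by ring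
  linarith

open Classical in
/-- A region `region F w b r` whose parameters are determined by the points in it is explorable. -/
def explorableOfParams {J : Type*} [Fintype J] {alive : Set Conf} (hal : MeasurableSet alive)
    {F : Set Plane} (hF : MeasurableSet F) {w : Conf → ℝ} (hw : Measurable w)
    {b : J → Conf → Plane} (hb : ∀ j, Measurable (b j)) {r : J → Conf → ℝ}
    (hr : ∀ j, Measurable (r j))
    (locality : ∀ c c' : Conf, c ∈ alive →
      (∀ y ∈ region F (w c) (fun j => b j c) (fun j => r j c), y ∈ c.1 ↔ y ∈ c'.1) →
      c' ∈ alive ∧ w c' = w c ∧ (∀ j, b j c' = b j c) ∧ ∀ j, r j c' = r j c) :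
    Explorable (fun c => {y | c ∈ alive → y ∈ region F (w c) (fun j => b j c) (fun j => r j c)})
      (Bool × ℤ × (J → (ℤ × ℤ) × ℤ)) where
  q m c := (decide (c ∈ alive), ⌈(m + 1) * w c⌉,
    fun j => ((⌊(m + 1) * b j c 0⌋, ⌊(m + 1) * b j c 1⌋), ⌈(m + 1) * r j c⌉))
  -- Rounding moves a centre by at most `2 / (m + 1)`, and enlarging the radii by as much keeps the
  -- approximation outside. A configuration that is not alive gets the whole plane, so none of it is
  -- replaced.
  K m p := if p.1 = true then region F ((p.2.1 : ℝ) / (m + 1)) (fun j => gridPoint m (p.2.2 j).1)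
    (fun j => (((p.2.2 j).2 : ℝ) + 2) / (m + 1)) else univ
  measurable_q m := by
    refine Measurable.prodMk ?_ (Measurable.prodMk ?_ (measurable_pi_lambda _ fun j =>
      Measurable.prodMk (Measurable.prodMk ?_ ?_) ?_))
    · have : (fun c : Conf => decide (c ∈ alive)) = fun c => if c ∈ alive then true else false := by
        ext1 c; by_cases h : c ∈ alive <;> simp [h]
      rw [this]
      exact Measurable.ite hal measurable_const measurable_const
    · exact Int.measurable_ceil.comp (hw.const_mul _)
    · exact Int.measurable_floor.comp (((measurable_coord 0).comp (hb j)).const_mul _)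
    · exact Int.measurable_floor.comp (((measurable_coord 1).comp (hb j)).const_mul _)
    · exact Int.measurable_ceil.comp ((hr j).const_mul _)
  measurable_K m p := by
    split_ifs
    · exact measurableSet_region hF _ _ _
    · exact MeasurableSet.univ
  subset m c := by
    have hm : (0 : ℝ) < m + 1 := by positivity
    intro y hy
    by_cases hc : c ∈ alive
    · simp only [hc, decide_true, if_true]
      rcases hy hc with (h | h) | h
      · refine Or.inl (Or.inl ?_)
        have h1 := Int.le_ceil ((m + 1) * w c)
        have h2 : y 1 ≤ w c := h
        change y 1 ≤ _
        rw [le_div_iff₀ hm]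
        nlinarith
      · exact Or.inl (Or.inr h)
      · obtain ⟨j, hj⟩ := mem_iUnion.1 h
        refine Or.inr (mem_iUnion.2 ⟨j, ?_⟩)
        rw [Metric.mem_closedBall] at hj ⊢
        refine (dist_triangle _ (b j c) _).trans ?_
        have h1 := dist_gridPoint_le m (b j c)
        have h2 := Int.le_ceil ((m + 1) * r j c)
        have h3 : r j c ≤ (⌈(m + 1) * r j c⌉ : ℝ) / (m + 1) := by
          rw [le_div_iff₀ hm]; linarith
        change _ ≤ ((⌈(m + 1) * r j c⌉ : ℝ) + 2) / (m + 1)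
        rw [add_div]
        change dist y (b j c) ≤ r j c at hj
        linarith
    · simp [hc]
  tendsto c y hy := by
    have hc : c ∈ alive := by
      by_contra h
      exact hy fun h' => absurd h' h
    have hy' : y ∉ region F (w c) (fun j => b j c) (fun j => r j c) := fun h => hy fun _ => h
    simp only [region, mem_union, mem_iUnion, not_or, not_exists, mem_ofPred_eq, not_le,
      Metric.mem_closedBall] at hy'
    obtain ⟨⟨h1, h2⟩, h3⟩ := hy'
    have hlim : ∀ C : ℝ, Filter.Tendsto (fun m : ℕ => C / ((m : ℝ) + 1)) Filter.atTop (nhds 0) :=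
      fun C => tendsto_const_nhds.div_atTop
        (Filter.tendsto_atTop_add_const_right _ _ tendsto_natCast_atTop_atTop)
    have e1 : ∀ᶠ m : ℕ in Filter.atTop, 1 / ((m : ℝ) + 1) < y 1 - w c :=
      (hlim 1).eventually_lt_const (by linarith)
    -- `5 = 1 + 2 + 2`: the rounding up of the radius, its enlargement, and the displacement of the
    -- centre.
    have e2 : ∀ᶠ m : ℕ in Filter.atTop, ∀ j, 5 / ((m : ℝ) + 1) < dist y (b j c) - r j c := by
      rw [Filter.eventually_all]
      intro j
      exact (hlim 5).eventually_lt_const (by linarith [h3 j])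
    filter_upwards [e1, e2] with m he1 he2
    have hm : (0 : ℝ) < m + 1 := by positivity
    simp only [hc, decide_true, if_true]
    rintro ((h | h) | h)
    · have h' : y 1 ≤ (⌈(m + 1) * w c⌉ : ℝ) / (m + 1) := h
      have h4 := (Int.ceil_lt_add_one ((m + 1) * w c)).le
      have : (⌈(m + 1) * w c⌉ : ℝ) / (m + 1) ≤ w c + 1 / (m + 1) := by
        rw [div_le_iff₀ hm, add_mul (w c), one_div, inv_mul_cancel₀ hm.ne']
        linarith
      linarith
    · exact h2 h
    · obtain ⟨j, hj⟩ := mem_iUnion.1 h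
      rw [Metric.mem_closedBall] at hj
      have h4 := (Int.ceil_lt_add_one ((m + 1) * r j c)).le
      have h5 := dist_gridPoint_le m (b j c)
      have h6 := dist_triangle y (gridPoint m (⌊(m + 1) * b j c 0⌋, ⌊(m + 1) * b j c 1⌋)) (b j c)
      rw [dist_comm (gridPoint m _) (b j c)] at h6
      have h7 := he2 j
      change dist y (gridPoint m _) ≤ ((⌈(m + 1) * r j c⌉ : ℝ) + 2) / (m + 1) at hj
      have h8 : ((⌈(m + 1) * r j c⌉ : ℝ) + 2) / (m + 1) ≤ r j c + 3 / (m + 1) := by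
        rw [div_le_iff₀ hm, add_mul (r j c), div_mul_cancel₀ _ hm.ne']
        linarith
      have h9 : (5 : ℝ) / (m + 1) = 3 / (m + 1) + 2 / (m + 1) := by ring
      linarith
  locality c c' h m := by
    by_cases hc : c ∈ alive
    · obtain ⟨h1, h2, h3, h4⟩ := locality c c' hc fun y hy => h y fun _ => hy
      simp only [h1, h2, h3, h4, hc]
    · have : c = c' := Conf.ext fun y => h y fun h' => absurd h' hc
      rw [this]

/-! ### Elementary estimates for a Poisson process -/

section Poisson

variable {L : Measure Conf} {lam : ℝ}

theorem measure_encard_eq (hL : IsPoissonProcess L lam (fun c : Conf => c.1)) (hlam : 0 < lam)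
    {B : Set Plane} (hB : MeasurableSet B) (hb : Bornology.IsBounded B) (n : ℕ) :
    L {c | (c.1 ∩ B).encard = n} = ENNReal.ofReal (Real.exp (-(lam * volume.real B)) *
      (lam * volume.real B) ^ n / n.factorial) := by
  have h := congrArg (fun μ : Measure ℕ => μ {n}) (hL.law_count B hB hb)
  have hm : Measurable fun c : Conf => (c.1 ∩ B).ncard := by
    have : (fun c : Conf => (c.1 ∩ B).ncard) = ENat.toNat ∘ fun c => (c.1 ∩ B).encard := rfl
    rw [this]
    exact (measurable_from_top).comp (measurable_count hB)
  rw [Measure.map_apply hm (measurableSet_singleton n), poissonMeasure_singleton,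
    Real.coe_toNNReal _ (by positivity)] at h
  rw [← h]
  congr 1
  ext c
  simp only [mem_ofPred_eq, mem_preimage, mem_singleton_iff]
  rw [← (c.2 B hb).cast_ncard_eq]
  norm_cast

theorem measure_void (hL : IsPoissonProcess L lam (fun c : Conf => c.1)) (hlam : 0 < lam)
    {B : Set Plane} (hB : MeasurableSet B) (hb : Bornology.IsBounded B) :
    L {c | c.1 ∩ B = ∅} = ENNReal.ofReal (Real.exp (-(lam * volume.real B))) := by
  have := measure_encard_eq hL hlam hB hb 0
  simpa using this

theorem measurableSet_void {B : Set Plane} (hB : MeasurableSet B) :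
    MeasurableSet {c : Conf | c.1 ∩ B = ∅} := by
  have := measurable_count hB (measurableSet_singleton 0)
  simpa [preimage] using this

theorem measure_hit_le [IsProbabilityMeasure L]
    (hL : IsPoissonProcess L lam (fun c : Conf => c.1)) (hlam : 0 < lam)
    {B : Set Plane} (hB : MeasurableSet B) (hb : Bornology.IsBounded B) :
    L {c | (c.1 ∩ B).Nonempty} ≤ ENNReal.ofReal (lam * volume.real B) := by
  have h : {c : Conf | (c.1 ∩ B).Nonempty} = {c | c.1 ∩ B = ∅}ᶜ := by
    ext c; simp [nonempty_iff_ne_empty]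
  rw [h, prob_compl_eq_one_sub (measurableSet_void hB), measure_void hL hlam hB hb,
    ← ENNReal.ofReal_one, ← ENNReal.ofReal_sub _ (Real.exp_pos _).le]
  refine ENNReal.ofReal_le_ofReal ?_
  have := Real.add_one_le_exp (-(lam * volume.real B))
  linarith

/-- The bound is quadratic in the mean, which is what beats the number of strips in
`ae_ordinate_ne`. -/
theorem measure_two_le [IsProbabilityMeasure L]
    (hL : IsPoissonProcess L lam (fun c : Conf => c.1)) (hlam : 0 < lam)
    {B : Set Plane} (hB : MeasurableSet B) (hb : Bornology.IsBounded B) :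
    L {c | 2 ≤ (c.1 ∩ B).encard} ≤ ENNReal.ofReal ((lam * volume.real B) ^ 2) := by
  set x := lam * volume.real B with hx
  have hx0 : 0 ≤ x := by positivity
  have h : {c : Conf | 2 ≤ (c.1 ∩ B).encard} =
      ({c | (c.1 ∩ B).encard = (0 : ℕ)} ∪ {c | (c.1 ∩ B).encard = (1 : ℕ)})ᶜ := by
    ext c
    simp only [mem_ofPred_eq, mem_compl_iff, mem_union]
    rw [← (c.2 B hb).cast_ncard_eq]
    norm_cast
    omega
  have hm : ∀ n : ℕ, MeasurableSet {c : Conf | (c.1 ∩ B).encard = n} := fun n =>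
    measurable_count hB (measurableSet_singleton _)
  rw [h, prob_compl_eq_one_sub ((hm 0).union (hm 1)), measure_union _ (hm 1),
    measure_encard_eq hL hlam hB hb, measure_encard_eq hL hlam hB hb, ← hx,
    ← ENNReal.ofReal_add (by positivity) (by positivity), ← ENNReal.ofReal_one,
    ← ENNReal.ofReal_sub _ (by positivity)]
  · refine ENNReal.ofReal_le_ofReal ?_
    have := Real.add_one_le_exp (-x)
    simp
    nlinarith
  · rw [Set.disjoint_left]
    intro c h1 h2
    simp only [mem_ofPred_eq] at h1 h2
    rw [h1] at h2
    exact absurd h2 (by norm_num)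

theorem volume_rect (s t : Set ℝ) :
    volume {y : Plane | y 0 ∈ s ∧ y 1 ∈ t} = volume s * volume t := by
  have h := (PiLp.volume_preserving_ofLp (Fin 2)).measure_preimage_emb
    (MeasurableEquiv.toLp 2 (Fin 2 → ℝ)).symm.measurableEmbedding (Set.univ.pi ![s, t])
  rw [volume_pi_pi, Fin.prod_univ_two] at h
  simp only [Matrix.cons_val_zero, Matrix.cons_val_one] at h
  rw [← h]
  congr 1
  ext y
  simp [Set.mem_pi, Fin.forall_fin_two]

theorem measurableSet_rect {s t : Set ℝ} (hs : MeasurableSet s) (ht : MeasurableSet t) :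
    MeasurableSet {y : Plane | y 0 ∈ s ∧ y 1 ∈ t} :=
  (measurable_coord 0 hs).inter (measurable_coord 1 ht)

theorem isBounded_rect {s t : Set ℝ} (hs : Bornology.IsBounded s) (ht : Bornology.IsBounded t) :
    Bornology.IsBounded {y : Plane | y 0 ∈ s ∧ y 1 ∈ t} := by
  obtain ⟨r, hr⟩ := hs.subset_closedBall 0
  obtain ⟨r', hr'⟩ := ht.subset_closedBall 0
  refine (Metric.isBounded_closedBall (x := (0 : Plane)) (r := r + r')).subset ?_
  rintro y ⟨h0, h1⟩
  have h0' := hr h0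
  have h1' := hr' h1
  rw [Metric.mem_closedBall, Real.dist_eq] at h0' h1'
  rw [Metric.mem_closedBall]
  refine (dist_le_abs_add_abs _ _).trans ?_
  simp at h0' h1' ⊢
  linarith

theorem ae_void (hL : IsPoissonProcess L lam (fun c : Conf => c.1)) (hlam : 0 < lam)
    [IsProbabilityMeasure L] {B : Set Plane} (hB : MeasurableSet B) (h0 : volume B = 0) :
    ∀ᵐ c ∂L, c.1 ∩ B = ∅ := by
  have h : ∀ m : ℕ, ∀ᵐ c ∂L, c.1 ∩ (B ∩ Metric.closedBall 0 m) = ∅ := by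
    intro m
    have hBm := hB.inter (Metric.isClosed_closedBall (x := (0 : Plane)) (ε := m)).measurableSet
    have hb : Bornology.IsBounded (B ∩ Metric.closedBall (0 : Plane) m) :=
      Metric.isBounded_closedBall.subset inter_subset_right
    have hv : volume.real (B ∩ Metric.closedBall (0 : Plane) m) = 0 := by
      rw [Measure.real, measure_mono_null inter_subset_left h0]; simp
    have := measure_hit_le hL hlam hBm hb
    rw [hv, mul_zero, ENNReal.ofReal_zero, nonpos_iff_eq_zero] at this
    rw [ae_iff]
    simpa only [← nonempty_iff_ne_empty, ne_eq] using this
  filter_upwards [ae_all_iff.2 h] with c hc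
  rw [eq_empty_iff_forall_notMem]
  intro y hy
  obtain ⟨m, hm⟩ := exists_nat_ge (dist y 0)
  exact notMem_empty y ((hc m) ▸ ⟨hy.1, hy.2, hm⟩)

theorem ae_exists_above (hL : IsPoissonProcess L lam (fun c : Conf => c.1)) (hlam : 0 < lam)
    [IsProbabilityMeasure L] : ∀ᵐ c ∂L, ∀ t : ℝ, ∃ y ∈ c.1, t < y 1 := by
  have h : ∀ m : ℕ, ∀ᵐ c ∂L, ∃ y ∈ c.1, (m : ℝ) < y 1 := by
    intro m
    rw [ae_iff]
    have hle : ∀ R : ℕ, L {c : Conf | ¬ ∃ y ∈ c.1, (m : ℝ) < y 1} ≤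
        ENNReal.ofReal (Real.exp (-(lam * R))) := by
      intro R
      set B : Set Plane := {y | y 0 ∈ Ioo (0 : ℝ) 1 ∧ y 1 ∈ Ioo (m : ℝ) (m + R)} with hBdef
      have hv : volume.real B = R := by
        rw [Measure.real, hBdef, volume_rect]
        simp
      have hB : MeasurableSet B := measurableSet_rect measurableSet_Ioo measurableSet_Ioo
      have hb : Bornology.IsBounded B := isBounded_rect (Metric.isBounded_Ioo _ _)
        (Metric.isBounded_Ioo _ _)
      have := measure_void hL hlam hB hb
      rw [hv] at this
      rw [← this]
      refine measure_mono fun c hc => ?_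
      simp only [mem_ofPred_eq, not_exists, not_and] at hc ⊢
      rw [eq_empty_iff_forall_notMem]
      rintro y ⟨hy, -, hy2⟩
      exact hc y hy hy2.1
    refine le_antisymm (ge_of_tendsto' (f := fun R : ℕ => ENNReal.ofReal (Real.exp (-(lam * R))))
      (x := Filter.atTop) ?_ hle) zero_le
    rw [← ENNReal.ofReal_zero]
    refine ENNReal.tendsto_ofReal (Real.tendsto_exp_atBot.comp ?_)
    exact Filter.tendsto_neg_atTop_atBot.comp (tendsto_natCast_atTop_atTop.const_mul_atTop hlam)
  filter_upwards [ae_all_iff.2 h] with c hc t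
  obtain ⟨m, hm⟩ := exists_nat_ge t
  obtain ⟨y, hy, h⟩ := hc m
  exact ⟨y, hy, hm.trans_lt h⟩

theorem measure_hit_hit_le [IsProbabilityMeasure L]
    (hL : IsPoissonProcess L lam (fun c : Conf => c.1)) (hlam : 0 < lam)
    {B B' : Set Plane} (hB : MeasurableSet B) (hb : Bornology.IsBounded B)
    (hB' : MeasurableSet B') (hb' : Bornology.IsBounded B') (hd : Disjoint B B') :
    L {c | (c.1 ∩ B).Nonempty ∧ (c.1 ∩ B').Nonempty} ≤
      ENNReal.ofReal (lam * volume.real B) * ENNReal.ofReal (lam * volume.real B') := by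
  have hind := measure_restrict_inter hL hB
  have hm : ∀ {A : Set Plane}, MeasurableSet A → MeasurableSet {c : Conf | (c.1 ∩ A).Nonempty} := by
    intro A hA
    have h : {c : Conf | (c.1 ∩ A).Nonempty} = {c | c.1 ∩ A = ∅}ᶜ := by
      ext c; simp [nonempty_iff_ne_empty]
    rw [h]
    exact (measurableSet_void hA).compl
  have h := indepFun_iff_measure_inter_preimage_eq_mul.1 hind {c | (c.1 ∩ B).Nonempty}
    {c | (c.1 ∩ B').Nonempty} (hm hB) (hm hB')
  have e1 : Conf.restrict B ⁻¹' {c | (c.1 ∩ B).Nonempty} = {c | (c.1 ∩ B).Nonempty} := by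
    ext c
    simp [Conf.restrict, inter_assoc]
  have e2 : Conf.restrict Bᶜ ⁻¹' {c | (c.1 ∩ B').Nonempty} = {c | (c.1 ∩ B').Nonempty} := by
    ext c
    simp [Conf.restrict, inter_assoc, inter_eq_right.2 (subset_compl_iff_disjoint_left.2 hd)]
  rw [e1, e2] at h
  rw [show {c : Conf | (c.1 ∩ B).Nonempty ∧ (c.1 ∩ B').Nonempty} =
    {c | (c.1 ∩ B).Nonempty} ∩ {c | (c.1 ∩ B').Nonempty} from rfl, h]
  exact mul_le_mul' (measure_hit_le hL hlam hB hb) (measure_hit_le hL hlam hB' hb')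

/-- Almost surely, no two distinct points have ordinates that differ by a given amount. -/
theorem ae_ordinate_ne (hL : IsPoissonProcess L lam (fun c : Conf => c.1)) (hlam : 0 < lam)
    [IsProbabilityMeasure L] {s : ℝ} (hs : 0 ≤ s) :
    ∀ᵐ c ∂L, ∀ x ∈ c.1, ∀ y ∈ c.1, x ≠ y → y 1 ≠ x 1 + s := by
  have h : ∀ M : ℕ, ∀ᵐ c ∂L, ∀ x ∈ c.1, ∀ y ∈ c.1, x ≠ y → |x 0| ≤ (M : ℝ) →
      |x 1| < (M : ℝ) → |y 0| ≤ (M : ℝ) → y 1 ≠ x 1 + s := by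
    intro M
    rw [ae_iff]
    -- The window is cut into `n` strips of height `2 * M / n`. A bad pair occupies a strip and its
    -- translate by `s`, which coincide if `s = 0` and are disjoint once `2 * M / n < s`. Either way
    -- the cost is of order `1 / n ^ 2`, and the sum over the strips is of order `1 / n`.
    set S : ℕ → ℕ → ℝ → Set Plane := fun n i t => {y | y 0 ∈ Icc (-(M : ℝ)) M ∧
      y 1 ∈ Ico (-(M : ℝ) + t + 2 * M * i / n) (-(M : ℝ) + t + 2 * M * (i + 1) / n)} with hS
    have hSm : ∀ n i t, MeasurableSet (S n i t) := fun n i t =>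
      measurableSet_rect measurableSet_Icc measurableSet_Ico
    have hSb : ∀ n i t, Bornology.IsBounded (S n i t) := fun n i t =>
      isBounded_rect (Metric.isBounded_Icc _ _) (Metric.isBounded_Ico _ _)
    have hSv : ∀ n i t, volume.real (S n i t) = 4 * M ^ 2 / n := by
      intro n i t
      rw [Measure.real, hS]
      simp only
      rw [volume_rect, Real.volume_Icc, Real.volume_Ico, ← ENNReal.ofReal_mul (by
        have : (0 : ℝ) ≤ M := by positivity
        linarith), ENNReal.toReal_ofReal]
      · ring
      · have h1 : (0 : ℝ) ≤ M := by positivity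
        have h2 : -(M : ℝ) + t + 2 * M * (i + 1) / n - (-M + t + 2 * M * i / n) = 2 * M / n := by
          ring
        rw [h2]
        have h3 : (M : ℝ) - -M = 2 * M := by ring
        rw [h3]
        positivity
    have hE : ∀ n : ℕ, 1 ≤ n → (s = 0 ∨ 2 * M / n < s) → ∀ i, L {c : Conf | ∃ x ∈ c.1, ∃ y ∈ c.1,
        x ≠ y ∧ x ∈ S n i 0 ∧ y ∈ S n i s} ≤ ENNReal.ofReal ((lam * (4 * M ^ 2 / n)) ^ 2) := by
      intro n hn hor i
      rcases hor with rfl | hlt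
      · rw [← hSv n i 0]
        refine (measure_mono ?_).trans (measure_two_le hL hlam (hSm n i 0) (hSb n i 0))
        rintro c ⟨x, hx, y, hy, hne, hxS, hyS⟩
        have h2 : (1 : ℕ∞) < (c.1 ∩ S n i 0).encard :=
          one_lt_encard_iff.2 ⟨x, y, ⟨hx, hxS⟩, ⟨hy, hyS⟩, hne⟩
        exact Order.add_one_le_of_lt h2
      · rw [sq, ENNReal.ofReal_mul (by positivity)]
        conv_rhs => rw [← hSv n i 0]
        conv_rhs => arg 2; rw [hSv n i 0, ← hSv n i s]
        refine (measure_mono ?_).trans (measure_hit_hit_le hL hlam (hSm n i 0) (hSb n i 0)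
          (hSm n i s) (hSb n i s) ?_)
        · rintro c ⟨x, hx, y, hy, -, hxS, hyS⟩
          exact ⟨⟨x, hx, hxS⟩, ⟨y, hy, hyS⟩⟩
        · rw [Set.disjoint_left]
          rintro y ⟨-, h1⟩ ⟨-, h2⟩
          have h3 := h1.2
          have h4 := h2.1
          have h5 : 2 * (M : ℝ) * (i + 1) / n = 2 * M * i / n + 2 * M / n := by ring
          linarith
    have hle : ∀ n : ℕ, 1 ≤ n → (s = 0 ∨ 2 * M / n < s) → L {c : Conf | ¬ ∀ x ∈ c.1, ∀ y ∈ c.1,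
        x ≠ y → |x 0| ≤ M → |x 1| < M → |y 0| ≤ M → y 1 ≠ x 1 + s} ≤
          ENNReal.ofReal ((lam * (4 * M ^ 2)) ^ 2 / n) := by
      intro n hn hor
      have hn0 : (0 : ℝ) < n := by exact_mod_cast hn
      have hsub : {c : Conf | ¬ ∀ x ∈ c.1, ∀ y ∈ c.1, x ≠ y → |x 0| ≤ M → |x 1| < M → |y 0| ≤ M →
          y 1 ≠ x 1 + s} ⊆ ⋃ i ∈ Finset.range n, {c : Conf | ∃ x ∈ c.1, ∃ y ∈ c.1,
            x ≠ y ∧ x ∈ S n i 0 ∧ y ∈ S n i s} := by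
        intro c hc
        simp only [mem_ofPred_eq] at hc
        push Not at hc
        obtain ⟨x, hx, y, hy, hne, hx0, hx1, hy0, hxy⟩ := hc
        have hM : (0 : ℝ) < M := (abs_nonneg _).trans_lt hx1
        rw [abs_lt] at hx1
        rw [abs_le] at hx0 hy0
        set v := (x 1 + M) * n / (2 * M) with hv
        have hv0 : 0 ≤ v := div_nonneg (mul_nonneg (by linarith) hn0.le) (by linarith)
        have hi1 := Nat.floor_le hv0
        have hi2 := Nat.lt_floor_add_one v
        have hvn : v < n := by
          rw [hv, div_lt_iff₀ (by linarith)]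
          nlinarith
        have hxv : x 1 = -M + 2 * M * v / n := by
          rw [hv]; field_simp; ring
        have hlo : 2 * (M : ℝ) * ⌊v⌋₊ / n ≤ 2 * M * v / n := by gcongr
        have hhi : 2 * (M : ℝ) * v / n < 2 * M * (⌊v⌋₊ + 1) / n := by gcongr
        refine mem_biUnion (x := ⌊v⌋₊) ?_ ⟨x, hx, y, hy, hne, ⟨⟨hx0.1, hx0.2⟩, ?_, ?_⟩,
          ⟨hy0.1, hy0.2⟩, ?_, ?_⟩
        · exact Finset.mem_coe.2 (Finset.mem_range.2 ((Nat.floor_lt hv0).2 hvn))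
        all_goals linarith
      refine (measure_mono hsub).trans ((measure_biUnion_finset_le _ _).trans ?_)
      refine (Finset.sum_le_sum fun i _ => hE n hn hor i).trans ?_
      rw [Finset.sum_const, Finset.card_range, nsmul_eq_mul, ← ENNReal.ofReal_natCast,
        ← ENNReal.ofReal_mul hn0.le]
      refine ENNReal.ofReal_le_ofReal (le_of_eq ?_)
      field_simp
    have hlim : ∀ C : ℝ, Filter.Tendsto (fun n : ℕ => C / (n : ℝ)) Filter.atTop (nhds 0) :=
      fun C => tendsto_const_nhds.div_atTop tendsto_natCast_atTop_atTop
    have hev : ∀ᶠ n : ℕ in Filter.atTop, s = 0 ∨ 2 * M / (n : ℝ) < s := by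
      rcases hs.eq_or_lt with h | h
      · exact Filter.Eventually.of_forall fun n => Or.inl h.symm
      · filter_upwards [(hlim (2 * M)).eventually_lt_const h] with n hn using Or.inr hn
    have ht : Filter.Tendsto (fun n : ℕ => ENNReal.ofReal ((lam * (4 * M ^ 2)) ^ 2 / n))
        Filter.atTop (nhds 0) := by
      rw [← ENNReal.ofReal_zero]
      exact ENNReal.tendsto_ofReal (hlim _)
    refine le_antisymm (ge_of_tendsto ht ?_) zero_le
    filter_upwards [hev, Filter.eventually_ge_atTop 1] with n h1 h2 using hle n h2 h1
  filter_upwards [ae_all_iff.2 h] with c hc x hx y hy hne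
  obtain ⟨M, hM⟩ := exists_nat_gt (max (max |x 0| |x 1|) |y 0|)
  simp only [max_lt_iff] at hM
  exact hc M x hx y hy hne hM.1.1.le hM.1.2 hM.2.le

end Poisson

/-! ### Locality of the exploration process -/

/-- Standing assumptions on the geometry of a starting configuration. -/
structure Start.Good {k : ℕ} (κ : ℕ) (a : Start k) : Prop where
  pts_close : ∀ i j, |a.pts i 1 - a.pts j 1| ≤ κ
  le_hist : ∀ x ∈ a.hist, level a.pts ≤ x 1
  hist_le : ∀ x ∈ a.hist, x 1 ≤ level a.pts + 1

section Local

variable {k : ℕ} [NeZero k] {κ : ℕ} {N N' : Set Plane} {a : Start k}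

/-- There is a candidate for the ancestor of the moving vertex. -/
def HasCand (N : Set Plane) (a : Start k) (n : ℕ) : Prop :=
  ∃ y ∈ cand N a n, moveLevel N a n < y 1

theorem pos_congr {n : ℕ} (h : explore N' a n = explore N a n) : pos N' a n = pos N a n := by
  unfold pos; rw [h]

theorem hist_congr {n : ℕ} (h : explore N' a n = explore N a n) : hist N' a n = hist N a n := by
  unfold hist; rw [h]

theorem moveLevel_congr {n : ℕ} (h : explore N' a n = explore N a n) :
    moveLevel N' a n = moveLevel N a n := by
  unfold moveLevel; rw [h]

theorem explore_succ_congr {n : ℕ} (h : explore N' a n = explore N a n)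
    (h' : ∀ i, IsMoving (pos N a n) i →
      ancestor (cand N' a n) (pos N a n i) = ancestor (cand N a n) (pos N a n i)) :
    explore N' a (n + 1) = explore N a (n + 1) := by
  have hn : nextPos N' a.extra (explore N' a n) = nextPos N a.extra (explore N a n) := by
    funext i
    rw [← pos_succ, ← pos_succ]
    by_cases hi : IsMoving (pos N a n) i
    · have hi' : IsMoving (pos N' a n) i := by rwa [pos_congr h]
      rw [pos_succ_of_moving N' a hi', pos_succ_of_moving N a hi, pos_congr h, h' i hi]
    · have hi' : ¬ IsMoving (pos N' a n) i := by rwa [pos_congr h]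
      rw [pos_succ_of_not N' a hi', pos_succ_of_not N a hi, pos_congr h]
  change nextState N' a.extra (explore N' a n) = nextState N a.extra (explore N a n)
  unfold nextState
  rw [hn, h]

/-- The union of the balls explored in the first `n` steps. -/
def explored (N : Set Plane) (a : Start k) (n : ℕ) : Set Plane :=
  {y | ∃ j < n, ∃ i, IsMoving (pos N a j) i ∧ dist y (pos N a j i) ≤ stepLen N a j}

/-- The first `n` steps are determined by the points in the explored balls. -/
theorem explore_stop (hN : LocFin N) (hX : LocFin a.extra) {n : ℕ}
    (hc : ∀ j < n, HasCand N a j) (hag : ∀ y ∈ explored N a n, (y ∈ N ↔ y ∈ N')) {j : ℕ} (hj : j ≤ n) : explore N' a j = explore N a j := by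
  induction j with
  | zero => rfl
  | succ j ih =>
    have ih := ih (Nat.le_of_succ_le hj)
    refine explore_succ_congr ih fun i hi => ?_
    have hA := isAncestor_pos_succ N a hN hX hi (hc j hj)
    rw [pos_succ_of_moving N a hi] at hA
    refine ancestor_eq (isAncestor_congr hA fun z _ hz => ?_)
    have := hag z ⟨j, hj, i, hi, by
      rwa [stepLen_eq N a hi, pos_succ_of_moving N a hi, dist_comm z, dist_comm (ancestor _ _)]⟩
    simp only [cand, mem_union, mem_sdiff, this, pos_congr ih, hist_congr ih]

/-- The default value of `ancestor` is the vertex itself, so a vertex that strictly rises has a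
candidate. -/
theorem HasCand.congr {n : ℕ} (h : explore N' a n = explore N a n)
    (h' : explore N' a (n + 1) = explore N a (n + 1)) (hN : LocFin N) (hX : LocFin a.extra)
    (hc : HasCand N a n) : HasCand N' a n := by
  obtain ⟨i, hi⟩ := exists_isMoving (pos N a n)
  have hi' : IsMoving (pos N' a n) i := by rwa [pos_congr h]
  have hA := isAncestor_pos_succ N a hN hX hi hc
  rcases ancestor_cases (cand N' a n) (pos N' a n i) with h1 | h1
  · exact ⟨_, h1.1, by have := h1.2.1; rwa [hi'.moveLevel_eq] at this⟩
  · rw [← pos_succ_of_moving N' a hi', pos_congr h', pos_congr h] at h1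
    have := hA.2.1
    rw [h1] at this
    exact absurd this (lt_irrefl _)

theorem mem_hist_of_start {n : ℕ} (h0 : ∀ x ∈ a.hist, level a.pts ≤ x 1) {y : Plane}
    (hy : y ∈ a.hist) (hl : moveLevel N a n ≤ y 1) : y ∈ hist N a n :=
  (mem_hist_iff N a h0).2 ⟨Or.inl hy, hl⟩

/-- The process only depends on the points that are above the starting level and outside of the
initial history set. -/
theorem explore_fresh (h0 : ∀ x ∈ a.hist, level a.pts ≤ x 1)
    (hag : ∀ y, level a.pts < y 1 → y ∉ a.hist → (y ∈ N ↔ y ∈ N')) (n : ℕ) :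
    explore N' a n = explore N a n := by
  induction n with
  | zero => rfl
  | succ n ih =>
    refine explore_succ_congr ih fun i hi => ancestor_congr fun z hz => ?_
    rw [hi.moveLevel_eq] at hz
    have hl : level a.pts < z 1 := (moveLevel_mono N a (Nat.zero_le n)).trans_lt hz
    simp only [cand, mem_union, mem_sdiff, pos_congr ih, hist_congr ih]
    refine or_congr_left (and_congr_left fun hh => ?_)
    exact (hag z hl fun h => hh (mem_hist_of_start h0 h hz.le)).symm

/-! ### Good steps -/

variable (κ N a) in
theorem goodStep_zero : goodStep κ N a 0 = 0 := rfl

theorem goodStep_succ_spec {j : ℕ} (h : goodStep κ N a (j + 1) ≠ ⊤) :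
    ∃ n : ℕ, 1 ≤ n ∧ goodStep κ N a (j + 1) = ((k * n : ℕ) : ℕ∞) ∧
      goodStep κ N a j < ((k * n : ℕ) : ℕ∞) ∧ height (hist N a (k * n)) ≤ κ ∧
      moveLevel N a (goodStep κ N a j).toNat + κ + 1 ≤ moveLevel N a (k * n) := by
  have hne : {t : ℕ∞ | ∃ n : ℕ, 1 ≤ n ∧ t = ((k * n : ℕ) : ℕ∞) ∧ goodStep κ N a j < t ∧
      height (explore N a (k * n)).hist ≤ κ ∧
      moveLevel N a (goodStep κ N a j).toNat + κ + 1 ≤ moveLevel N a (k * n)}.Nonempty := by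
    rw [nonempty_iff_ne_empty]
    intro h'
    apply h
    rw [goodStep, h', sInf_empty]
  obtain ⟨n, h1, h2, h3, h4, h5⟩ := csInf_mem hne
  have h2' : goodStep κ N a (j + 1) = ((k * n : ℕ) : ℕ∞) := h2
  refine ⟨n, h1, h2', ?_, h4, h5⟩
  rw [← h2']
  exact h3

theorem goodStep_succ_le {j n : ℕ} (h1 : 1 ≤ n) (h2 : goodStep κ N a j < ((k * n : ℕ) : ℕ∞))
    (h3 : height (hist N a (k * n)) ≤ κ)
    (h4 : moveLevel N a (goodStep κ N a j).toNat + κ + 1 ≤ moveLevel N a (k * n)) :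
    goodStep κ N a (j + 1) ≤ ((k * n : ℕ) : ℕ∞) :=
  csInf_le (OrderBot.bddBelow _) ⟨n, h1, rfl, h2, h3, h4⟩

theorem goodStep_lt_succ {j : ℕ} (h : goodStep κ N a (j + 1) ≠ ⊤) :
    goodStep κ N a j < goodStep κ N a (j + 1) := by
  obtain ⟨n, -, h2, h3, -⟩ := goodStep_succ_spec h
  rwa [h2]

theorem goodStep_mono : Monotone (goodStep κ N a) := by
  refine monotone_nat_of_le_succ fun j => ?_
  by_cases h : goodStep κ N a (j + 1) = ⊤
  · rw [h]; exact le_top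
  · exact (goodStep_lt_succ h).le

/-- This spacing keeps the semi-balls of radius `κ + 1` tested at a good step from reaching above
the level of any later one, so that each trial uses new points. -/
theorem level_goodStep_lt {i j : ℕ} (hij : i < j) (h : goodStep κ N a j ≠ ⊤) :
    moveLevel N a (goodStep κ N a i).toNat + κ + 1 ≤ moveLevel N a (goodStep κ N a j).toNat := by
  obtain ⟨m, rfl⟩ : ∃ m, j = m + 1 := ⟨j - 1, by omega⟩
  obtain ⟨n, -, h2, h3, -, h5⟩ := goodStep_succ_spec h
  have hi : (goodStep κ N a i).toNat ≤ (goodStep κ N a m).toNat := by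
    refine ENat.toNat_le_toNat (goodStep_mono (by omega)) ?_
    exact ne_top_of_lt h3
  have := moveLevel_mono N a hi
  rw [h2, ENat.toNat_natCast]
  linarith

theorem goodStep_congr {m : ℕ} (h : ∀ j ≤ m, explore N' a j = explore N a j) {j : ℕ}
    (hj : goodStep κ N a j ≤ m) : goodStep κ N' a j = goodStep κ N a j := by
  induction j with
  | zero => rfl
  | succ j ih =>
    have hne : goodStep κ N a (j + 1) ≠ ⊤ := ne_top_of_le_ne_top (ENat.natCast_ne_top m) hj
    obtain ⟨n, h1, h2, h3, h4, h5⟩ := goodStep_succ_spec hne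
    rw [h2] at hj
    have hkn : k * n ≤ m := by exact_mod_cast hj
    have ih := ih (h3.le.trans hj)
    have hs : (goodStep κ N a j).toNat ≤ m := by
      rw [← ENat.natCast_le_natCast, ENat.natCast_toNat (ne_top_of_lt h3)]
      exact h3.le.trans hj
    have hle : goodStep κ N' a (j + 1) ≤ ((k * n : ℕ) : ℕ∞) := by
      refine goodStep_succ_le h1 (by rwa [ih]) ?_ ?_
      · rwa [hist_congr (h _ hkn)]
      · rwa [ih, moveLevel_congr (h _ hkn), moveLevel_congr (h _ hs)]
    have hne' : goodStep κ N' a (j + 1) ≠ ⊤ := ne_top_of_le_ne_top (ENat.natCast_ne_top _) hle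
    obtain ⟨n', h1', h2', h3', h4', h5'⟩ := goodStep_succ_spec hne'
    have hkn' : k * n' ≤ m := by
      rw [h2'] at hle
      exact (by exact_mod_cast hle : k * n' ≤ k * n).trans hkn
    rw [ih] at h3' h5'
    have hge : goodStep κ N a (j + 1) ≤ ((k * n' : ℕ) : ℕ∞) := by
      refine goodStep_succ_le h1' h3' ?_ ?_
      · rwa [← hist_congr (h _ hkn')]
      · rwa [← moveLevel_congr (h _ hkn'), ← moveLevel_congr (h _ hs)]
    refine le_antisymm ?_ ?_
    · rw [h2]; exact hle
    · rw [h2']; exact hge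

theorem firstRenewal_spec (h : firstRenewal κ N a ≠ ⊤) :
    ∃ j : ℕ, firstRenewal κ N a = goodStep κ N a (j + 1) ∧ RenewalEvent κ N a (j + 1) := by
  have hne : {t : ℕ∞ | 0 < t ∧ ∃ j, t = goodStep κ N a j ∧ RenewalEvent κ N a j}.Nonempty := by
    rw [nonempty_iff_ne_empty]
    intro h'
    apply h
    rw [firstRenewal, h', sInf_empty]
  obtain ⟨h1, j, h2, h3⟩ := csInf_mem hne
  cases j with
  | zero =>
    rw [h2] at h1
    exact absurd h1 (lt_irrefl _)
  | succ j => exact ⟨j, h2, h3⟩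

theorem firstRenewal_le {j : ℕ} (h : RenewalEvent κ N a (j + 1)) :
    firstRenewal κ N a ≤ goodStep κ N a (j + 1) :=
  csInf_le (OrderBot.bddBelow _) ⟨(zero_le).trans_lt (goodStep_lt_succ h.1), j + 1, rfl, h⟩

/-! ### Renewal events and regeneration -/

theorem down_one (g : Fin k → Plane) (i : Fin k) : down g i 1 = level g := by simp [down]

theorem down_zero (g : Fin k → Plane) (i : Fin k) : down g i 0 = g i 0 := by simp [down]

theorem up_one (κ : ℕ) (g : Fin k → Plane) (i : Fin k) : up κ g i 1 = level g + κ := by simp [up]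

theorem up_zero (κ : ℕ) (g : Fin k → Plane) (i : Fin k) : up κ g i 0 = g i 0 := by simp [up]

theorem level_up (κ : ℕ) (g : Fin k → Plane) : level (up κ g) = level g + κ := by
  unfold level
  simp only [up_one]
  exact ciInf_const

theorem dist_up_down (κ : ℕ) (g : Fin k → Plane) (i : Fin k) : dist (up κ g i) (down g i) ≤ κ := by
  rw [dist_le_iff (by positivity), up_zero, up_one, down_zero, down_one]
  simp

theorem le_of_mem_semiBall {x y : Plane} {r : ℝ} (h : y ∈ semiBall x r) :
    x 1 ≤ y 1 ∧ y 1 ≤ x 1 + r := by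
  refine ⟨h.2, ?_⟩
  have h1 := coord_sub_le_dist y x 1
  have h2 := Metric.mem_closedBall.1 h.1
  linarith

theorem mem_ball_of_mem_up {κ : ℕ} {g : Fin k → Plane} {i : Fin k} {y : Plane}
    (h : y ∈ semiBall (up κ g i) 1) : y ∈ semiBall (down g i) (κ + 1) ∧ level g + κ ≤ y 1 := by
  have h1 := (le_of_mem_semiBall h).1
  rw [up_one] at h1
  refine ⟨⟨?_, ?_⟩, h1⟩
  · have h2 := Metric.mem_closedBall.1 h.1
    have h3 := dist_triangle y (up κ g i) (down g i)
    have h4 := dist_up_down κ g i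
    rw [Metric.mem_closedBall]
    linarith
  · change down g i 1 ≤ y 1
    rw [down_one]
    have : (0 : ℝ) ≤ κ := by positivity
    linarith

/-- The region that must be known at the start of the process. -/
def zone (a : Start k) : Set Plane := {y | y 1 ≤ level a.pts} ∪ a.hist

theorem renewalEvent_congr {j : ℕ} (hg : goodStep κ N' a j = goodStep κ N a j)
    (he : explore N' a (goodStep κ N a j).toNat = explore N a (goodStep κ N a j).toNat)
    (hag : ∀ i, ∀ y ∈ semiBall (down (pos N a (goodStep κ N a j).toNat) i) (κ + 1),
      (y ∈ N ↔ y ∈ N')) : RenewalEvent κ N' a j ↔ RenewalEvent κ N a j := by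
  unfold RenewalEvent
  rw [hg]
  refine and_congr_right fun hne => ?_
  simp only [he]
  refine forall_congr' fun i => ?_
  have e1 : (semiBall (down (explore N a (goodStep κ N a j).toNat).pos i) (κ + 1) \
      (explore N a (goodStep κ N a j).toNat).hist) ∩ N' =
      (semiBall (down (explore N a (goodStep κ N a j).toNat).pos i) (κ + 1) \
      (explore N a (goodStep κ N a j).toNat).hist) ∩ N := by
    ext y
    exact and_congr_right fun h => (hag i y h.1).symm
  have e2 : semiBall (up κ (explore N a (goodStep κ N a j).toNat).pos i) 1 ∩ N' =
      semiBall (up κ (explore N a (goodStep κ N a j).toNat).pos i) 1 ∩ N := by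
    ext y
    exact and_congr_right fun h => (hag i y (mem_ball_of_mem_up h).1).symm
  rw [e1, e2]

/-- The first renewal step only depends on the points above the starting level and outside of the
initial history set. -/
theorem firstRenewal_fresh (ha : a.Good κ) (hκ : 1 ≤ κ) (hag : ∀ y ∉ zone a, (y ∈ N ↔ y ∈ N')) :
    firstRenewal κ N' a = firstRenewal κ N a := by
  have he : ∀ n, explore N' a n = explore N a n := explore_fresh ha.le_hist fun y h1 h2 =>
    hag y fun h => h.elim (fun h => absurd (show y 1 ≤ level a.pts from h) (not_le.2 h1)) h2
  have hg : ∀ j, goodStep κ N' a j = goodStep κ N a j := by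
    intro j
    by_cases h : goodStep κ N a j = ⊤
    · by_contra hne
      rw [h] at hne
      have := goodStep_congr (κ := κ) (N := N') (N' := N) (m := (goodStep κ N' a j).toNat)
        (fun n _ => (he n).symm) (j := j) (by rw [ENat.natCast_toNat hne])
      exact hne (this.symm.trans h)
    · exact goodStep_congr (m := (goodStep κ N a j).toNat) (fun n _ => he n)
        (by rw [ENat.natCast_toNat h])
  have hR : ∀ j, RenewalEvent κ N' a (j + 1) ↔ RenewalEvent κ N a (j + 1) := by
    intro j
    by_cases h : goodStep κ N a (j + 1) = ⊤
    · exact ⟨fun h' => absurd h (by rw [← hg]; exact h'.1), fun h' => absurd h h'.1⟩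
    refine renewalEvent_congr (hg _) (he _) fun i y hy => hag y ?_
    have h1 := (le_of_mem_semiBall hy).1
    rw [down_one] at h1
    -- A good step of positive index is at least `κ + 1` above the start, out of reach of the
    -- initial history set, which extends at most `1` above it.
    have h2 := level_goodStep_lt (Nat.succ_pos j) h
    have h3 : level a.pts ≤ moveLevel N a (goodStep κ N a 0).toNat :=
      moveLevel_mono N a (Nat.zero_le _)
    have h4 : level (pos N a (goodStep κ N a (j + 1)).toNat) =
      moveLevel N a (goodStep κ N a (j + 1)).toNat := rfl
    have h5 : (1 : ℝ) ≤ κ := by exact_mod_cast hκ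
    rintro (h | h)
    · have h' : y 1 ≤ level a.pts := h
      linarith
    · have := ha.hist_le y h
      linarith
  unfold firstRenewal
  congr 1
  ext t
  refine and_congr_right fun ht => exists_congr fun j => ?_
  rw [hg]
  cases j with
  | zero =>
    refine and_congr_right fun h => ?_
    rw [h] at ht
    exact absurd ht (lt_irrefl _)
  | succ j => rw [hR]

theorem level_regenerate (κ : ℕ) (N : Set Plane) (a : Start k) :
    level (regenerate κ N a).pts = moveLevel N a (firstRenewal κ N a).toNat + κ :=
  level_up κ _

theorem regenerate_good (κ : ℕ) (N : Set Plane) (a : Start k) : (regenerate κ N a).Good κ := by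
  refine ⟨fun i j => ?_, fun x hx => ?_, fun x hx => ?_⟩
  · simp only [regenerate, up_one, sub_self, abs_zero]
    positivity
  · rw [level_regenerate]
    exact hx.2
  · obtain ⟨i, hi⟩ := mem_iUnion.1 hx.1
    have := (le_of_mem_semiBall hi).2
    rw [down_one] at this
    rw [level_regenerate]
    change _ ≤ level (explore N a (firstRenewal κ N a).toNat).pos + κ + 1
    linarith

theorem regenStart_good (ha : a.Good κ) (N : Set Plane) (l : ℕ) :
    (regenStart κ N a l).Good κ := by
  cases l with
  | zero => exact ha
  | succ l => exact regenerate_good κ N _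

theorem regenStart_extra_locFin (hN : LocFin N) (hX : LocFin a.extra) (l : ℕ) :
    LocFin (regenStart κ N a l).extra := by
  cases l with
  | zero => exact hX
  | succ l => exact hN.mono inter_subset_left

/-- The first renewal step is finite and it is reached without lack of candidates. -/
def RenewAlive (κ : ℕ) (N : Set Plane) (a : Start k) : Prop :=
  firstRenewal κ N a ≠ ⊤ ∧ ∀ j < (firstRenewal κ N a).toNat, HasCand N a j

/-- The new starting level is at least `κ ≥ 1` above the old one, so its half-plane swallows the old
history set. -/
theorem zone_subset (hκ : 1 ≤ κ) (ha : a.Good κ) :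
    zone a ⊆ zone (regenerate κ N a) := by
  have hκ' : (1 : ℝ) ≤ κ := by exact_mod_cast hκ
  intro y hy
  refine Or.inl ?_
  change y 1 ≤ _
  rw [level_regenerate]
  have h3 : level a.pts ≤ moveLevel N a (firstRenewal κ N a).toNat :=
    moveLevel_mono N a (Nat.zero_le _)
  rcases hy with h | h
  · have h : y 1 ≤ level a.pts := h
    linarith
  · have := ha.hist_le y h
    linarith

/-- The regenerated history set keeps only the part of the ball above the new level; the rest lies
in the half-plane of the zone. -/
theorem ball_subset_zone {i : Fin k} {y : Plane}
    (h : dist y (down (pos N a (firstRenewal κ N a).toNat) i) ≤ κ + 1) :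
    y ∈ zone (regenerate κ N a) := by
  by_cases hy : y 1 ≤ level (regenerate κ N a).pts
  · exact Or.inl hy
  · refine Or.inr ⟨mem_iUnion.2 ⟨i, Metric.mem_closedBall.2 h, ?_⟩, ?_⟩
    · change down (pos N a (firstRenewal κ N a).toNat) i 1 ≤ y 1
      rw [down_one]
      rw [level_regenerate] at hy
      have : (0 : ℝ) ≤ κ := by positivity
      change moveLevel N a (firstRenewal κ N a).toNat ≤ y 1
      linarith
    · rw [level_regenerate] at hy
      exact (not_le.1 hy).le

/-- What the process reveals until its first renewal step. -/
structure SameBlock (κ : ℕ) (N N' : Set Plane) (a : Start k) : Prop where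
  renewal : firstRenewal κ N' a = firstRenewal κ N a
  explore : ∀ j ≤ (firstRenewal κ N a).toNat, explore N' a j = explore N a j
  goodStep : ∀ j, min (goodStep κ N' a j) (firstRenewal κ N a) =
    min (goodStep κ N a j) (firstRenewal κ N a)
  event : ∀ j, (DSF.goodStep κ N' a j ≤ firstRenewal κ N a ∧ RenewalEvent κ N' a j) ↔
    (DSF.goodStep κ N a j ≤ firstRenewal κ N a ∧ RenewalEvent κ N a j)
  regenerate : regenerate κ N' a = regenerate κ N a
  alive : RenewAlive κ N' a

/-- The history set of a renewal step has height at most `κ`, so no ball explored so far reaches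
above the new starting level. Neither do the semi-balls tested at earlier good steps, by their
spacing, and those tested at the renewal step itself belong to the zone. -/
theorem renewal_stop (hκ : 1 ≤ κ) (ha : a.Good κ) (hN : LocFin N) (hX : LocFin a.extra)
    (hal : RenewAlive κ N a) (hag : ∀ y ∈ zone (regenerate κ N a), (y ∈ N ↔ y ∈ N')) :
    SameBlock κ N N' a := by
  have hκ' : (1 : ℝ) ≤ κ := by exact_mod_cast hκ
  obtain ⟨hne, hc⟩ := hal
  obtain ⟨j0, hj0, hR⟩ := firstRenewal_spec hne
  obtain ⟨n0, hn1, hn2, hn3, hn4, hn5⟩ := goodStep_succ_spec hR.1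
  set b := firstRenewal κ N a with hb
  have hbk : b.toNat = k * n0 := by rw [hj0, hn2, ENat.toNat_natCast]
  have hcoe : ((b.toNat : ℕ) : ℕ∞) = b := ENat.natCast_toNat hne
  have hkn : 1 ≤ k * n0 := Nat.mul_pos (NeZero.pos k) hn1
  have h0 : ∀ x ∈ a.hist, level a.pts ≤ x 1 ∧ x 1 ≤ level a.pts + 1 :=
    fun x hx => ⟨ha.le_hist x hx, ha.hist_le x hx⟩
  have hzl : ∀ y : Plane, y 1 ≤ moveLevel N a b.toNat + κ → (y ∈ N ↔ y ∈ N') := fun y hy =>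
    hag y (Or.inl (by rw [← level_regenerate] at hy; exact hy))
  have he : ∀ j ≤ b.toNat, explore N' a j = explore N a j := by
    intro j hj
    refine explore_stop hN hX hc ?_ hj
    rintro y ⟨j', hj', i, hi, hd⟩
    rw [hbk] at hj'
    rw [stepLen_eq N a hi] at hd
    have := (height_hist_le_iff N a ha.pts_close hκ h0 hkn).1 hn4 j' hj' i
    refine hzl y ?_
    rw [hbk]
    have := coord_sub_le_dist y (pos N a j' i) 1
    linarith
  have hgs : ∀ j, goodStep κ N a j ≤ b → goodStep κ N' a j = goodStep κ N a j := fun j hj =>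
    goodStep_congr he (by rwa [hcoe])
  have hgs' : ∀ j, goodStep κ N' a j ≤ b → goodStep κ N' a j = goodStep κ N a j := fun j hj =>
    (goodStep_congr (N := N') (N' := N) (fun m hm => (he m hm).symm) (by rwa [hcoe])).symm
  have hev : ∀ j, goodStep κ N a j ≤ b → (RenewalEvent κ N' a j ↔ RenewalEvent κ N a j) := by
    intro j hj
    refine renewalEvent_congr (hgs j hj) (he _ (ENat.toNat_le_toNat hj hne)) fun i y hy => ?_
    rcases lt_or_ge j (j0 + 1) with h | h
    · have h1 := level_goodStep_lt h hR.1
      rw [← hj0] at h1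
      have h2 := (le_of_mem_semiBall hy).2
      rw [down_one] at h2
      refine hzl y ?_
      have h3 : level (pos N a (goodStep κ N a j).toNat) =
        moveLevel N a (goodStep κ N a j).toNat := rfl
      linarith
    · have h1 : goodStep κ N a j = b := le_antisymm hj (by rw [hj0]; exact goodStep_mono h)
      rw [h1] at hy
      exact hag y (ball_subset_zone (Metric.mem_closedBall.1 hy.1))
  have hren : firstRenewal κ N' a = b := by
    refine le_antisymm ?_ ?_
    · have h1 : goodStep κ N' a (j0 + 1) = b := by rw [hgs _ hj0.ge, hj0]
      rw [← h1]
      exact firstRenewal_le ((hev _ hj0.ge).2 hR)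
    · by_contra! hlt
      obtain ⟨j, h1, h2⟩ := firstRenewal_spec (ne_top_of_lt hlt)
      have h3 := hgs' (j + 1) (by rw [← h1]; exact hlt.le)
      have h4 : goodStep κ N a (j + 1) ≤ b := by rw [← h3, ← h1]; exact hlt.le
      have h5 := firstRenewal_le ((hev _ h4).1 h2)
      rw [← h3, ← h1] at h5
      exact absurd hlt (not_lt.2 h5)
  refine ⟨hren, he, fun j => ?_, fun j => ?_, ?_, ?_⟩
  · by_cases h : goodStep κ N a j ≤ b
    · rw [hgs j h]
    · have h' : ¬ goodStep κ N' a j ≤ b := fun h' => h (by rw [← hgs' j h']; exact h')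
      rw [min_eq_right (not_le.1 h).le, min_eq_right (not_le.1 h').le]
  · constructor
    · rintro ⟨h1, h2⟩
      have h3 : goodStep κ N a j ≤ b := by rw [← hgs' j h1]; exact h1
      exact ⟨h3, (hev j h3).1 h2⟩
    · rintro ⟨h1, h2⟩
      exact ⟨by rw [hgs j h1]; exact h1, (hev j h1).2 h2⟩
  · unfold DSF.regenerate
    rw [hren, he b.toNat le_rfl, ← hb]
    simp only [Start.mk.injEq, true_and]
    ext y
    refine and_congr_left fun hy => (hag y ?_).symm
    obtain ⟨i, hi⟩ := mem_iUnion.1 hy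
    exact ball_subset_zone (Metric.mem_closedBall.1 (mem_ball_of_mem_up hi).1.1)
  · refine ⟨by rw [hren]; exact hne, fun j hj => ?_⟩
    rw [hren] at hj
    exact HasCand.congr (he j hj.le) (he (j + 1) hj) hN hX (hc j hj)

/-- The first `l` renewal steps are finite. -/
def RegenAlive (κ : ℕ) (N : Set Plane) (a : Start k) (l : ℕ) : Prop :=
  ∀ m < l, RenewAlive κ N (regenStart κ N a m)

/-- The zones increase with `l`, so agreement on the last one implies agreement on the earlier ones
and `renewal_stop` can be iterated. -/
theorem regen_stop (hκ : 1 ≤ κ) (ha : a.Good κ) (hN : LocFin N) (hX : LocFin a.extra) {l : ℕ}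
    (hal : RegenAlive κ N a l) (hag : ∀ y ∈ zone (regenStart κ N a l), (y ∈ N ↔ y ∈ N')) :
    regenStart κ N' a l = regenStart κ N a l ∧
      ∀ m < l, regenStart κ N' a m = regenStart κ N a m ∧
        SameBlock κ N N' (regenStart κ N a m) := by
  induction l with
  | zero => exact ⟨rfl, fun m hm => absurd hm (Nat.not_lt_zero m)⟩
  | succ l ih =>
    have hl := hal l (Nat.lt_succ_self l)
    have hg := regenStart_good ha N l
    have hsub := zone_subset (N := N) hκ hg
    obtain ⟨h1, h2⟩ := ih (fun m hm => hal m (hm.trans (Nat.lt_succ_self l)))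
      (fun y hy => hag y (hsub hy))
    have h3 := renewal_stop hκ hg hN (regenStart_extra_locFin hN hX l) hl hag
    refine ⟨?_, fun m hm => ?_⟩
    · rw [regenStart, regenStart, h1, h3.regenerate]
    · rcases Nat.lt_succ_iff_lt_or_eq.1 hm with h | rfl
      · exact h2 m h
      · exact ⟨h1, h3⟩

end Local

/-! ### Measurability of random sets -/

section Random

variable {Ω : Type*} [MeasurableSpace Ω]

/-- A random set with measurable graph. -/
def GraphMeas (H : Ω → Set Plane) : Prop := MeasurableSet {p : Ω × Plane | p.2 ∈ H p.1}

/-- A random set for which the events of hitting a random set with measurable graph are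
measurable. -/
def HitMeas (S : Ω → Set Plane) : Prop :=
  ∀ B : Set (Ω × Plane), MeasurableSet B → MeasurableSet {ω | ∃ y ∈ S ω, (ω, y) ∈ B}

/-- A random set for which the numbers of points in random sets with measurable graph are
measurable. -/
def CountMeas (S : Ω → Set Plane) : Prop :=
  ∀ B : Set (Ω × Plane), MeasurableSet B → Measurable fun ω => (S ω ∩ {y | (ω, y) ∈ B}).encard

theorem CountMeas.hitMeas {S : Ω → Set Plane} (h : CountMeas S) : HitMeas S := by
  intro B hB
  have h1 := (h B hB) (measurableSet_singleton 0).compl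
  convert h1 using 1
  ext ω
  simp only [mem_ofPred_eq, mem_preimage, mem_compl_iff, mem_singleton_iff, encard_eq_zero,
    ← nonempty_iff_ne_empty, Set.Nonempty, mem_inter_iff]

theorem CountMeas.inter {S H : Ω → Set Plane} (h : CountMeas S) (hH : GraphMeas H) :
    CountMeas fun ω => S ω ∩ H ω := by
  intro B hB
  have := h _ (hH.inter hB)
  convert this using 2 with ω
  congr 1
  ext y
  simp [and_assoc]

theorem HitMeas.union {S S' : Ω → Set Plane} (h : HitMeas S) (h' : HitMeas S') :
    HitMeas fun ω => S ω ∪ S' ω := by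
  intro B hB
  convert (h B hB).union (h' B hB) using 1
  ext ω
  simp only [mem_union, mem_ofPred_eq, or_and_right, exists_or]

theorem HitMeas.diff {S H : Ω → Set Plane} (h : HitMeas S) (hH : GraphMeas H) :
    HitMeas fun ω => S ω \ H ω := by
  intro B hB
  convert h _ (hH.compl.inter hB) using 1
  ext ω
  simp only [mem_sdiff, mem_ofPred_eq, mem_inter_iff, mem_compl_iff, and_assoc]

/-- Induction over the product sigma-field inside a bounded window, where finiteness turns
complements into subtractions. The windows then exhaust the plane. -/
theorem countMeas_of_locFin {S : Ω → Set Plane} (hS : ∀ ω, LocFin (S ω))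
    (hm : ∀ B : Set Plane, MeasurableSet B → Measurable fun ω => (S ω ∩ B).encard) :
    CountMeas S := by
  have hcoe : Measurable (fun n : ℕ∞ => (n : ENNReal)) := measurable_from_top
  have key : ∀ m : ℕ, ∀ B : Set (Ω × Plane), MeasurableSet B → Measurable fun ω =>
      (Measure.count (S ω ∩ (Metric.closedBall 0 m ∩ {y | (ω, y) ∈ B})) : ENNReal) := by
    intro m
    have hfin : ∀ ω, (S ω ∩ Metric.closedBall 0 m).Finite := fun ω =>
      hS ω _ Metric.isBounded_closedBall
    have hfin' : ∀ ω (C : Set Plane), (S ω ∩ (Metric.closedBall 0 m ∩ C)).Finite := fun ω C =>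
      (hfin ω).subset (inter_subset_inter_right _ inter_subset_left)
    have hD : MeasurableSet (Metric.closedBall (0 : Plane) m) :=
      Metric.isClosed_closedBall.measurableSet
    refine MeasurableSpace.induction_on_inter generateFrom_prod.symm isPiSystem_prod ?_ ?_ ?_ ?_
    · simp
    · rintro _ ⟨A, hA, C, hC, rfl⟩
      have : (fun ω => (Measure.count (S ω ∩ (Metric.closedBall 0 m ∩ {y | (ω, y) ∈ A ×ˢ C})) :
          ENNReal)) = A.indicator fun ω => (((S ω ∩ (Metric.closedBall 0 m ∩ C)).encard : ℕ∞) :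
            ENNReal) := by
        ext1 ω
        by_cases h : ω ∈ A
        · rw [indicator_of_mem h, ← Measure.count_apply (hfin' ω C).measurableSet]
          simp [h]
        · rw [indicator_of_notMem h]
          simp [h]
      rw [this]
      exact (hcoe.comp (hm _ (hD.inter hC))).indicator hA
    · intro B hB ih
      have : (fun ω => (Measure.count (S ω ∩ (Metric.closedBall 0 m ∩ {y | (ω, y) ∈ Bᶜ})) :
          ENNReal)) = fun ω => (((S ω ∩ Metric.closedBall 0 m).encard : ℕ∞) : ENNReal) -
            Measure.count (S ω ∩ (Metric.closedBall 0 m ∩ {y | (ω, y) ∈ B})) := by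
        ext1 ω
        rw [← Measure.count_apply (hfin ω).measurableSet, ← measure_sdiff _
          (hfin' ω _).measurableSet.nullMeasurableSet
          (Measure.count_apply_lt_top.2 (hfin' ω _)).ne]
        · congr 1
          ext y
          simp only [mem_inter_iff, mem_sdiff, mem_ofPred_eq, mem_compl_iff]
          tauto
        · exact inter_subset_inter_right _ inter_subset_left
      rw [this]
      exact (hcoe.comp (hm _ hD)).sub ih
    · intro f hd hf ih
      have : (fun ω => (Measure.count (S ω ∩ (Metric.closedBall 0 m ∩ {y | (ω, y) ∈ ⋃ i, f i})) :
          ENNReal)) = fun ω => ∑' i, Measure.count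
            (S ω ∩ (Metric.closedBall 0 m ∩ {y | (ω, y) ∈ f i})) := by
        ext1 ω
        rw [← measure_iUnion]
        · congr 1
          ext y
          simp only [mem_inter_iff, mem_ofPred_eq, mem_iUnion]
          constructor
          · rintro ⟨h1, h2, i, h3⟩
            exact ⟨i, h1, h2, h3⟩
          · rintro ⟨i, h1, h2, h3⟩
            exact ⟨h1, h2, i, h3⟩
        · intro i j hij
          rw [Function.onFun, Set.disjoint_left]
          rintro y ⟨-, -, h1⟩ ⟨-, -, h2⟩
          exact (Set.disjoint_left.1 (hd hij)) h1 h2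
        · exact fun i => (hfin' ω _).measurableSet
      rw [this]
      exact Measurable.tsum ih
  intro B hB
  have hb := borelSpace_enat
  have : (fun ω => (S ω ∩ {y | (ω, y) ∈ B}).encard) = fun ω => ⨆ m : ℕ,
      (S ω ∩ ({y | (ω, y) ∈ B} ∩ Metric.closedBall 0 m)).encard := by
    ext1 ω
    exact encard_inter_eq_iSup _ _
  rw [this]
  refine Measurable.iSup fun m => measurable_to_countable' fun n => ?_
  have h1 := key m B hB (measurableSet_singleton (n : ENNReal))
  convert h1 using 1
  ext ω
  simp only [mem_preimage, mem_singleton_iff]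
  rw [inter_comm {y | (ω, y) ∈ B}, Measure.count_apply]
  · exact ENat.toENNReal_inj.symm
  · exact ((hS ω _ Metric.isBounded_closedBall).subset
      (inter_subset_inter_right _ inter_subset_left)).measurableSet

theorem measurable_plane {f g : Ω → ℝ} (hf : Measurable f) (hg : Measurable g) :
    Measurable fun ω => (!₂[f ω, g ω] : Plane) := by
  refine (MeasurableEquiv.toLp 2 (Fin 2 → ℝ)).measurable.comp (measurable_pi_lambda _ fun i => ?_)
  fin_cases i
  · exact hf
  · exact hg

theorem measurable_coord_comp {f : Ω → Plane} (hf : Measurable f) (i : Fin 2) :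
    Measurable fun ω => f ω i := (measurable_coord i).comp hf

/-- Three rounds of hitting events: first the distance to the ancestor is shown to be measurable,
then its abscissa, using the points at that distance; a point of `S` above `x` with both values
right is the ancestor, so its position can be tested at last. -/
theorem measurable_ancestor {S : Ω → Set Plane} (hS : HitMeas S) (hf : ∀ ω, LocFin (S ω))
    {x : Ω → Plane} (hx : Measurable x) : Measurable fun ω => ancestor (S ω) (x ω) := by
  set y := fun ω => ancestor (S ω) (x ω) with hy
  have hx0 := measurable_coord_comp hx 0
  have hx1 := measurable_coord_comp hx 1
  have habove : MeasurableSet {p : Ω × Plane | x p.1 1 < p.2 1} :=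
    measurableSet_lt (hx1.comp measurable_fst) ((measurable_coord 1).comp measurable_snd)
  set A : Set Ω := {ω | ∃ z ∈ S ω, x ω 1 < z 1} with hA
  have hAm : MeasurableSet A := hS _ habove
  have hanc : ∀ ω ∈ A, IsAncestor (S ω) (x ω) (y ω) := by
    intro ω hω
    obtain ⟨z, hz⟩ := exists_isAncestor (hf ω) hω
    simp only [hy]
    rw [ancestor_eq hz]
    exact hz
  have hnot : ∀ ω, ω ∉ A → y ω = x ω := by
    intro ω hω
    exact ancestor_of_not fun ⟨z, hz⟩ => hω ⟨z, hz.1, hz.2.1⟩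
  have hdm : Measurable fun p : Ω × Plane => dist (x p.1) p.2 :=
    (hx.comp measurable_fst).dist measurable_snd
  have hR : Measurable fun ω => dist (x ω) (y ω) := by
    refine measurable_of_Iio fun r => ?_
    have : (fun ω => dist (x ω) (y ω)) ⁻¹' Iio r = (A ∩ {ω | ∃ z ∈ S ω, (ω, z) ∈
        {p : Ω × Plane | x p.1 1 < p.2 1} ∩ {p | dist (x p.1) p.2 < r}}) ∪
          (Aᶜ ∩ {_ω | 0 < r}) := by
      ext ω
      simp only [mem_preimage, mem_Iio, mem_union, mem_inter_iff, mem_ofPred_eq, mem_compl_iff]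
      by_cases hω : ω ∈ A
      · have h := hanc ω hω
        simp only [hω, true_and, not_true_eq_false, false_and, or_false]
        constructor
        · exact fun hr => ⟨y ω, h.1, h.2.1, hr⟩
        · rintro ⟨z, hz, hxz, hr⟩
          exact (h.2.2 z hz hxz).1.trans_lt hr
      · simp [hω, hnot ω hω]
    rw [this]
    exact (hAm.inter (hS _ (habove.inter (measurableSet_lt hdm measurable_const)))).union
      (hAm.compl.inter (MeasurableSet.const _))
  have hclose : MeasurableSet {p : Ω × Plane | dist (x p.1) p.2 = dist (x p.1) (y p.1)} :=
    measurableSet_eq_fun hdm (hR.comp measurable_fst)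
  have hy0 : Measurable fun ω => y ω 0 := by
    refine measurable_of_Iio fun t => ?_
    have : (fun ω => y ω 0) ⁻¹' Iio t = (A ∩ {ω | ∃ z ∈ S ω, (ω, z) ∈
        {p : Ω × Plane | x p.1 1 < p.2 1} ∩ ({p | dist (x p.1) p.2 = dist (x p.1) (y p.1)} ∩
          {p | p.2 0 < t})}) ∪ (Aᶜ ∩ {ω | x ω 0 < t}) := by
      ext ω
      simp only [mem_preimage, mem_Iio, mem_union, mem_inter_iff, mem_ofPred_eq, mem_compl_iff]
      by_cases hω : ω ∈ A
      · have h := hanc ω hω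
        simp only [hω, true_and, not_true_eq_false, false_and, or_false]
        constructor
        · exact fun hr => ⟨y ω, h.1, h.2.1, rfl, hr⟩
        · rintro ⟨z, hz, hxz, hd, hr⟩
          exact ((h.2.2 z hz hxz).2 hd).trans_lt hr
      · simp [hω, hnot ω hω]
    rw [this]
    exact (hAm.inter (hS _ (habove.inter (hclose.inter (measurableSet_lt
      ((measurable_coord 0).comp measurable_snd) measurable_const))))).union
      (hAm.compl.inter (measurableSet_lt hx0 measurable_const))
  intro C hC
  have : y ⁻¹' C = (A ∩ {ω | ∃ z ∈ S ω, (ω, z) ∈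
      {p : Ω × Plane | x p.1 1 < p.2 1} ∩ ({p | dist (x p.1) p.2 = dist (x p.1) (y p.1)} ∩
        ({p | p.2 0 = y p.1 0} ∩ {p | p.2 ∈ C}))}) ∪ (Aᶜ ∩ {ω | x ω ∈ C}) := by
    ext ω
    simp only [mem_preimage, mem_union, mem_inter_iff, mem_ofPred_eq, mem_compl_iff]
    by_cases hω : ω ∈ A
    · have h := hanc ω hω
      simp only [hω, true_and, not_true_eq_false, false_and, or_false]
      constructor
      · exact fun hr => ⟨y ω, h.1, h.2.1, rfl, rfl, hr⟩
      · rintro ⟨z, hz, hxz, hd, h0, hr⟩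
        have hz' : IsAncestor (S ω) (x ω) z := ⟨hz, hxz, fun v hv hxv => by
          rw [hd, h0]; exact h.2.2 v hv hxv⟩
        rwa [isAncestor_unique h hz']
    · simp [hω, hnot ω hω]
  rw [this]
  exact (hAm.inter (hS _ (habove.inter (hclose.inter ((measurableSet_eq_fun
    ((measurable_coord 0).comp measurable_snd) (hy0.comp measurable_fst)).inter
      (measurable_snd hC)))))).union (hAm.compl.inter (hx hC))

theorem measurable_nat_comp {E : Type*} [MeasurableSpace E] {f : ℕ → Ω → E}
    (hf : ∀ n, Measurable (f n)) {τ : Ω → ℕ} (hτ : Measurable τ) :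
    Measurable fun ω => f (τ ω) ω :=
  (measurable_from_prod_countable_left (f := fun p : Ω × ℕ => f p.2 p.1) hf).comp
    (measurable_id.prodMk hτ)

theorem measurableSet_nat_comp {A : ℕ → Set Ω} (hA : ∀ n, MeasurableSet (A n)) {τ : Ω → ℕ}
    (hτ : Measurable τ) : MeasurableSet {ω | ω ∈ A (τ ω)} := by
  have : {ω | ω ∈ A (τ ω)} = ⋃ n, (τ ⁻¹' {n} ∩ A n) := by
    ext ω; simp
  rw [this]
  exact MeasurableSet.iUnion fun n => (hτ (measurableSet_singleton n)).inter (hA n)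

theorem graphMeas_nat_comp {H : ℕ → Ω → Set Plane} (hH : ∀ n, GraphMeas (H n)) {τ : Ω → ℕ}
    (hτ : Measurable τ) : GraphMeas fun ω => H (τ ω) ω :=
  measurableSet_nat_comp (A := fun n => {p : Ω × Plane | p.2 ∈ H n p.1}) hH
    (hτ.comp measurable_fst)

theorem graphMeas_semiBall {c : Ω → Plane} (hc : Measurable c) {r : Ω → ℝ} (hr : Measurable r) :
    GraphMeas fun ω => semiBall (c ω) (r ω) :=
  (measurableSet_le (measurable_snd.dist (hc.comp measurable_fst)) (hr.comp measurable_fst)).inter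
    (measurableSet_le ((measurable_coord_comp hc 1).comp measurable_fst)
      ((measurable_coord 1).comp measurable_snd))

theorem graphMeas_upperHalf {r : Ω → ℝ} (hr : Measurable r) :
    GraphMeas fun ω => upperHalf (r ω) :=
  measurableSet_le (hr.comp measurable_fst) ((measurable_coord 1).comp measurable_snd)

theorem GraphMeas.iUnion {ι : Type*} [Countable ι] {H : ι → Ω → Set Plane}
    (h : ∀ i, GraphMeas (H i)) : GraphMeas fun ω => ⋃ i, H i ω := by
  unfold GraphMeas
  convert MeasurableSet.iUnion h using 1
  ext p
  simp

theorem measurable_level {k : ℕ} {g : Ω → Fin k → Plane}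
    (hg : ∀ i, Measurable fun ω => g ω i) : Measurable fun ω => level (g ω) :=
  Measurable.iInf fun i => measurable_coord_comp (hg i) 1

theorem measurableSet_isMoving {k : ℕ} {g : Ω → Fin k → Plane}
    (hg : ∀ i, Measurable fun ω => g ω i) (i : Fin k) : MeasurableSet {ω | IsMoving (g ω) i} := by
  have : {ω | IsMoving (g ω) i} = (⋂ j, {ω | g ω i 1 ≤ g ω j 1}) ∩
      ⋂ j, ({ω | g ω j 1 = g ω i 1}ᶜ ∪ {ω | g ω i 0 ≤ g ω j 0}) := by
    ext ω
    simp only [IsMoving, mem_ofPred_eq, mem_inter_iff, mem_iInter, mem_union, mem_compl_iff,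
      imp_iff_not_or]
  rw [this]
  have hc := fun (i : Fin k) (m : Fin 2) => measurable_coord_comp (hg i) m
  exact (MeasurableSet.iInter fun j => measurableSet_le (hc i 1) (hc j 1)).inter
    (MeasurableSet.iInter fun j => (measurableSet_eq_fun (hc j 1) (hc i 1)).compl.union
      (measurableSet_le (hc i 0) (hc j 0)))

theorem hitMeas_staySet {k : ℕ} {g : Ω → Fin k → Plane}
    (hg : ∀ i, Measurable fun ω => g ω i) : HitMeas fun ω => staySet (g ω) := by
  intro B hB
  have : {ω | ∃ y ∈ staySet (g ω), (ω, y) ∈ B} =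
      ⋃ j, ({ω | IsMoving (g ω) j}ᶜ ∩ {ω | (ω, g ω j) ∈ B}) := by
    ext ω
    simp only [staySet, mem_ofPred_eq, mem_iUnion, mem_inter_iff, mem_compl_iff]
    constructor
    · rintro ⟨y, ⟨j, h1, rfl⟩, h2⟩
      exact ⟨j, h1, h2⟩
    · rintro ⟨j, h1, h2⟩
      exact ⟨_, ⟨j, h1, rfl⟩, h2⟩
  rw [this]
  exact MeasurableSet.iUnion fun j => (measurableSet_isMoving hg j).compl.inter
    ((measurable_id.prodMk (hg j)) hB)

/-! ### Measurability of the exploration process -/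

/-- A measurable random starting configuration. -/
structure MeasStart {k : ℕ} (a : Ω → Start k) : Prop where
  pts : ∀ i, Measurable fun ω => (a ω).pts i
  hist : GraphMeas fun ω => (a ω).hist
  extra : CountMeas fun ω => (a ω).extra
  locFin : ∀ ω, LocFin (a ω).extra

variable {k : ℕ} {N : Ω → Set Plane} {a : Ω → Start k}

theorem measurable_explore (hN : CountMeas N) (hf : ∀ ω, LocFin (N ω)) (ha : MeasStart a) (n : ℕ) :
    (∀ i, Measurable fun ω => pos (N ω) (a ω) n i) ∧ GraphMeas fun ω => hist (N ω) (a ω) n := by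
  induction n with
  | zero => exact ⟨ha.pts, ha.hist⟩
  | succ n ih =>
    obtain ⟨hp, hh⟩ := ih
    have hcand : HitMeas fun ω => cand (N ω) (a ω) n :=
      (hN.hitMeas.diff hh).union ((hitMeas_staySet hp).union ha.extra.hitMeas)
    have hp' : ∀ i, Measurable fun ω => pos (N ω) (a ω) (n + 1) i := by
      intro i
      classical
      have : (fun ω => pos (N ω) (a ω) (n + 1) i) = fun ω =>
          if ω ∈ {ω | IsMoving (pos (N ω) (a ω) n) i} then
            ancestor (cand (N ω) (a ω) n) (pos (N ω) (a ω) n i) else pos (N ω) (a ω) n i := by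
        ext1 ω
        split_ifs with h
        · exact pos_succ_of_moving _ _ h
        · exact pos_succ_of_not _ _ h
      rw [this]
      exact Measurable.ite (measurableSet_isMoving hp i)
        (measurable_ancestor hcand (fun ω => (((hf ω).mono sdiff_subset).union
          ((locFin_of_finite (staySet_finite _)).union (ha.locFin ω)))) (hp i)) (hp i)
    refine ⟨hp', ?_⟩
    have hb : GraphMeas fun ω => ⋃ i, semiBall (pos (N ω) (a ω) n i)
        (dist (pos (N ω) (a ω) (n + 1) i) (pos (N ω) (a ω) n i)) :=
      GraphMeas.iUnion fun i => graphMeas_semiBall (hp i) ((hp' i).dist (hp i))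
    exact (hh.union hb).inter (graphMeas_upperHalf (measurable_level hp'))

variable [NeZero k] {κ : ℕ}

theorem measurable_pos (hN : CountMeas N) (hf : ∀ ω, LocFin (N ω)) (ha : MeasStart a) (n : ℕ)
    (i : Fin k) : Measurable fun ω => pos (N ω) (a ω) n i := (measurable_explore hN hf ha n).1 i

theorem measurable_moveLevel (hN : CountMeas N) (hf : ∀ ω, LocFin (N ω)) (ha : MeasStart a)
    (n : ℕ) : Measurable fun ω => moveLevel (N ω) (a ω) n :=
  measurable_level fun i => measurable_pos hN hf ha n i

theorem measurableSet_height (hN : CountMeas N) (hf : ∀ ω, LocFin (N ω)) (ha : MeasStart a)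
    (hg : ∀ ω, (a ω).Good κ) (hκ : 1 ≤ κ) {n : ℕ} (hn : 1 ≤ n) :
    MeasurableSet {ω | height (hist (N ω) (a ω) n) ≤ κ} := by
  have : {ω | height (hist (N ω) (a ω) n) ≤ κ} = ⋂ j : Fin n, ⋂ i : Fin k,
      {ω | pos (N ω) (a ω) j i 1 + dist (pos (N ω) (a ω) (j + 1) i) (pos (N ω) (a ω) j i) ≤
        moveLevel (N ω) (a ω) n + κ} := by
    ext ω
    simp only [mem_ofPred_eq, mem_iInter]
    rw [height_hist_le_iff _ _ (hg ω).pts_close hκ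
      (fun x hx => ⟨(hg ω).le_hist x hx, (hg ω).hist_le x hx⟩) hn]
    exact ⟨fun h j i => h j j.2 i, fun h j hj i => h ⟨j, hj⟩ i⟩
  rw [this]
  have hp := measurable_pos hN hf ha
  exact MeasurableSet.iInter fun j => MeasurableSet.iInter fun i => measurableSet_le
    ((measurable_coord_comp (hp j i) 1).add ((hp _ i).dist (hp _ i)))
    ((measurable_moveLevel hN hf ha n).add_const _)

theorem measurable_iInf_ite {ι : Type*} [Countable ι] {A : ι → Set Ω}
    [∀ i ω, Decidable (ω ∈ A i)]
    (hA : ∀ i, MeasurableSet (A i)) {c : ι → Ω → ℕ∞} (hc : ∀ i, Measurable (c i)) :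
    Measurable fun ω => ⨅ i, if ω ∈ A i then c i ω else ⊤ := by
  have := borelSpace_enat
  exact Measurable.iInf fun i => Measurable.ite (hA i) (hc i) measurable_const

theorem measurable_toNat {τ : Ω → ℕ∞} (h : Measurable τ) : Measurable fun ω => (τ ω).toNat :=
  (measurable_from_top (f := ENat.toNat)).comp h

theorem measurable_goodStep (hN : CountMeas N) (hf : ∀ ω, LocFin (N ω)) (ha : MeasStart a)
    (hg : ∀ ω, (a ω).Good κ) (hκ : 1 ≤ κ) (j : ℕ) :
    Measurable fun ω => goodStep κ (N ω) (a ω) j := by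
  induction j with
  | zero => exact measurable_const
  | succ j ih =>
    classical
    set A : ℕ → Set Ω := fun n => {ω | 1 ≤ n ∧ goodStep κ (N ω) (a ω) j < ((k * n : ℕ) : ℕ∞) ∧
      height (hist (N ω) (a ω) (k * n)) ≤ κ ∧
      moveLevel (N ω) (a ω) (goodStep κ (N ω) (a ω) j).toNat + κ + 1 ≤
        moveLevel (N ω) (a ω) (k * n)} with hA
    have : (fun ω => goodStep κ (N ω) (a ω) (j + 1)) = fun ω => ⨅ n,
        if ω ∈ A n then ((k * n : ℕ) : ℕ∞) else ⊤ := by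
      ext1 ω
      refine le_antisymm (le_iInf fun n => ?_) (le_sInf ?_)
      · split_ifs with h
        · exact goodStep_succ_le h.1 h.2.1 h.2.2.1 h.2.2.2
        · exact le_top
      · rintro t ⟨n, h1, rfl, h3, h4, h5⟩
        refine (iInf_le _ n).trans ?_
        rw [if_pos ⟨h1, h3, h4, h5⟩]
    rw [this]
    refine measurable_iInf_ite (A := A) (fun n => ?_) fun n => measurable_const
    by_cases hn : 1 ≤ n
    · have hkn : 1 ≤ k * n := Nat.mul_pos (NeZero.pos k) hn
      refine (MeasurableSet.const _).inter (MeasurableSet.inter ?_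
        ((measurableSet_height hN hf ha hg hκ hkn).inter ?_))
      · exact ih (MeasurableSet.of_discrete (s := Iio ((k * n : ℕ) : ℕ∞)))
      · exact measurableSet_le (((measurable_nat_comp (measurable_moveLevel hN hf ha)
          (measurable_toNat ih)).add_const _).add_const _) (measurable_moveLevel hN hf ha _)
    · have : A n = ∅ := by
        ext ω; simp [hA, hn]
      rw [this]
      exact MeasurableSet.empty

theorem measurable_down (hN : CountMeas N) (hf : ∀ ω, LocFin (N ω)) (ha : MeasStart a) (n : ℕ)
    (i : Fin k) : Measurable fun ω => down (pos (N ω) (a ω) n) i :=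
  measurable_plane (measurable_coord_comp (measurable_pos hN hf ha n i) 0)
    (measurable_moveLevel hN hf ha n)

theorem measurable_up (hN : CountMeas N) (hf : ∀ ω, LocFin (N ω)) (ha : MeasStart a) (n : ℕ)
    (i : Fin k) : Measurable fun ω => up κ (pos (N ω) (a ω) n) i :=
  measurable_plane (measurable_coord_comp (measurable_pos hN hf ha n i) 0)
    ((measurable_moveLevel hN hf ha n).add_const _)

theorem measurableSet_renewalEvent (hN : CountMeas N) (hf : ∀ ω, LocFin (N ω)) (ha : MeasStart a)
    (hg : ∀ ω, (a ω).Good κ) (hκ : 1 ≤ κ) (j : ℕ) :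
    MeasurableSet {ω | RenewalEvent κ (N ω) (a ω) j} := by
  have hgs := measurable_goodStep hN hf ha hg hκ j
  set A : ℕ → Set Ω := fun n => {ω | ∀ i, ((semiBall (down (pos (N ω) (a ω) n) i) (κ + 1) \
    hist (N ω) (a ω) n) ∩ N ω).encard = 1 ∧
      (semiBall (up κ (pos (N ω) (a ω) n) i) 1 ∩ N ω).encard = 1} with hA
  have hAm : ∀ n, MeasurableSet (A n) := by
    intro n
    have h1 : ∀ i, Measurable fun ω => ((semiBall (down (pos (N ω) (a ω) n) i) (κ + 1) \
        hist (N ω) (a ω) n) ∩ N ω).encard := by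
      intro i
      simp only [inter_comm _ (N _)]
      exact hN _ ((graphMeas_semiBall (measurable_down hN hf ha n i) measurable_const).diff
        (measurable_explore hN hf ha n).2)
    have h2 : ∀ i, Measurable fun ω => (semiBall (up κ (pos (N ω) (a ω) n) i) 1 ∩ N ω).encard := by
      intro i
      simp only [inter_comm _ (N _)]
      exact hN _ (graphMeas_semiBall (measurable_up hN hf ha n i) measurable_const)
    have : A n = ⋂ i, ({ω | ((semiBall (down (pos (N ω) (a ω) n) i) (κ + 1) \
        hist (N ω) (a ω) n) ∩ N ω).encard = 1} ∩
          {ω | (semiBall (up κ (pos (N ω) (a ω) n) i) 1 ∩ N ω).encard = 1}) := by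
      ext ω; simp [hA]
    rw [this]
    exact MeasurableSet.iInter fun i => (h1 i (measurableSet_singleton 1)).inter
      (h2 i (measurableSet_singleton 1))
  exact (hgs (measurableSet_singleton ⊤).compl).inter
    (measurableSet_nat_comp hAm (measurable_toNat hgs))

theorem measurable_firstRenewal (hN : CountMeas N) (hf : ∀ ω, LocFin (N ω)) (ha : MeasStart a)
    (hg : ∀ ω, (a ω).Good κ) (hκ : 1 ≤ κ) :
    Measurable fun ω => firstRenewal κ (N ω) (a ω) := by
  classical
  have hgs := measurable_goodStep hN hf ha hg hκ
  set A : ℕ → Set Ω := fun j => {ω | 0 < goodStep κ (N ω) (a ω) j ∧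
    RenewalEvent κ (N ω) (a ω) j} with hA
  have : (fun ω => firstRenewal κ (N ω) (a ω)) = fun ω => ⨅ j,
      if ω ∈ A j then goodStep κ (N ω) (a ω) j else ⊤ := by
    ext1 ω
    refine le_antisymm (le_iInf fun j => ?_) (le_sInf ?_)
    · split_ifs with h
      · exact csInf_le (OrderBot.bddBelow _) ⟨h.1, j, rfl, h.2⟩
      · exact le_top
    · rintro t ⟨h1, j, rfl, h2⟩
      refine (iInf_le _ j).trans ?_
      rw [if_pos ⟨h1, h2⟩]
  rw [this]
  exact measurable_iInf_ite (A := A) (fun j => (hgs j (MeasurableSet.of_discrete (s := Ioi 0))).inter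
    (measurableSet_renewalEvent hN hf ha hg hκ j)) hgs

theorem measStart_regenerate (hN : CountMeas N) (hf : ∀ ω, LocFin (N ω)) (ha : MeasStart a)
    (hg : ∀ ω, (a ω).Good κ) (hκ : 1 ≤ κ) :
    MeasStart fun ω => regenerate κ (N ω) (a ω) := by
  have hb := measurable_toNat (measurable_firstRenewal hN hf ha hg hκ)
  refine ⟨fun i => measurable_nat_comp (fun n => measurable_up hN hf ha n i) hb, ?_, ?_,
    fun ω => (hf ω).mono inter_subset_left⟩
  · refine graphMeas_nat_comp (H := fun n ω => (⋃ i, semiBall (down (pos (N ω) (a ω) n) i) (κ + 1)) ∩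
      upperHalf (moveLevel (N ω) (a ω) n + κ)) (fun n => ?_) hb
    exact (GraphMeas.iUnion fun i => graphMeas_semiBall (measurable_down hN hf ha n i)
      measurable_const).inter
        (graphMeas_upperHalf ((measurable_moveLevel hN hf ha n).add_const _))
  · refine hN.inter (graphMeas_nat_comp (H := fun n ω => ⋃ i,
      semiBall (up κ (pos (N ω) (a ω) n) i) 1) (fun n => ?_) hb)
    exact GraphMeas.iUnion fun i => graphMeas_semiBall (measurable_up hN hf ha n i)
      measurable_const

theorem measStart_regenStart (hN : CountMeas N) (hf : ∀ ω, LocFin (N ω)) (ha : MeasStart a)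
    (hg : ∀ ω, (a ω).Good κ) (hκ : 1 ≤ κ) (l : ℕ) :
    MeasStart fun ω => regenStart κ (N ω) (a ω) l := by
  induction l with
  | zero => exact ha
  | succ l ih =>
    exact measStart_regenerate hN hf ih (fun ω => regenStart_good (hg ω) _ l) hκ

theorem measurable_renewalGap (hN : CountMeas N) (hf : ∀ ω, LocFin (N ω)) (ha : MeasStart a)
    (hg : ∀ ω, (a ω).Good κ) (hκ : 1 ≤ κ) (l : ℕ) :
    Measurable fun ω => renewalGap κ (N ω) (a ω) l :=
  measurable_firstRenewal hN hf (measStart_regenStart hN hf ha hg hκ (l - 1))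
    (fun ω => regenStart_good (hg ω) _ _) hκ

theorem blockSigma_le (hN : CountMeas N) (hf : ∀ ω, LocFin (N ω)) (ha : MeasStart a)
    (hg : ∀ ω, (a ω).Good κ) (hκ : 1 ≤ κ) :
    blockSigma κ N a ≤ (inferInstance : MeasurableSpace Ω) := by
  have hb := measurable_firstRenewal hN hf ha hg hκ
  have hgs := measurable_goodStep hN hf ha hg hκ
  have hmin : ∀ f g : Ω → ℕ∞, Measurable f → Measurable g → Measurable fun ω => min (f ω) (g ω) :=
    fun f g hf hg => (measurable_from_top (f := fun p : ℕ∞ × ℕ∞ => min p.1 p.2)).comp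
      ((hf.prodMk hg).mono le_rfl (by
        intro s _
        exact (Set.to_countable s).measurableSet))
  refine sup_le (sup_le (sup_le (sup_le ?_ ?_) ?_) ?_) ?_
  · refine iSup₂_le fun n i => Measurable.comap_le ?_
    exact measurable_nat_comp (f := fun n ω => pos (N ω) (a ω) n i)
      (fun n => measurable_pos hN hf ha n i)
      (measurable_toNat (hmin (fun _ => (n : ℕ∞)) _ measurable_const hb))
  · exact hb.comap_le
  · refine iSup₂_le fun B hB => Measurable.comap_le ?_
    have := ha.extra (Set.univ ×ˢ B) (MeasurableSet.univ.prod hB)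
    simpa using this
  · exact iSup_le fun j => Measurable.comap_le (hmin _ _ (hgs j) hb)
  · refine MeasurableSpace.generateFrom_le ?_
    rintro S ⟨j, -, rfl⟩
    have h1 : MeasurableSet {ω | goodStep κ (N ω) (a ω) j ≤ firstRenewal κ (N ω) (a ω)} := by
      have : Measurable fun ω => (goodStep κ (N ω) (a ω) j, firstRenewal κ (N ω) (a ω)) :=
        (hgs j).prodMk hb
      exact this (Set.to_countable {p : ℕ∞ × ℕ∞ | p.1 ≤ p.2}).measurableSet
    exact h1.inter (measurableSet_renewalEvent hN hf ha hg hκ j)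

theorem renewalSigma_le (hN : CountMeas N) (hf : ∀ ω, LocFin (N ω)) (ha : MeasStart a)
    (hg : ∀ ω, (a ω).Good κ) (hκ : 1 ≤ κ) (l : ℕ) :
    renewalSigma κ N a l ≤ (inferInstance : MeasurableSpace Ω) :=
  iSup₂_le fun m _ => blockSigma_le hN hf (measStart_regenStart hN hf ha hg hκ (m - 1))
    (fun ω => regenStart_good (hg ω) _ _) hκ

end Random

/-! ### Paths in a configuration in general position -/

/-- The starting points and the extra points. -/
def Start.special {k : ℕ} (a : Start k) : Set Plane := range a.pts ∪ a.extra

/-- A configuration in general position with respect to a starting configuration. -/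
structure Nice {k : ℕ} (N : Set Plane) (a : Start k) : Prop where
  locFin : LocFin N
  extra : a.extra.encard ≤ k
  ordinate : ∀ x ∈ N, ∀ y ∈ N, x ≠ y → y 1 ≠ x 1
  special : ∀ x ∈ N, ∀ y ∈ a.special, x 1 ≠ y 1
  above : ∀ t : ℝ, ∃ y ∈ N, t < y 1

/-- The point at height `t` above `x`. -/
def lift (x : Plane) (t : ℝ) : Plane := !₂[x 0, x 1 + t]

theorem lift_zero (x : Plane) (t : ℝ) : lift x t 0 = x 0 := by simp [lift]

theorem lift_one (x : Plane) (t : ℝ) : lift x t 1 = x 1 + t := by simp [lift]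

theorem dist_lift (x : Plane) {t : ℝ} (ht : 0 ≤ t) : dist (lift x t) x = t := by
  have h := dist_sq (lift x t) x
  rw [lift_zero, lift_one] at h
  have : dist (lift x t) x ^ 2 = t ^ 2 := by rw [h]; ring
  exact (sq_eq_sq₀ dist_nonneg ht).1 this

section Path

variable {k : ℕ} [NeZero k] {κ : ℕ} {N : Set Plane} {a : Start k}

theorem Start.Good.hist_strip (ha : a.Good κ) :
    ∀ x ∈ a.hist, level a.pts ≤ x 1 ∧ x 1 ≤ level a.pts + 1 :=
  fun x hx => ⟨ha.le_hist x hx, ha.hist_le x hx⟩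

theorem Nice.extra_finite (hN : Nice N a) : a.extra.Finite :=
  finite_of_encard_le_coe hN.extra

theorem Nice.extra_locFin (hN : Nice N a) : LocFin a.extra := locFin_of_finite hN.extra_finite

/-- A point of `N` above everything explored cannot belong to the history set. -/
theorem hasCand_of_above (hN : ∀ t : ℝ, ∃ y ∈ N, t < y 1) (hκ : 1 ≤ κ) (ha : a.Good κ) (n : ℕ) :
    HasCand N a n := by
  obtain ⟨y, hy, hl⟩ := hN (top N a κ n)
  refine ⟨y, Or.inl ⟨hy, fun h => ?_⟩, (moveLevel_le_top N a ha.pts_close n).trans_lt hl⟩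
  exact absurd (hist_le_top N a ha.pts_close hκ ha.hist_strip h) (not_le.2 hl)

theorem Nice.hasCand (hN : Nice N a) (hκ : 1 ≤ κ) (ha : a.Good κ) (n : ℕ) : HasCand N a n :=
  hasCand_of_above hN.above hκ ha n

theorem Nice.isAncestor (hN : Nice N a) (hκ : 1 ≤ κ) (ha : a.Good κ) {n : ℕ} {i : Fin k}
    (hi : IsMoving (pos N a n) i) : IsAncestor (cand N a n) (pos N a n i) (pos N a (n + 1) i) :=
  isAncestor_pos_succ N a hN.locFin hN.extra_locFin hi (hN.hasCand hκ ha n)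

theorem Nice.level_lt (hN : Nice N a) (hκ : 1 ≤ κ) (ha : a.Good κ) {n : ℕ} {i : Fin k}
    (hi : IsMoving (pos N a n) i) : moveLevel N a n < pos N a (n + 1) i 1 := by
  have := (hN.isAncestor hκ ha hi).2.1
  rwa [hi.moveLevel_eq] at this

theorem pos_mem (n : ℕ) (i : Fin k) : pos N a n i ∈ N ∪ a.special := by
  induction n generalizing i with
  | zero => exact Or.inr (Or.inl ⟨i, rfl⟩)
  | succ n ih =>
    by_cases hi : IsMoving (pos N a n) i
    · rw [pos_succ_of_moving N a hi]
      rcases ancestor_cases (cand N a n) (pos N a n i) with h | h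
      · rcases h.1 with h1 | h1 | h1
        · exact Or.inl h1.1
        · obtain ⟨j, -, hj⟩ := h1
          rw [← hj]
          exact ih j
        · exact Or.inr (Or.inr h1)
      · rw [h]
        exact ih i
    · rw [pos_succ_of_not N a hi]
      exact ih i

/-- The balls explored before step `n` do not contain the current non-special vertices in their
interior. -/
theorem Nice.stepLen_le_dist (hN : Nice N a) (hκ : 1 ≤ κ) (ha : a.Good κ) {n : ℕ} {i : Fin k}
    (hs : pos N a n i ∉ a.special) {j : ℕ} (hj : j < n) {i' : Fin k}
    (hi' : IsMoving (pos N a j) i') : stepLen N a j ≤ dist (pos N a j i') (pos N a n i) := by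
  induction n generalizing i with
  | zero => exact absurd hj (Nat.not_lt_zero j)
  | succ n ih =>
    by_cases hi : IsMoving (pos N a n) i
    · have hA := hN.isAncestor hκ ha hi
      have hlast : j = n → stepLen N a j ≤ dist (pos N a j i') (pos N a (n + 1) i) := by
        rintro rfl
        rw [stepLen_eq N a hi, dist_comm, hi.eq hi']
      rcases Nat.lt_succ_iff_lt_or_eq.1 hj with hlt | heq
      · rcases hA.1 with h1 | h1 | h1
        -- A Poisson point inside an earlier ball would belong to the history set and would not be a
        -- candidate.
        · by_contra! hd
          refine h1.2 ((mem_hist_iff N a ha.le_hist).2 ⟨Or.inr ⟨j, hlt, i', ?_, ?_⟩, ?_⟩)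
          · rw [stepLen_eq N a hi'] at hd
            rw [dist_comm]
            exact hd.le
          · rw [hi'.moveLevel_eq]
            exact (moveLevel_mono N a hlt.le).trans (hN.level_lt hκ ha hi).le
          · exact (hN.level_lt hκ ha hi).le
        · obtain ⟨i2, -, h2⟩ := h1
          rw [← h2] at hs ⊢
          exact ih hs hlt
        · exact absurd (Or.inr h1) hs
      · exact hlast heq
    · rw [pos_succ_of_not N a hi] at hs ⊢
      rcases Nat.lt_succ_iff_lt_or_eq.1 hj with hlt | rfl
      · exact ih hs hlt
      -- A vertex that stays is itself a candidate for the moving one as soon as it is strictly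
      -- higher, and general position rules out equal ordinates.
      · have hne : pos N a j i ≠ pos N a j i' := fun h => hi (isMoving_of_eq hi' h)
        have hx : pos N a j i ∈ N := (pos_mem j i).resolve_right hs
        have hlt : moveLevel N a j < pos N a j i 1 := by
          refine lt_of_le_of_ne (moveLevel_le_pos N a j i) ?_
          rw [← hi'.moveLevel_eq]
          rcases pos_mem (N := N) (a := a) j i' with h | h
          · exact hN.ordinate _ hx _ h hne
          · exact (hN.special _ hx _ h).symm
        exact stepLen_le N a hi' (Or.inr (Or.inl ⟨i, hi, rfl⟩)) hlt

/-- A vertex that is above the current level has not moved since. -/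
theorem pos_eq_of_lt {j n : ℕ} (hjn : j ≤ n) {i : Fin k} (h : moveLevel N a n < pos N a j i 1) :
    pos N a n i = pos N a j i := by
  induction n, hjn using Nat.le_induction with
  | base => rfl
  | succ n hjn ih =>
    have h' : moveLevel N a n < pos N a j i 1 := (moveLevel_mono N a (Nat.le_succ n)).trans_lt h
    rw [← ih h']
    refine pos_succ_of_not N a fun hi => ?_
    rw [← ih h', hi.moveLevel_eq] at h'
    exact absurd h' (lt_irrefl _)

/-- Points outside of the explored region are candidates. -/
theorem mem_cand (ha : a.Good κ) {n : ℕ} {y : Plane} (hy : y ∈ N) (hl : moveLevel N a n < y 1)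
    (h1 : y ∉ a.hist) (h2 : y ∉ explored N a n) : y ∈ cand N a n := by
  by_cases h : y ∈ hist N a n
  · rcases ((mem_hist_iff N a ha.le_hist).1 h).1 with h | ⟨j, hj, i, hd, -⟩
    · exact absurd h h1
    · by_cases hi : IsMoving (pos N a j) i
      · refine absurd ⟨j, hj, i, hi, ?_⟩ h2
        rwa [stepLen_eq N a hi]
      -- Vertices that stay contribute balls of radius `0` to the history set. A point removed in
      -- this way is still the position of a vertex above the level, and it comes back through
      -- `staySet`.
      · rw [pos_succ_of_not N a hi, dist_self] at hd
        have hy' : y = pos N a j i := dist_le_zero.1 hd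
        have he : pos N a n i = pos N a j i := pos_eq_of_lt hj.le (by rwa [← hy'])
        refine Or.inr (Or.inl ⟨i, fun hm => ?_, by rw [he, hy']⟩)
        have := hm.moveLevel_eq
        rw [he, ← hy'] at this
        linarith
  · exact Or.inl ⟨hy, h⟩

/-- The region about which nothing is known after `n` steps. -/
def Fresh (N : Set Plane) (a : Start k) (n : ℕ) (y : Plane) : Prop :=
  moveLevel N a n < y 1 ∧ y ∉ a.hist ∧ y ∉ explored N a n

theorem explored_le_top {n : ℕ} {y : Plane} (hy : y ∈ explored N a n) : y 1 ≤ top N a κ n := by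
  obtain ⟨j, hj, i, hi, hd⟩ := hy
  have h1 := ball_le_top N a κ hj
  have h2 := coord_sub_le_dist y (pos N a j i) 1
  rw [hi.moveLevel_eq] at h2
  linarith

theorem fresh_above_top (ha : a.Good κ) (hκ : 1 ≤ κ) {n : ℕ} {y : Plane}
    (hy : top N a κ n < y 1) : Fresh N a n y := by
  have hκ' : (1 : ℝ) ≤ κ := by exact_mod_cast hκ
  refine ⟨(moveLevel_le_top N a ha.pts_close n).trans_lt hy, fun h => ?_, fun h => ?_⟩
  · have h1 := ha.hist_le y h
    have h2 : level a.pts + κ ≤ top N a κ n := top_mono N a κ (Nat.zero_le n)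
    linarith
  · exact absurd (explored_le_top (κ := κ) h) (not_le.2 hy)

/-- There is a free ball above a non-special moving vertex. -/
theorem Nice.fresh_cusp (hN : Nice N a) (hκ : 1 ≤ κ) (ha : a.Good κ) {n : ℕ} {i : Fin k}
    (hi : IsMoving (pos N a n) i) (hs : pos N a n i ∉ a.special) {D : ℝ} (hD : 6 ≤ D)
    (hgap : top N a κ n - moveLevel N a n ≤ D) {y : Plane}
    (hy : dist y (lift (pos N a n i) (D / 2)) < D / 10) : Fresh N a n y := by
  set x := pos N a n i with hx
  have hx1 : x 1 = moveLevel N a n := hi.moveLevel_eq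
  have hy1 : x 1 + 2 / 5 * D < y 1 := by
    have := coord_sub_le_dist (lift x (D / 2)) y 1
    rw [lift_one, dist_comm] at this
    linarith
  refine ⟨by rw [← hx1]; linarith, fun h => ?_, ?_⟩
  · have h1 := ha.hist_le y h
    have h2 : level a.pts ≤ moveLevel N a n := moveLevel_mono N a (Nat.zero_le n)
    linarith
  · rintro ⟨j, hj, i', hi', hd⟩
    have h1 := hN.stepLen_le_dist hκ ha hs hj hi'
    have h2 := ball_le_top N a κ hj
    have h3 : moveLevel N a j ≤ moveLevel N a n := moveLevel_mono N a hj.le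
    set c := pos N a j i' with hc
    have hc1 : c 1 = moveLevel N a j := hi'.moveLevel_eq
    have hR := stepLen_nonneg N a j
    set R := stepLen N a j with hRdef
    -- With `s = x 1 - c 1 ≥ 0`, the squared distance is `|c - x|² + D s + D² / 4 ≥ R² + D s + D² /
    -- 4`. On the other hand, `R ≤ D + s` gives `(R + D / 10)² ≤ R² + D s / 5 + 21 D² / 100`.
    have h4 : R + D / 10 ≤ dist c (lift x (D / 2)) := by
      rw [le_dist_iff (by linarith), lift_zero, lift_one]
      have h5 : R ^ 2 ≤ (c 0 - x 0) ^ 2 + (c 1 - x 1) ^ 2 := (le_dist_iff hR).1 h1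
      have h6 : R ≤ D + (x 1 - c 1) := by linarith
      nlinarith
    have h7 := dist_triangle c y (lift x (D / 2))
    rw [dist_comm c y] at h7
    linarith

/-- A point in the fresh region bounds the length of the step. -/
theorem stepLen_le_of_fresh (ha : a.Good κ) {n : ℕ} {i : Fin k} (hi : IsMoving (pos N a n) i)
    {y : Plane} (hy : y ∈ N) (hf : Fresh N a n y) : stepLen N a n ≤ dist (pos N a n i) y :=
  stepLen_le N a hi (mem_cand ha hy hf.1 hf.2.1 hf.2.2) hf.1

/-! ### Special steps -/

/-- The moving vertex is a starting point or an extra point. -/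
def SpecialSource (N : Set Plane) (a : Start k) (n : ℕ) : Prop :=
  ∃ i, IsMoving (pos N a n) i ∧ pos N a n i ∈ a.special

/-- A step starting from a special vertex, or leading to an extra point or to another vertex. -/
def SpecialStep (N : Set Plane) (a : Start k) (n : ℕ) : Prop :=
  SpecialSource N a n ∨
    ∃ i, IsMoving (pos N a n) i ∧ pos N a (n + 1) i ∈ staySet (pos N a n) ∪ a.extra

open Classical in
/-- The number of special steps among the first `n` ones. -/
def specialCount (N : Set Plane) (a : Start k) (n : ℕ) : ℕ :=
  ∑ j ∈ Finset.range n, if SpecialStep N a j then 1 else 0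

open Classical in
theorem specialCount_succ (n : ℕ) : specialCount N a (n + 1) =
    specialCount N a n + if SpecialStep N a n then 1 else 0 := Finset.sum_range_succ _ _

/-- The special points that can still be used. -/
def aliveExtra (N : Set Plane) (a : Start k) (n : ℕ) : Set Plane :=
  {x | x ∈ a.extra ∧ moveLevel N a n < x 1}

open Classical in
-- Two cardinalities never increase: that of the vertices together with the extra points still above
-- the level, and that of the special ones among them. A step onto another vertex or an extra point
-- lowers the first, and a step away from a special point lowers the second.
theorem Nice.count_step (hN : Nice N a) (hκ : 1 ≤ κ) (ha : a.Good κ) (n : ℕ) :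
    (if SpecialStep N a n then 1 else 0) +
      ((range (pos N a (n + 1)) ∪ aliveExtra N a (n + 1)).ncard +
        ((range (pos N a (n + 1)) ∩ a.special) ∪ aliveExtra N a (n + 1)).ncard) ≤
      (range (pos N a n) ∪ aliveExtra N a n).ncard +
        ((range (pos N a n) ∩ a.special) ∪ aliveExtra N a n).ncard := by
  obtain ⟨i, hi⟩ := exists_isMoving (pos N a n)
  set p := pos N a n i with hp
  set q := pos N a (n + 1) i with hq
  have hp1 : p 1 = moveLevel N a n := hi.moveLevel_eq
  have hq1 : moveLevel N a n < q 1 := hN.level_lt hκ ha hi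
  have hqp : q ≠ p := fun h => by rw [h, hp1] at hq1; exact absurd hq1 (lt_irrefl _)
  have hXfin : (aliveExtra N a n).Finite := hN.extra_finite.subset fun x hx => hx.1
  have hAfin : (range (pos N a n) ∪ aliveExtra N a n).Finite := (finite_range _).union hXfin
  have hBfin : ((range (pos N a n) ∩ a.special) ∪ aliveExtra N a n).Finite :=
    ((finite_range _).inter_of_left _).union hXfin
  have hX : aliveExtra N a (n + 1) ⊆ aliveExtra N a n \ {p} := by
    intro x hx
    have h1 : moveLevel N a n < x 1 := (moveLevel_mono N a (Nat.le_succ n)).trans_lt hx.2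
    refine ⟨⟨hx.1, h1⟩, fun h => ?_⟩
    rw [mem_singleton_iff.1 h, hp1] at h1
    exact absurd h1 (lt_irrefl _)
  have hpos : ∀ i', pos N a (n + 1) i' = q ∨
      (pos N a (n + 1) i' = pos N a n i' ∧ pos N a n i' ≠ p) := by
    intro i'
    by_cases h : IsMoving (pos N a n) i'
    · left
      rw [hq, pos_succ_of_moving N a h, pos_succ_of_moving N a hi, h.eq hi]
    · exact Or.inr ⟨pos_succ_of_not N a h, fun h' => h (isMoving_of_eq hi h')⟩
  have hpA : p ∈ range (pos N a n) ∪ aliveExtra N a n := Or.inl ⟨i, rfl⟩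
  have hqA : q ∈ staySet (pos N a n) ∪ a.extra →
      q ∈ range (pos N a n) ∪ aliveExtra N a n := by
    rintro (h | h)
    · exact Or.inl (staySet_subset _ h)
    · exact Or.inr ⟨h, hq1⟩
  have hA : range (pos N a (n + 1)) ∪ aliveExtra N a (n + 1) ⊆
      insert q ((range (pos N a n) ∪ aliveExtra N a n) \ {p}) := by
    rintro x (⟨i', rfl⟩ | hx)
    · rcases hpos i' with h | ⟨h, h'⟩
      · exact Or.inl h
      · rw [h]
        exact Or.inr ⟨Or.inl ⟨i', rfl⟩, h'⟩
    · exact Or.inr ⟨Or.inr (hX hx).1, (hX hx).2⟩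
  have hcA : ((range (pos N a n) ∪ aliveExtra N a n) \ {p}).ncard + 1 =
      (range (pos N a n) ∪ aliveExtra N a n).ncard := ncard_sdiff_singleton_add_one hpA hAfin
  have hA1 : (range (pos N a (n + 1)) ∪ aliveExtra N a (n + 1)).ncard ≤
      (range (pos N a n) ∪ aliveExtra N a n).ncard := by
    refine (ncard_le_ncard hA (hAfin.sdiff.insert q)).trans ((ncard_insert_le _ _).trans hcA.le)
  have hA2 : q ∈ staySet (pos N a n) ∪ a.extra →
      (range (pos N a (n + 1)) ∪ aliveExtra N a (n + 1)).ncard + 1 ≤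
        (range (pos N a n) ∪ aliveExtra N a n).ncard := by
    intro h
    rw [insert_eq_of_mem (show q ∈ (range (pos N a n) ∪ aliveExtra N a n) \ {p} from
      ⟨hqA h, hqp⟩)] at hA
    rw [← hcA]
    exact Nat.succ_le_succ (ncard_le_ncard hA hAfin.sdiff)
  -- If the new position is special, general position prevents it from being a Poisson point, so it
  -- was already counted as a vertex or as an extra point.
  have hB : (range (pos N a (n + 1)) ∩ a.special) ∪ aliveExtra N a (n + 1) ⊆
      ((range (pos N a n) ∩ a.special) ∪ aliveExtra N a n) \ {p} := by
    rintro x (⟨⟨i', rfl⟩, hx⟩ | hx)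
    · rcases hpos i' with h | ⟨h, h'⟩
      · rw [h] at hx ⊢
        refine ⟨?_, hqp⟩
        rcases (hN.isAncestor hκ ha hi).1 with h1 | h1 | h1
        · exact absurd rfl (hN.special q h1.1 q hx)
        · exact Or.inl ⟨staySet_subset _ h1, hx⟩
        · exact Or.inr ⟨h1, hq1⟩
      · rw [h] at hx ⊢
        exact ⟨Or.inl ⟨⟨i', rfl⟩, hx⟩, h'⟩
    · exact ⟨Or.inr (hX hx).1, (hX hx).2⟩
  have hB1 : ((range (pos N a (n + 1)) ∩ a.special) ∪ aliveExtra N a (n + 1)).ncard ≤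
      ((range (pos N a n) ∩ a.special) ∪ aliveExtra N a n).ncard :=
    ncard_le_ncard (hB.trans sdiff_subset) hBfin
  have hB2 : p ∈ a.special →
      ((range (pos N a (n + 1)) ∩ a.special) ∪ aliveExtra N a (n + 1)).ncard + 1 ≤
        ((range (pos N a n) ∩ a.special) ∪ aliveExtra N a n).ncard := by
    intro h
    rw [← ncard_sdiff_singleton_add_one (show p ∈ (range (pos N a n) ∩ a.special) ∪
      aliveExtra N a n from Or.inl ⟨⟨i, rfl⟩, h⟩) hBfin]
    exact Nat.succ_le_succ (ncard_le_ncard hB hBfin.sdiff)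
  split_ifs with h
  · rcases h with ⟨i', hi', h⟩ | ⟨i', hi', h⟩
    · rw [hi'.eq hi] at h
      have := hB2 h
      omega
    · have h' : pos N a (n + 1) i' = q := by
        rw [hq, pos_succ_of_moving N a hi', pos_succ_of_moving N a hi, hi'.eq hi]
      rw [h'] at h
      have := hA2 h
      omega
  · omega

/-- Each of the two cardinalities in `Nice.count_step` is initially at most `2 * k`: at most `k`
vertices and at most `k` extra points. -/
theorem Nice.specialCount_le (hN : Nice N a) (hκ : 1 ≤ κ) (ha : a.Good κ) (n : ℕ) :
    specialCount N a n ≤ 4 * k := by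
  have hind : specialCount N a n + ((range (pos N a n) ∪ aliveExtra N a n).ncard +
      ((range (pos N a n) ∩ a.special) ∪ aliveExtra N a n).ncard) ≤
      (range (pos N a 0) ∪ aliveExtra N a 0).ncard +
        ((range (pos N a 0) ∩ a.special) ∪ aliveExtra N a 0).ncard := by
    induction n with
    | zero => simp [specialCount]
    | succ n ih =>
      have := hN.count_step hκ ha n
      rw [specialCount_succ]
      omega
  have hr : (range (pos N a 0)).ncard ≤ k := by
    have := ncard_image_le (f := pos N a 0) (s := univ) finite_univ
    rwa [image_univ, ncard_univ, Nat.card_eq_fintype_card, Fintype.card_fin] at this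
  have hX : (aliveExtra N a 0).ncard ≤ k := by
    refine (ncard_le_ncard (fun x hx => hx.1) hN.extra_finite).trans ?_
    have := hN.extra
    rw [← hN.extra_finite.cast_ncard_eq] at this
    exact_mod_cast this
  have h1 := ncard_union_le (range (pos N a 0)) (aliveExtra N a 0)
  have h2 := ncard_union_le (range (pos N a 0) ∩ a.special) (aliveExtra N a 0)
  have h3 := ncard_le_ncard (inter_subset_left (s := range (pos N a 0)) (t := a.special))
    (finite_range _)
  omega

end Path

/-! ### The energy of the exploration process -/

section Energy

variable {k : ℕ} (N : Set Plane) (a : Start k) (κ : ℕ)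

/-- The height of the explored region above the current level. -/
def gap (n : ℕ) : ℝ := top N a κ n - moveLevel N a n

/-- The gap, or `6` if it is smaller. -/
def wideGap (n : ℕ) : ℝ := max (gap N a κ n) 6

/-- The sum of the distances of the vertices to the top of the explored region. -/
def excess (n : ℕ) : ℝ := ∑ i, (top N a κ n - pos N a n i 1)

/-- The sum of the vertical moves of the vertices. -/
def rise (n : ℕ) : ℝ := ∑ i, (pos N a (n + 1) i 1 - pos N a n i 1)

/-- The weight given to the number of special steps that may still occur. -/
def weight (n : ℕ) : ℝ := (4 * k : ℝ) ^ (4 * k - specialCount N a n)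

/-- The weighted excess. -/
def energy (n : ℕ) : ℝ := weight N a n * excess N a κ n

/-- A step that lowers the energy. -/
def Success (ε : ℝ) (n : ℕ) : Prop :=
  (SpecialSource N a n ∧ stepLen N a n ≤ 2 * wideGap N a κ n) ∨
    (¬ SpecialSource N a n ∧ stepLen N a n ≤ 3 / 5 * wideGap N a κ n ∧
      (SpecialStep N a n ∨ ε / wideGap N a κ n ≤ rise N a n))

variable {N a κ} [NeZero k]

theorem one_le_card : (1 : ℝ) ≤ k := by
  exact_mod_cast Nat.one_le_iff_ne_zero.2 (NeZero.ne k)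

theorem gap_nonneg (ha : a.Good κ) (n : ℕ) : 0 ≤ gap N a κ n :=
  sub_nonneg.2 (moveLevel_le_top N a ha.pts_close n)

theorem six_le_wideGap (n : ℕ) : 6 ≤ wideGap N a κ n := le_max_right _ _

theorem gap_le_wideGap (n : ℕ) : gap N a κ n ≤ wideGap N a κ n := le_max_left _ _

theorem rise_nonneg (n : ℕ) : 0 ≤ rise N a n :=
  Finset.sum_nonneg fun i _ => sub_nonneg.2 (pos_le_succ N a n i)

theorem gap_le_excess (ha : a.Good κ) (n : ℕ) : gap N a κ n ≤ excess N a κ n := by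
  obtain ⟨i, hi⟩ := exists_isMoving (pos N a n)
  unfold gap excess
  rw [← hi.moveLevel_eq]
  exact Finset.single_le_sum (f := fun i => top N a κ n - pos N a n i 1)
    (fun j _ => sub_nonneg.2 (pos_le_top N a ha.pts_close n j)) (Finset.mem_univ i)

theorem excess_le (n : ℕ) : excess N a κ n ≤ k * gap N a κ n := by
  unfold gap excess
  calc _ ≤ ∑ _i : Fin k, (top N a κ n - moveLevel N a n) :=
        Finset.sum_le_sum fun i _ => by linarith [moveLevel_le_pos N a n i]
    _ = _ := by
        rw [Finset.sum_const, Finset.card_univ, Fintype.card_fin, nsmul_eq_mul]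

theorem excess_nonneg (ha : a.Good κ) (n : ℕ) : 0 ≤ excess N a κ n :=
  (gap_nonneg ha n).trans (gap_le_excess ha n)

theorem gap_succ_le (n : ℕ) :
    gap N a κ (n + 1) ≤ max (gap N a κ n) (stepLen N a n) := by
  have := moveLevel_mono N a (Nat.le_succ n)
  unfold gap
  rw [top_succ]
  rcases max_cases (top N a κ n) (moveLevel N a n + stepLen N a n) with h | h <;> rw [h.1]
  · exact le_max_of_le_left (by linarith)
  · exact le_max_of_le_right (by linarith)

theorem excess_succ_of_le {n : ℕ} (h : stepLen N a n ≤ gap N a κ n) :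
    excess N a κ (n + 1) = excess N a κ n - rise N a n := by
  have : top N a κ (n + 1) = top N a κ n := by
    rw [top_succ, max_eq_left]
    unfold gap at h
    linarith
  unfold excess rise
  rw [this, ← Finset.sum_sub_distrib]
  exact Finset.sum_congr rfl fun i _ => by ring

theorem excess_succ_of_lt {n : ℕ} (h : gap N a κ n < stepLen N a n) :
    excess N a κ (n + 1) ≤ k * stepLen N a n := by
  refine (excess_le _).trans (mul_le_mul_of_nonneg_left ?_ (Nat.cast_nonneg k))
  unfold gap at h ⊢
  have := moveLevel_mono N a (Nat.le_succ n)
  rw [top_succ, max_eq_right (by linarith)]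
  linarith

theorem excess_succ_le (n : ℕ) :
    excess N a κ (n + 1) ≤ max (excess N a κ n) (k * stepLen N a n) := by
  rcases le_or_gt (stepLen N a n) (gap N a κ n) with h | h
  · refine le_max_of_le_left ?_
    rw [excess_succ_of_le h]
    linarith [rise_nonneg (N := N) (a := a) n]
  · exact le_max_of_le_right (excess_succ_of_lt h)

theorem one_le_weight (n : ℕ) : 1 ≤ weight N a n :=
  one_le_pow₀ (by linarith [one_le_card (k := k)])

theorem weight_le (n : ℕ) : weight N a n ≤ (4 * k : ℝ) ^ (4 * k) :=
  pow_le_pow_right₀ (by linarith [one_le_card (k := k)]) (Nat.sub_le _ _)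

theorem weight_succ_le (n : ℕ) : weight N a (n + 1) ≤ weight N a n := by
  refine pow_le_pow_right₀ (by linarith [one_le_card (k := k)]) (Nat.sub_le_sub_left ?_ _)
  rw [specialCount_succ]
  exact Nat.le_add_right _ _

/-- The exponent drops by exactly one: the truncated subtraction is harmless because the count, this
step included, is at most `4 * k`. -/
theorem Nice.weight_succ (hN : Nice N a) (hκ : 1 ≤ κ) (ha : a.Good κ) {n : ℕ}
    (h : SpecialStep N a n) : 4 * k * weight N a (n + 1) = weight N a n := by
  have h1 := hN.specialCount_le hκ ha (n + 1)
  have h2 := specialCount_succ (N := N) (a := a) n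
  rw [if_pos h] at h2
  unfold weight
  rw [← pow_succ']
  congr 1
  omega

theorem energy_nonneg (ha : a.Good κ) (n : ℕ) : 0 ≤ energy N a κ n :=
  mul_nonneg (zero_le_one.trans (one_le_weight n)) (excess_nonneg ha n)

theorem excess_le_energy (ha : a.Good κ) (n : ℕ) : excess N a κ n ≤ energy N a κ n :=
  le_mul_of_one_le_left (excess_nonneg ha n) (one_le_weight n)

theorem gap_le_energy (ha : a.Good κ) (n : ℕ) : gap N a κ n ≤ energy N a κ n :=
  (gap_le_excess ha n).trans (excess_le_energy ha n)

theorem energy_le (ha : a.Good κ) (n : ℕ) :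
    energy N a κ n ≤ (4 * k : ℝ) ^ (4 * k) * (k * gap N a κ n) :=
  mul_le_mul (weight_le n) (excess_le n) (excess_nonneg ha n) (by positivity)

theorem energy_succ_le (ha : a.Good κ) (n : ℕ) : energy N a κ (n + 1) ≤
    max (energy N a κ n) ((4 * k : ℝ) ^ (4 * k) * (k * stepLen N a n)) := by
  have hR := stepLen_nonneg N a n
  rcases le_max_iff.1 (excess_succ_le (N := N) (a := a) (κ := κ) n) with h | h
  · exact le_max_of_le_left (mul_le_mul (weight_succ_le n) h (excess_nonneg ha _)
      (zero_le_one.trans (one_le_weight n)))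
  · exact le_max_of_le_right (mul_le_mul (weight_le _) h (excess_nonneg ha _) (by positivity))

theorem energy_succ_le_of_le (ha : a.Good κ) {n : ℕ} (h : stepLen N a n ≤ gap N a κ n) :
    energy N a κ (n + 1) ≤ energy N a κ n := by
  refine mul_le_mul (weight_succ_le n) ?_ (excess_nonneg ha _)
    (zero_le_one.trans (one_le_weight n))
  rw [excess_succ_of_le h]
  linarith [rise_nonneg (N := N) (a := a) n]

/-- Below the threshold `6` no decrease is needed, only a constant bound; `12 = 2 * 6` is the
longest step that a success allows there. -/
theorem energy_succ_le_of_gap_le (ha : a.Good κ) {n : ℕ} (h : gap N a κ n ≤ 6)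
    (h' : stepLen N a n ≤ 12) :
    energy N a κ (n + 1) ≤ (4 * k : ℝ) ^ (4 * k) * (k * 12) := by
  refine (energy_succ_le ha n).trans (max_le ((energy_le ha n).trans ?_) ?_) <;> gcongr
  linarith

/-- At a special step the excess grows by a factor at most `2 * k` while the weight is divided by `4
* k`, so the energy is at least halved. Otherwise the excess `x` loses a rise of at least `ε / D`,
and `x ≥ D` makes `x ^ 2` lose at least `rise * x ≥ ε`. The square appears because the guaranteed
rise is only of order `1 / D`. -/
theorem Nice.energy_sq_succ (hN : Nice N a) (hκ : 1 ≤ κ) (ha : a.Good κ) {ε : ℝ} (h0 : 0 < ε)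
    (h1 : ε ≤ 1) {n : ℕ} (hg : 6 ≤ gap N a κ n) (hs : Success N a κ ε n) :
    energy N a κ (n + 1) ^ 2 ≤ energy N a κ n ^ 2 - ε := by
  have hk := one_le_card (k := k)
  have hw : wideGap N a κ n = gap N a κ n := max_eq_left hg
  have hE := gap_le_energy (N := N) ha n
  have hE' := energy_nonneg (N := N) ha (n + 1)
  have hx := gap_le_excess (N := N) ha n
  have hx' := excess_nonneg (N := N) ha (n + 1)
  have hW := one_le_weight (N := N) (a := a) n
  have hW' := one_le_weight (N := N) (a := a) (n + 1)
  have half : energy N a κ (n + 1) ≤ energy N a κ n / 2 →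
      energy N a κ (n + 1) ^ 2 ≤ energy N a κ n ^ 2 - ε := by
    intro h
    nlinarith
  have hsp : SpecialStep N a n → excess N a κ (n + 1) ≤ 2 * k * excess N a κ n →
      energy N a κ (n + 1) ^ 2 ≤ energy N a κ n ^ 2 - ε := by
    intro h h'
    refine half ?_
    unfold energy
    rw [← hN.weight_succ hκ ha h]
    have := mul_le_mul_of_nonneg_left h' (zero_le_one.trans hW')
    linarith
  rcases hs with ⟨hs, hR⟩ | ⟨-, hR, hs⟩
  · refine hsp (Or.inl hs) ((excess_succ_le n).trans (max_le ?_ ?_))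
    · nlinarith
    · rw [hw] at hR
      nlinarith
  · have hR' : stepLen N a n ≤ gap N a κ n := by linarith
    have hex := excess_succ_of_le hR'
    have hr := rise_nonneg (N := N) (a := a) n
    rcases hs with hs | hs
    · refine hsp hs ?_
      nlinarith
    · rw [hw] at hs
      rw [hex] at hx'
      set D := gap N a κ n
      set x := excess N a κ n
      have hr2 : ε ≤ rise N a n * D := by rwa [div_le_iff₀ (by linarith)] at hs
      have h2 : excess N a κ (n + 1) ^ 2 ≤ x ^ 2 - ε := by
        rw [hex]
        nlinarith [mul_nonneg hr (sub_nonneg.2 hx), mul_nonneg hr hx']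
      have h3 : energy N a κ (n + 1) ≤ weight N a n * excess N a κ (n + 1) :=
        mul_le_mul_of_nonneg_right (weight_succ_le n) (by rw [hex]; exact hx')
      have h4 : energy N a κ n = weight N a n * x := rfl
      rw [h4]
      calc energy N a κ (n + 1) ^ 2 ≤ (weight N a n * excess N a κ (n + 1)) ^ 2 := by gcongr
        _ = weight N a n ^ 2 * excess N a κ (n + 1) ^ 2 := by ring
        _ ≤ weight N a n ^ 2 * (x ^ 2 - ε) := by gcongr
        _ ≤ (weight N a n * x) ^ 2 - ε := by nlinarith [one_le_pow₀ hW (n := 2)]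

/-- A success does not lead out of a large level set of the energy. -/
theorem Nice.energy_success_le (hN : Nice N a) (hκ : 1 ≤ κ) (ha : a.Good κ) {ε : ℝ} (h0 : 0 < ε)
    (h1 : ε ≤ 1) {n : ℕ} (hs : Success N a κ ε n) {e : ℝ}
    (he : (4 * k : ℝ) ^ (4 * k) * (k * 12) ≤ e) (hn : energy N a κ n ≤ e) :
    energy N a κ (n + 1) ≤ e := by
  rcases le_or_gt 6 (gap N a κ n) with hg | hg
  · have := hN.energy_sq_succ hκ ha h0 h1 hg hs
    have h2 : energy N a κ (n + 1) ≤ energy N a κ n :=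
      (sq_le_sq₀ (energy_nonneg ha _) (energy_nonneg ha _)).1 (by linarith)
    exact h2.trans hn
  · refine (energy_succ_le_of_gap_le ha hg.le ?_).trans he
    have hw : wideGap N a κ n = 6 := max_eq_right hg.le
    rcases hs with ⟨-, h⟩ | ⟨-, h, -⟩ <;> rw [hw] at h <;> linarith

/-! ### Regions that decide about a step -/

/-- A point of the disc is at distance less than `1 / 2 + 1 / 10 = 3 / 5` of the wide gap from the
vertex. -/
theorem Nice.stepLen_le_of_cusp (hN : Nice N a) (hκ : 1 ≤ κ) (ha : a.Good κ) {n : ℕ} {i : Fin k}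
    (hi : IsMoving (pos N a n) i) (hs : ¬ SpecialSource N a n) {y : Plane}
    (hy : dist y (lift (pos N a n i) (wideGap N a κ n / 2)) < wideGap N a κ n / 10) :
    Fresh N a n y ∧ (y ∈ N → stepLen N a n ≤ 3 / 5 * wideGap N a κ n) := by
  have h6 := six_le_wideGap (N := N) (a := a) (κ := κ) n
  have hf : Fresh N a n y := hN.fresh_cusp hκ ha hi (fun h => hs ⟨i, hi, h⟩) h6
    (gap_le_wideGap n) hy
  refine ⟨hf, fun hyN => ?_⟩
  have h1 := stepLen_le_of_fresh ha hi hyN hf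
  have h2 := dist_triangle_left (pos N a n i) y (lift (pos N a n i) (wideGap N a κ n / 2))
  rw [dist_lift _ (by linarith)] at h2
  rw [dist_comm] at hy
  linarith

/-- The disc lies above the top of the explored region, so it is fresh whether or not the moving
vertex is special, and all its points are within `r` of the vertex. -/
theorem stepLen_le_of_high (hκ : 1 ≤ κ) (ha : a.Good κ) {n : ℕ} {i : Fin k}
    (hi : IsMoving (pos N a n) i) {r : ℝ} (hr : 2 * wideGap N a κ n ≤ r) {y : Plane}
    (hy : dist y (lift (pos N a n i) (wideGap N a κ n + (r - wideGap N a κ n) / 2)) <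
      (r - wideGap N a κ n) / 2) :
    Fresh N a n y ∧ (y ∈ N → stepLen N a n ≤ r) := by
  have h6 := six_le_wideGap (N := N) (a := a) (κ := κ) n
  have hg := gap_le_wideGap (N := N) (a := a) (κ := κ) n
  set D := wideGap N a κ n
  have hf : Fresh N a n y := by
    refine fresh_above_top (κ := κ) ha hκ ?_
    have := coord_sub_le_dist (lift (pos N a n i) (D + (r - D) / 2)) y 1
    rw [lift_one, hi.moveLevel_eq, dist_comm] at this
    unfold gap at hg
    linarith
  refine ⟨hf, fun hyN => ?_⟩
  have h1 := stepLen_le_of_fresh ha hi hyN hf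
  have h2 := dist_triangle_left (pos N a n i) y (lift (pos N a n i) (D + (r - D) / 2))
  rw [dist_lift _ (by linarith)] at h2
  rw [dist_comm] at hy
  linarith

/-- A step that is not special ends at a fresh Poisson point, displaced horizontally by at most the
length of the step. If there is no such point in the thin box over the vertex, the rise is at least
`ε / wideGap`. -/
theorem Nice.success_of_box (hN : Nice N a) (hκ : 1 ≤ κ) (ha : a.Good κ) {ε : ℝ}
    {n : ℕ} {i : Fin k} (hi : IsMoving (pos N a n) i) (hs : ¬ SpecialSource N a n)
    (hR : stepLen N a n ≤ 3 / 5 * wideGap N a κ n)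
    (hbox : ∀ y ∈ N, Fresh N a n y → |y 0 - pos N a n i 0| ≤ 3 / 5 * wideGap N a κ n →
      pos N a n i 1 + ε / wideGap N a κ n ≤ y 1) : Success N a κ ε n := by
  refine Or.inr ⟨hs, hR, ?_⟩
  by_cases hsp : SpecialStep N a n
  · exact Or.inl hsp
  refine Or.inr ?_
  have hA := hN.isAncestor hκ ha hi
  have hlt := hN.level_lt hκ ha hi
  rcases hA.1 with h | h | h
  · have hf : Fresh N a n (pos N a (n + 1) i) := by
      refine ⟨hlt, fun h' => h.2 ?_, fun h' => h.2 ?_⟩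
      · exact mem_hist_of_start ha.le_hist h' hlt.le
      · obtain ⟨j, hj, i', hi', hd⟩ := h'
        refine (mem_hist_iff N a ha.le_hist).2 ⟨Or.inr ⟨j, hj, i', ?_, ?_⟩, hlt.le⟩
        · rwa [← stepLen_eq N a hi']
        · rw [hi'.moveLevel_eq]
          exact (moveLevel_mono N a hj.le).trans hlt.le
    have h1 := hbox _ h.1 hf (by
      rw [stepLen_eq N a hi] at hR
      refine le_trans (abs_le.2 ⟨?_, ?_⟩) hR
      · have := coord_sub_le_dist (pos N a n i) (pos N a (n + 1) i) 0
        rw [dist_comm] at this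
        linarith
      · exact coord_sub_le_dist _ _ 0)
    have h2 : pos N a (n + 1) i 1 - pos N a n i 1 ≤ rise N a n :=
      Finset.single_le_sum (f := fun i => pos N a (n + 1) i 1 - pos N a n i 1)
        (fun j _ => sub_nonneg.2 (pos_le_succ N a n j)) (Finset.mem_univ i)
    linarith
  · exact absurd (Or.inr ⟨i, hi, Or.inl h⟩) hsp
  · exact absurd (Or.inr ⟨i, hi, Or.inr h⟩) hsp

end Energy

/-! ### Long runs of successes -/

section Run

variable {k : ℕ} {N : Set Plane} {a : Start k} {κ : ℕ} [NeZero k]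

/-- A success that is not a special step. -/
def PlainSuccess (N : Set Plane) (a : Start k) (κ : ℕ) (ε : ℝ) (n : ℕ) : Prop :=
  stepLen N a n ≤ 3 / 5 * wideGap N a κ n ∧ ε / wideGap N a κ n ≤ rise N a n

/-- As long as the level has gained less than `2 / 5 * Δ`, a step of length at most `3 / 5 * Δ`
leaves the top below the initial level plus `Δ`. So the sum of the ordinates, which gains at least
`ε / Δ` per step, stays bounded by `k` times that height, and `L` steps are too many. Once the level
has gained `2 / 5 * Δ`, what remains of the gap is at most `3 / 5 * Δ`. -/
theorem exists_rise (ha : a.Good κ) {ε Δ : ℝ} (hε : 0 < ε) (hΔ : 6 ≤ Δ) {s L : ℕ}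
    (hL : k * Δ ^ 2 / ε < L) (hg : gap N a κ s ≤ Δ)
    (hrun : ∀ j < L, PlainSuccess N a κ ε (s + j)) :
    ∃ i ≤ L, moveLevel N a s + 2 / 5 * Δ ≤ moveLevel N a (s + i) ∧
      gap N a κ (s + i) ≤ 3 / 5 * Δ := by
  by_contra! hcon
  have key : ∀ i ≤ L, top N a κ (s + i) ≤ moveLevel N a s + Δ ∧
      k * moveLevel N a s + i * (ε / Δ) ≤ ∑ i', pos N a (s + i) i' 1 := by
    intro i hi
    induction i with
    | zero =>
      refine ⟨by unfold gap at hg; simpa using by linarith, ?_⟩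
      calc (k * moveLevel N a s + (0 : ℕ) * (ε / Δ) : ℝ) = ∑ _i : Fin k, moveLevel N a s := by
            rw [Finset.sum_const, Finset.card_univ, Fintype.card_fin, nsmul_eq_mul]
            push_cast
            ring
        _ ≤ _ := Finset.sum_le_sum fun i' _ => moveLevel_le_pos N a s i'
    | succ i ih =>
      obtain ⟨h1, h2⟩ := ih (by omega)
      obtain ⟨hR, hr⟩ := hrun i (by omega)
      have hw := moveLevel_mono N a (Nat.le_add_right s i)
      have hlt : moveLevel N a (s + i) < moveLevel N a s + 2 / 5 * Δ := by
        by_contra! hge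
        have := hcon i (by omega) hge
        unfold gap at this
        linarith
      have hW : wideGap N a κ (s + i) ≤ Δ := max_le (by unfold gap; linarith) hΔ
      have h6 := six_le_wideGap (N := N) (a := a) (κ := κ) (s + i)
      refine ⟨?_, ?_⟩
      · rw [← add_assoc, top_succ]
        exact max_le h1 (by linarith)
      · have h3 : ε / Δ ≤ ε / wideGap N a κ (s + i) :=
          div_le_div_of_nonneg_left hε.le (by linarith) hW
        unfold rise at hr
        rw [Finset.sum_sub_distrib] at hr
        rw [← add_assoc]
        push_cast
        linarith
  obtain ⟨h1, h2⟩ := key L le_rfl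
  have h3 : ∑ i', pos N a (s + L) i' 1 ≤ k * (moveLevel N a s + Δ) := by
    calc _ ≤ ∑ _i : Fin k, (moveLevel N a s + Δ) :=
          Finset.sum_le_sum fun i' _ => (pos_le_top N a ha.pts_close _ i').trans h1
      _ = _ := by rw [Finset.sum_const, Finset.card_univ, Fintype.card_fin, nsmul_eq_mul]
  have h4 : L * (ε / Δ) ≤ k * Δ := by linarith
  rw [div_lt_iff₀ hε] at hL
  have h5 : (L : ℝ) * ε ≤ k * Δ * Δ := by
    rw [← mul_div_assoc, div_le_iff₀ (by linarith)] at h4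
    exact h4
  nlinarith

/-- Each round multiplies the bound on the gap by `3 / 5`, down to the floor `6`, and lifts the
level by at least `2 / 5 * 6 = 12 / 5`. -/
theorem exists_rises (ha : a.Good κ) {ε e : ℝ} (hε : 0 < ε) (he : 6 ≤ e) {s L : ℕ}
    (hL : k * e ^ 2 / ε < L) (hg : gap N a κ s ≤ e) (m : ℕ)
    (hrun : ∀ j < m * L, PlainSuccess N a κ ε (s + j)) :
    ∃ i ≤ m * L, moveLevel N a s + 12 / 5 * m ≤ moveLevel N a (s + i) ∧
      gap N a κ (s + i) ≤ max 6 ((3 / 5) ^ m * e) := by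
  induction m with
  | zero => exact ⟨0, by simp, by simp, by simpa using Or.inr hg⟩
  | succ m ih =>
    have hmL : (m + 1) * L = m * L + L := by ring
    obtain ⟨i, hi, h1, h2⟩ := ih fun j hj => hrun j (by omega)
    set Δ := max 6 ((3 / 5) ^ m * e) with hΔ
    have hΔe : Δ ≤ e := max_le he (mul_le_of_le_one_left (by linarith)
      (pow_le_one₀ (by norm_num) (by norm_num)))
    have h6 : 6 ≤ Δ := le_max_left _ _
    obtain ⟨i', hi', h3, h4⟩ := exists_rise ha hε h6 (s := s + i) (L := L) (lt_of_le_of_lt (by gcongr) hL)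
      h2 (fun j hj => by rw [add_assoc]; exact hrun (i + j) (by omega))
    refine ⟨i + i', by omega, ?_, ?_⟩
    · rw [← add_assoc]
      push_cast
      linarith
    · rw [← add_assoc]
      refine h4.trans ?_
      rcases max_cases 6 ((3 / 5) ^ m * e) with h | h
      · refine le_max_of_le_left ?_
        rw [hΔ, h.1]
        norm_num
      · refine le_max_of_le_right ?_
        rw [hΔ, h.1, pow_succ]
        linarith

theorem gap_le_six {ε : ℝ} {s m : ℕ} (hg : gap N a κ s ≤ 6)
    (hrun : ∀ j < m, PlainSuccess N a κ ε (s + j)) : gap N a κ (s + m) ≤ 6 := by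
  induction m with
  | zero => exact hg
  | succ m ih =>
    have h1 := ih fun j hj => hrun j (by omega)
    have h2 := (hrun m (by omega)).1
    have hw : wideGap N a κ (s + m) = 6 := max_eq_right h1
    rw [hw] at h2
    exact (gap_succ_le (s + m)).trans (max_le h1 (by linarith))

variable (k κ) in
/-- A long enough run of plain successes contains a good step. -/
theorem exists_plain_run {ε e : ℝ} (hε : 0 < ε) (he : 6 ≤ e) : ∃ M : ℕ, 1 ≤ M ∧
    ∀ (N : Set Plane) (a : Start k), a.Good κ → ∀ s : ℕ, gap N a κ s ≤ e →
      (∀ j < M, PlainSuccess N a κ ε (s + j)) →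
      ∃ n : ℕ, s < k * n ∧ k * n ≤ s + M ∧ gap N a κ (k * n) ≤ 6 ∧
        moveLevel N a s + κ + 1 ≤ moveLevel N a (k * n) := by
  obtain ⟨L, hL⟩ := exists_nat_gt (k * e ^ 2 / ε)
  obtain ⟨m1, hm1⟩ := exists_pow_lt_of_lt_one (show (0 : ℝ) < 6 / e by positivity)
    (show (3 / 5 : ℝ) < 1 by norm_num)
  -- `m1` rounds bring the gap down to `6`, and the `κ + 1` others ensure the required rise of the
  -- level.
  set m := m1 + κ + 1 with hm
  have hme : (3 / 5 : ℝ) ^ m * e ≤ 6 := by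
    have : (3 / 5 : ℝ) ^ m ≤ (3 / 5) ^ m1 :=
      pow_le_pow_of_le_one (by norm_num) (by norm_num) (by omega)
    have h2 : (3 / 5 : ℝ) ^ m ≤ 6 / e := this.trans hm1.le
    rwa [le_div_iff₀ (by linarith)] at h2
  have hk : 1 ≤ k := Nat.one_le_iff_ne_zero.2 (NeZero.ne k)
  refine ⟨m * L + k, by omega, fun N a ha s hg hrun => ?_⟩
  obtain ⟨i, hi, h1, h2⟩ := exists_rises ha hε he hL hg m fun j hj => hrun j (by omega)
  rw [max_eq_left hme] at h2
  have hdm := Nat.div_add_mod (s + i) k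
  have hmod := Nat.mod_lt (s + i) (show 0 < k by omega)
  have hn : k * ((s + i) / k + 1) = k * ((s + i) / k) + k := by ring
  obtain ⟨d, hd⟩ : ∃ d, k * ((s + i) / k + 1) = s + i + d :=
    ⟨k * ((s + i) / k + 1) - (s + i), by omega⟩
  refine ⟨(s + i) / k + 1, by omega, by omega, ?_, ?_⟩
  · rw [hd]
    exact gap_le_six h2 fun j hj => by rw [add_assoc]; exact hrun (i + j) (by omega)
  · have h3 := moveLevel_mono N a (show s + i ≤ k * ((s + i) / k + 1) by omega)
    have h4 : (κ + 1 : ℝ) ≤ m := by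
      rw [hm]
      push_cast
      linarith [Nat.cast_nonneg (α := ℝ) m1]
    have h5 : (0 : ℝ) ≤ m := Nat.cast_nonneg m
    linarith

theorem specialCount_mono : Monotone (specialCount N a) :=
  monotone_nat_of_le_succ fun n => by
    rw [specialCount_succ]
    exact Nat.le_add_right _ _

variable (k κ) in
/-- A long enough run of successes contains a good step. -/
theorem exists_run {ε e : ℝ} (hε : 0 < ε) (hε1 : ε ≤ 1)
    (he : (4 * k : ℝ) ^ (4 * k) * (k * 12) ≤ e) : ∃ M : ℕ, 1 ≤ M ∧
    ∀ (N : Set Plane) (a : Start k), 1 ≤ κ → a.Good κ → Nice N a → ∀ s : ℕ, energy N a κ s ≤ e →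
      (∀ j < M, Success N a κ ε (s + j)) →
      ∃ n : ℕ, s < k * n ∧ k * n ≤ s + M ∧ gap N a κ (k * n) ≤ 6 ∧
        moveLevel N a s + κ + 1 ≤ moveLevel N a (k * n) := by
  have hk := one_le_card (k := k)
  have he6 : 6 ≤ e := by
    have h1 : (1 : ℝ) ≤ (4 * k : ℝ) ^ (4 * k) := one_le_pow₀ (by linarith)
    nlinarith
  obtain ⟨M, hM, h⟩ := exists_plain_run k κ hε he6
  refine ⟨(4 * k + 1) * M, by nlinarith, fun N a hκ ha hN s hs hrun => ?_⟩
  have hen : ∀ j ≤ (4 * k + 1) * M, energy N a κ (s + j) ≤ e := by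
    intro j hj
    induction j with
    | zero => exact hs
    | succ j ih =>
      exact hN.energy_success_le hκ ha hε hε1 (hrun j (by omega)) he (ih (by omega))
  -- There are at most `4 * k` special steps, so one of `4 * k + 1` consecutive blocks of length `M`
  -- contains none.
  obtain ⟨q, hq, hc⟩ : ∃ q < 4 * k + 1,
      specialCount N a (s + q * M + M) = specialCount N a (s + q * M) := by
    by_contra! hcon
    have : ∀ q ≤ 4 * k + 1, q ≤ specialCount N a (s + q * M) := by
      intro q hq
      induction q with
      | zero => exact Nat.zero_le _
      | succ q ih =>
        have h1 := ih (by omega)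
        have h2 := hcon q (by omega)
        have h3 : specialCount N a (s + q * M) ≤ specialCount N a (s + q * M + M) :=
          specialCount_mono (Nat.le_add_right _ _)
        have h4 : s + (q + 1) * M = s + q * M + M := by ring
        rw [h4]
        omega
    have h1 := this _ le_rfl
    have h2 := hN.specialCount_le hκ ha (s + (4 * k + 1) * M)
    omega
  have hqM : q * M + M ≤ (4 * k + 1) * M := by nlinarith
  obtain ⟨n, h1, h2, h3, h4⟩ := h N a ha (s + q * M)
    ((gap_le_energy ha _).trans (hen _ (by omega))) fun j hj => by
      have hns : ¬ SpecialStep N a (s + q * M + j) := by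
        intro hsp
        have h1 := specialCount_succ (N := N) (a := a) (s + q * M + j)
        rw [if_pos hsp] at h1
        have h2 : specialCount N a (s + q * M) ≤ specialCount N a (s + q * M + j) :=
          specialCount_mono (Nat.le_add_right _ _)
        have h3 : specialCount N a (s + q * M + j + 1) ≤ specialCount N a (s + q * M + M) :=
          specialCount_mono (by omega)
        omega
      have := hrun (q * M + j) (by omega)
      rw [← add_assoc] at this
      rcases this with ⟨h1, -⟩ | ⟨-, h1, h2 | h2⟩
      · exact absurd (Or.inl h1) hns
      · exact absurd h2 hns
      · exact ⟨h1, h2⟩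
  refine ⟨n, by omega, by omega, h3, ?_⟩
  have := moveLevel_mono N a (Nat.le_add_right s (q * M))
  linarith

/-! ### Counting runs of successes -/

open Classical in
/-- The length of the current run of successes at low energy, and the number of completed runs of
length `M`. -/
def streak (N : Set Plane) (a : Start k) (κ : ℕ) (ε e : ℝ) (M : ℕ) : ℕ → ℕ × ℕ
  | 0 => (0, 0)
  | n + 1 =>
    if Success N a κ ε n ∧ energy N a κ n ≤ e then
      if (streak N a κ ε e M n).1 + 1 = M then (0, (streak N a κ ε e M n).2 + 1)
      else ((streak N a κ ε e M n).1 + 1, (streak N a κ ε e M n).2)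
    else (0, (streak N a κ ε e M n).2)

theorem streak_lt {ε e : ℝ} {M : ℕ} (hM : 1 ≤ M) (n : ℕ) : (streak N a κ ε e M n).1 < M := by
  induction n with
  | zero => exact hM
  | succ n ih =>
    unfold streak
    split_ifs with h1 h2
    · exact hM
    · simp only
      omega
    · exact hM

/-- The first counter certifies that the steps just before `n`, as many as it says, were successes
at low energy. -/
theorem streak_run {ε e : ℝ} {M : ℕ} (n : ℕ) : (streak N a κ ε e M n).1 ≤ n ∧
    ∀ j < n, n - (streak N a κ ε e M n).1 ≤ j → Success N a κ ε j ∧ energy N a κ j ≤ e := by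
  induction n with
  | zero => exact ⟨le_rfl, fun j hj => absurd hj (Nat.not_lt_zero j)⟩
  | succ n ih =>
    unfold streak
    split_ifs with h1 h2
    · exact ⟨Nat.zero_le _, fun j hj h => by simp only at h; omega⟩
    · refine ⟨by simp only; omega, fun j hj h => ?_⟩
      simp only at h
      rcases Nat.lt_succ_iff_lt_or_eq.1 hj with h3 | rfl
      · exact ih.2 j h3 (by omega)
      · exact h1
    · exact ⟨Nat.zero_le _, fun j hj h => by simp only at h; omega⟩

/-- Within a run, the energy is low. -/
theorem Nice.energy_le_of_streak (hN : Nice N a) (hκ : 1 ≤ κ) (ha : a.Good κ) {ε e : ℝ}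
    (h0 : 0 < ε) (h1 : ε ≤ 1) (he : (4 * k : ℝ) ^ (4 * k) * (k * 12) ≤ e) {M n : ℕ}
    (hs : (streak N a κ ε e M n).1 ≠ 0) : energy N a κ n ≤ e := by
  cases n with
  | zero => exact absurd rfl hs
  | succ n =>
    unfold streak at hs
    split_ifs at hs with h2 h3
    · exact absurd rfl hs
    · exact hN.energy_success_le hκ ha h0 h1 h2.1 he h2.2
    · exact absurd rfl hs

/-- Every completed run contains a good step. -/
theorem goodStep_streak_le (hκ : 6 ≤ κ) (ha : a.Good κ) {ε e : ℝ} {M : ℕ} (hM : 1 ≤ M)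
    (hrun : ∀ s : ℕ, energy N a κ s ≤ e → (∀ j < M, Success N a κ ε (s + j)) →
      ∃ n : ℕ, s < k * n ∧ k * n ≤ s + M ∧ gap N a κ (k * n) ≤ 6 ∧
        moveLevel N a s + κ + 1 ≤ moveLevel N a (k * n)) (n : ℕ) :
    goodStep κ N a (streak N a κ ε e M n).2 ≤ (n - (streak N a κ ε e M n).1 : ℕ) := by
  have hκ6 : (6 : ℝ) ≤ κ := by exact_mod_cast hκ
  induction n with
  | zero => simp [streak, goodStep_zero]
  | succ n ih =>
    obtain ⟨hle, hr⟩ := streak_run (N := N) (a := a) (κ := κ) (ε := ε) (e := e) (M := M) n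
    unfold streak
    split_ifs with h1 h2
    -- The completed run consists of the `M` steps from `s` to `n`. The good steps counted before
    -- were reached by time `s`, so the one found in this run is new.
    · set s := n - (streak N a κ ε e M n).1 with hs
      set G := (streak N a κ ε e M n).2 with hG
      have hall : ∀ j < M, Success N a κ ε (s + j) ∧ energy N a κ (s + j) ≤ e := by
        intro j hj
        rcases Nat.lt_or_ge (s + j) n with h3 | h3
        · exact hr _ h3 (by omega)
        · rw [show s + j = n by omega]
          exact h1
      obtain ⟨m, h3, h4, h5, h6⟩ := hrun s (hall 0 hM).2 fun j hj => (hall j hj).1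
      have hlt : goodStep κ N a G < ((k * m : ℕ) : ℕ∞) :=
        ih.trans_lt (by exact_mod_cast h3)
      have hle' : (goodStep κ N a G).toNat ≤ s := by
        have := ENat.toNat_le_toNat ih (ENat.natCast_ne_top _)
        simpa using this
      have h7 := moveLevel_mono N a hle'
      refine (goodStep_succ_le (Nat.one_le_iff_ne_zero.2 ?_) hlt ?_ ?_).trans ?_
      · rintro rfl
        simp at h3
      · exact (height_hist_le N a ha.pts_close (by omega) ha.hist_strip _).trans
          (le_trans h5 hκ6)
      · linarith
      · simp only
        exact_mod_cast (by omega : k * m ≤ n + 1 - 0)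
    · refine ih.trans ?_
      simp only
      exact_mod_cast (by omega)
    · refine ih.trans ?_
      simp only
      exact_mod_cast (by omega)

end Run

/-! ### Two configurations with the same first steps -/

section Congr

variable {k : ℕ} [NeZero k] {N N' : Set Plane} {a : Start k} {κ : ℕ}

/-- The first `n` steps are the same. -/
def SameSteps (N N' : Set Plane) (a : Start k) (n : ℕ) : Prop :=
  ∀ j ≤ n, explore N' a j = explore N a j

variable {n : ℕ} (h : SameSteps N N' a n)
include h

theorem SameSteps.pos {j : ℕ} (hj : j ≤ n) : pos N' a j = pos N a j := pos_congr (h j hj)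

theorem SameSteps.moveLevel {j : ℕ} (hj : j ≤ n) : moveLevel N' a j = moveLevel N a j :=
  moveLevel_congr (h j hj)

theorem SameSteps.stepLen {j : ℕ} (hj : j < n) : stepLen N' a j = stepLen N a j := by
  unfold DSF.stepLen
  rw [h.pos hj.le, h.pos hj]

theorem SameSteps.rise {j : ℕ} (hj : j < n) : rise N' a j = rise N a j := by
  unfold DSF.rise
  rw [h.pos hj.le, h.pos hj]

theorem SameSteps.top {j : ℕ} (hj : j ≤ n) : top N' a κ j = top N a κ j := by
  induction j with
  | zero => rfl
  | succ j ih =>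
    unfold DSF.top
    rw [ih (by omega), h.moveLevel (by omega), h.stepLen (by omega)]

theorem SameSteps.gap {j : ℕ} (hj : j ≤ n) : gap N' a κ j = gap N a κ j := by
  unfold DSF.gap
  rw [h.top hj, h.moveLevel hj]

theorem SameSteps.wideGap {j : ℕ} (hj : j ≤ n) : wideGap N' a κ j = wideGap N a κ j := by
  unfold DSF.wideGap
  rw [h.gap hj]

theorem SameSteps.specialSource {j : ℕ} (hj : j ≤ n) :
    SpecialSource N' a j ↔ SpecialSource N a j := by
  unfold SpecialSource
  rw [h.pos hj]

theorem SameSteps.specialStep {j : ℕ} (hj : j < n) :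
    SpecialStep N' a j ↔ SpecialStep N a j := by
  unfold SpecialStep
  rw [h.specialSource hj.le, h.pos hj.le, h.pos hj]

theorem SameSteps.specialCount {j : ℕ} (hj : j ≤ n) : specialCount N' a j = specialCount N a j := by
  classical
  unfold DSF.specialCount
  refine Finset.sum_congr rfl fun i hi => ?_
  exact if_congr (h.specialStep ((Finset.mem_range.1 hi).trans_le hj)) rfl rfl

theorem SameSteps.energy {j : ℕ} (hj : j ≤ n) : energy N' a κ j = energy N a κ j := by
  unfold DSF.energy weight excess
  rw [h.specialCount hj, h.pos hj, h.top hj]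

theorem SameSteps.success {ε : ℝ} {j : ℕ} (hj : j < n) :
    Success N' a κ ε j ↔ Success N a κ ε j := by
  unfold Success
  rw [h.specialSource hj.le, h.specialStep hj, h.stepLen hj, h.wideGap hj.le, h.rise hj]

theorem SameSteps.streak {ε e : ℝ} {M : ℕ} {j : ℕ} (hj : j ≤ n) :
    streak N' a κ ε e M j = streak N a κ ε e M j := by
  classical
  induction j with
  | zero => rfl
  | succ j ih =>
    unfold DSF.streak
    rw [ih (by omega)]
    refine if_congr ?_ rfl rfl
    rw [h.success (show j < n by omega), h.energy (show j ≤ n by omega)]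

theorem SameSteps.explored {j : ℕ} (hj : j ≤ n) : explored N' a j = explored N a j := by
  ext y
  unfold DSF.explored
  simp only [mem_ofPred_eq]
  refine exists_congr fun i => and_congr_right fun hi => ?_
  rw [h.pos (by omega), h.stepLen (by omega)]

end Congr

/-! ### Resampling the unexplored region -/

section Step

variable {k : ℕ} [NeZero k] {κ : ℕ} {a : Start k}

/-- No path has stopped before step `n`. -/
def stepAlive (a : Start k) (n : ℕ) : Set Conf := {c | ∀ j < n, HasCand c.1 a j}

open Classical in
/-- The radius of the `j`-th ball, or `-1` for a vertex that does not move. -/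
def stepRadius (N : Set Plane) (a : Start k) (j : ℕ) (i : Fin k) : ℝ :=
  if IsMoving (pos N a j) i then stepLen N a j else -1

/-- The region explored in the first `n` steps. -/
def stepZone (a : Start k) (n : ℕ) (c : Conf) : Set Plane :=
  {y | c ∈ stepAlive a n → y ∈ region a.hist (moveLevel c.1 a n)
    (fun p : Fin n × Fin k => pos c.1 a p.1 p.2) (fun p => stepRadius c.1 a p.1 p.2)}

/-- The radius `-1` makes the balls of the vertices that stay empty, so that the region is exactly
the complement of the fresh one. -/
theorem mem_stepZone_iff {n : ℕ} {c : Conf} (hc : c ∈ stepAlive a n) {y : Plane} :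
    y ∈ stepZone a n c ↔ ¬ Fresh c.1 a n y := by
  have h1 : y ∈ stepZone a n c ↔ y ∈ region a.hist (moveLevel c.1 a n)
    (fun p : Fin n × Fin k => pos c.1 a p.1 p.2) (fun p => stepRadius c.1 a p.1 p.2) :=
    ⟨fun h => h hc, fun h _ => h⟩
  rw [h1]
  unfold region Fresh stepRadius
  simp only [mem_union, mem_ofPred_eq, mem_iUnion, Metric.mem_closedBall, Prod.exists]
  constructor
  · rintro ((h | h) | ⟨j, i, h⟩) ⟨h2, h3, h4⟩
    · exact absurd h2 (not_lt.2 h)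
    · exact h3 h
    · split_ifs at h with hi
      · exact h4 ⟨j, j.2, i, hi, h⟩
      · linarith [dist_nonneg (x := y) (y := pos c.1 a j i)]
  · intro h
    by_contra! hcon
    obtain ⟨⟨h2, h3⟩, h4⟩ := hcon
    refine h ⟨h2, h3, ?_⟩
    rintro ⟨j, hj, i, hi, hd⟩
    have := h4 ⟨j, hj⟩ i
    rw [if_pos hi] at this
    linarith

theorem measStart_const (hH : MeasurableSet a.hist) (hX : LocFin a.extra) {Ω : Type*}
    [MeasurableSpace Ω] : MeasStart fun _ : Ω => a where
  pts := fun _ => measurable_const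
  hist := measurable_snd hH
  extra := countMeas_of_locFin (fun _ => hX) fun _ _ => measurable_const
  locFin := fun _ => hX

theorem countMeas_conf : CountMeas fun c : Conf => c.1 :=
  countMeas_of_locFin (fun c => c.2) fun _ hB => measurable_count hB

theorem measurable_stepLen {Ω : Type*} [MeasurableSpace Ω] {N : Ω → Set Plane} {a : Ω → Start k}
    (hN : CountMeas N) (hf : ∀ ω, LocFin (N ω)) (ha : MeasStart a) (n : ℕ) :
    Measurable fun ω => stepLen (N ω) (a ω) n :=
  Measurable.iSup fun i => (measurable_pos hN hf ha (n + 1) i).dist (measurable_pos hN hf ha n i)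

theorem measurableSet_hasCand {Ω : Type*} [MeasurableSpace Ω] {N : Ω → Set Plane}
    {a : Ω → Start k} (hN : CountMeas N) (hf : ∀ ω, LocFin (N ω)) (ha : MeasStart a) (n : ℕ) :
    MeasurableSet {ω | HasCand (N ω) (a ω) n} := by
  obtain ⟨hp, hh⟩ := measurable_explore hN hf ha n
  have hcand : HitMeas fun ω => cand (N ω) (a ω) n :=
    (hN.hitMeas.diff hh).union ((hitMeas_staySet hp).union ha.extra.hitMeas)
  refine hcand {p | moveLevel (N p.1) (a p.1) n < p.2 1} (measurableSet_lt ?_ ?_)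
  · exact (measurable_moveLevel hN hf ha n).comp measurable_fst
  · exact (measurable_coord 1).comp measurable_snd

theorem measurableSet_stepAlive (hH : MeasurableSet a.hist) (hX : LocFin a.extra) (n : ℕ) :
    MeasurableSet (stepAlive a n) := by
  have : stepAlive a n = ⋂ j : Fin n, {c : Conf | HasCand c.1 a j} := by
    ext c
    simp only [stepAlive, mem_ofPred_eq, mem_iInter]
    exact ⟨fun h j => h j j.2, fun h j hj => h ⟨j, hj⟩⟩
  rw [this]
  exact MeasurableSet.iInter fun j => measurableSet_hasCand countMeas_conf (fun c => c.2)
    (measStart_const hH hX) j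

theorem measurable_stepRadius (hH : MeasurableSet a.hist) (hX : LocFin a.extra) (j : ℕ)
    (i : Fin k) : Measurable fun c : Conf => stepRadius c.1 a j i := by
  classical
  unfold stepRadius
  exact Measurable.ite (measurableSet_isMoving (fun i => measurable_pos countMeas_conf
    (fun c => c.2) (measStart_const hH hX) j i) i)
    (measurable_stepLen countMeas_conf (fun c => c.2) (measStart_const hH hX) j)
    measurable_const

theorem stepZone_stop (hX : LocFin a.extra) (n : ℕ) (c c' : Conf) (hc : c ∈ stepAlive a n)
    (hag : ∀ y ∈ region a.hist (moveLevel c.1 a n) (fun p : Fin n × Fin k => pos c.1 a p.1 p.2)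
      (fun p => stepRadius c.1 a p.1 p.2), y ∈ c.1 ↔ y ∈ c'.1) :
    c' ∈ stepAlive a n ∧ moveLevel c'.1 a n = moveLevel c.1 a n ∧
      (∀ p : Fin n × Fin k, pos c'.1 a p.1 p.2 = pos c.1 a p.1 p.2) ∧
      ∀ p : Fin n × Fin k, stepRadius c'.1 a p.1 p.2 = stepRadius c.1 a p.1 p.2 := by
  have hag' : ∀ y, ¬ Fresh c.1 a n y → (y ∈ c.1 ↔ y ∈ c'.1) := fun y hy =>
    hag y ((mem_stepZone_iff hc).2 hy hc)
  have hs : SameSteps c.1 c'.1 a n := fun j hj => explore_stop c.2 hX hc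
    (fun y hy => hag' y fun hf => hf.2.2 hy) hj
  refine ⟨fun j hj => HasCand.congr (hs j hj.le) (hs (j + 1) hj) c.2 hX (hc j hj),
    hs.moveLevel le_rfl, fun p => by rw [hs.pos p.1.2.le], fun p => ?_⟩
  unfold stepRadius
  rw [hs.pos p.1.2.le, hs.stepLen p.1.2]

/-- The explored region can be resampled. -/
def stepExplorable (hH : MeasurableSet a.hist) (hX : LocFin a.extra) (n : ℕ) :
    Explorable (stepZone a n) (Bool × ℤ × (Fin n × Fin k → (ℤ × ℤ) × ℤ)) := by
  have h1 := measurableSet_stepAlive hH hX n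
  have h2 : Measurable fun c : Conf => moveLevel c.1 a n :=
    measurable_moveLevel (a := fun _ => a) countMeas_conf (fun c => c.2) (measStart_const hH hX) n
  have h3 : ∀ p : Fin n × Fin k, Measurable fun c : Conf => pos c.1 a p.1 p.2 :=
    fun p => measurable_pos (a := fun _ => a) countMeas_conf (fun c => c.2)
      (measStart_const hH hX) p.1 p.2
  have h4 : ∀ p : Fin n × Fin k, Measurable fun c : Conf => stepRadius c.1 a p.1 p.2 :=
    fun p => measurable_stepRadius hH hX p.1 p.2
  have h5 := stepZone_stop hX n
  exact explorableOfParams h1 hH h2 h3 h4 h5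

variable {n : ℕ} {c : Conf}

theorem mem_resample_of_fresh (hc : c ∈ stepAlive a n) {y : Plane} (hy : Fresh c.1 a n y)
    (c' : Conf) : y ∈ (resample (stepZone a n) (c, c')).1 ↔ y ∈ c'.1 := by
  have : y ∉ stepZone a n c := fun h => (mem_stepZone_iff hc).1 h hy
  unfold resample
  rw [mem_glue_iff]
  simp [this]

theorem mem_resample_of_not_fresh (hc : c ∈ stepAlive a n) {y : Plane} (hy : ¬ Fresh c.1 a n y)
    (c' : Conf) : y ∈ (resample (stepZone a n) (c, c')).1 ↔ y ∈ c.1 := by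
  have : y ∈ stepZone a n c := (mem_stepZone_iff hc).2 hy
  unfold resample
  rw [mem_glue_iff]
  simp [this]

theorem sameSteps_resample (hX : LocFin a.extra) (hc : c ∈ stepAlive a n) (c' : Conf) :
    SameSteps c.1 (resample (stepZone a n) (c, c')).1 a n := fun _ hj =>
  explore_stop c.2 hX hc
    (fun _ hy => (mem_resample_of_not_fresh hc (fun hf => hf.2.2 hy) c').symm) hj

theorem fresh_resample_iff (hX : LocFin a.extra) (hc : c ∈ stepAlive a n) (c' : Conf) (y : Plane) :
    Fresh (resample (stepZone a n) (c, c')).1 a n y ↔ Fresh c.1 a n y := by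
  have h := sameSteps_resample hX hc c'
  unfold Fresh
  rw [h.moveLevel le_rfl, h.explored le_rfl]

end Step

/-! ### General position holds almost surely -/

section Law

variable {L : Measure Conf} {lam : ℝ} [IsProbabilityMeasure L]

theorem ae_level_ne (hL : IsPoissonProcess L lam (fun c : Conf => c.1)) (hlam : 0 < lam) (t : ℝ) :
    ∀ᵐ c ∂L, ∀ y ∈ c.1, y 1 ≠ t := by
  have h := ae_void hL hlam (B := {y : Plane | y 0 ∈ univ ∧ y 1 ∈ ({t} : Set ℝ)})
    (measurableSet_rect MeasurableSet.univ (measurableSet_singleton t))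
    (by rw [volume_rect]; simp)
  filter_upwards [h] with c hc y hy hyt
  have : y ∈ c.1 ∩ {y : Plane | y 0 ∈ univ ∧ y 1 ∈ ({t} : Set ℝ)} := ⟨hy, mem_univ _, hyt⟩
  rw [hc] at this
  exact this

variable {k : ℕ} [NeZero k] {a : Start k}

theorem special_finite (hX : a.extra.encard ≤ k) : a.special.Finite :=
  (finite_range _).union (finite_of_encard_le_coe hX)

theorem ae_nice (hL : IsPoissonProcess L lam (fun c : Conf => c.1)) (hlam : 0 < lam)
    (hX : a.extra.encard ≤ k) : ∀ᵐ c ∂L, Nice c.1 a := by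
  have h1 : ∀ᵐ c ∂L, ∀ y ∈ a.special, ∀ x ∈ (c : Conf).1, x 1 ≠ y 1 :=
    (ae_ball_iff (special_finite hX).countable).2 fun y _ => ae_level_ne hL hlam _
  filter_upwards [h1, ae_ordinate_ne hL hlam le_rfl, ae_exists_above hL hlam] with c h1 h2 h3
  exact ⟨c.2, hX, fun x hx y hy hxy h => h2 x hx y hy hxy (by rw [h, add_zero]),
    fun x hx y hy => h1 y hy x hx, h3⟩

theorem volume_real_ball (c : Plane) {r : ℝ} (hr : 0 ≤ r) :
    volume.real (Metric.ball c r) = Real.pi * r ^ 2 := by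
  rw [Measure.real, EuclideanSpace.volume_ball_fin_two, ENNReal.toReal_mul, ENNReal.toReal_pow,
    ENNReal.toReal_ofReal hr]
  simp [mul_comm, Real.pi_nonneg]

theorem measurableSet_ball_void (x : Plane) (r : ℝ) :
    MeasurableSet {c : Conf | c.1 ∩ Metric.ball x r = ∅} :=
  measurableSet_void measurableSet_ball

theorem measure_ball_void (hL : IsPoissonProcess L lam (fun c : Conf => c.1)) (hlam : 0 < lam)
    (x : Plane) {r : ℝ} (hr : 0 ≤ r) :
    L {c | c.1 ∩ Metric.ball x r = ∅} = ENNReal.ofReal (Real.exp (-(lam * (Real.pi * r ^ 2)))) := by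
  rw [measure_void hL hlam measurableSet_ball Metric.isBounded_ball]
  rw [volume_real_ball x hr]

end Law

/-! ### The exponential moment of the energy after one step -/

/-- A disc whose points bound the length of a step from `x`. -/
def cusp (x : Plane) (D : ℝ) : Set Plane := Metric.ball (lift x (D / 2)) (D / 10)

/-- A disc above the explored region whose points bound the length of a step from `x` by `r`. -/
def highDisc (x : Plane) (D r : ℝ) : Set Plane :=
  Metric.ball (lift x (D + (r - D) / 2)) ((r - D) / 2)

/-- A thin rectangle above `x`. -/
def slab (x : Plane) (D t : ℝ) : Set Plane :=
  {y | y 0 ∈ Icc (x 0 - 3 / 5 * D) (x 0 + 3 / 5 * D) ∧ y 1 ∈ Ico (x 1) (x 1 + t)}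

section Energy

variable {k : ℕ} [NeZero k] {N : Set Plane} {a : Start k} {κ : ℕ}

open Classical in
-- One term for each way in which the energy can evolve. It contracts at a success with a wide gap,
-- does not grow if the step stays within the gap, and is bounded by a constant if the gap is small.
-- Otherwise the step itself bounds it. A step between one and two gaps from a special source is a
-- success, so the third term only concerns the other sources.
theorem Nice.exp_energy_succ_le (hN : Nice N a) (hκ : 1 ≤ κ) (ha : a.Good κ) {ε α : ℝ}
    (h0 : 0 < ε) (h1 : ε ≤ 1) (hα : 0 < α) (n : ℕ) :
    Real.exp (α * energy N a κ (n + 1) ^ 2) ≤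
      ((if Success N a κ ε n then Real.exp (-(α * ε)) else 1) *
        Real.exp (α * energy N a κ n ^ 2) +
        Real.exp (α * ((4 * k : ℝ) ^ (4 * k) * (k * 12)) ^ 2)) +
      ((if ¬ SpecialSource N a n ∧ 3 / 5 * wideGap N a κ n < stepLen N a n then
        Real.exp (α * ((4 * k : ℝ) ^ (4 * k) * (k * (2 * wideGap N a κ n))) ^ 2) else 0) +
      if 2 * wideGap N a κ n < stepLen N a n then
        Real.exp (α * ((4 * k : ℝ) ^ (4 * k) * (k * stepLen N a n)) ^ 2) else 0) := by
  have hE := energy_nonneg (N := N) ha n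
  have hE' := energy_nonneg (N := N) ha (n + 1)
  have hR := stepLen_nonneg N a n
  have hD := six_le_wideGap (N := N) (a := a) (κ := κ) n
  have mono : ∀ {b : ℝ}, energy N a κ (n + 1) ≤ b →
      Real.exp (α * energy N a κ (n + 1) ^ 2) ≤ Real.exp (α * b ^ 2) := fun h => by gcongr
  set V := Real.exp (α * energy N a κ n ^ 2) with hV
  set V' := Real.exp (α * energy N a κ (n + 1) ^ 2) with hV'
  have p0 : 0 < V := Real.exp_pos _
  have p1 : 0 < Real.exp (α * ((4 * k : ℝ) ^ (4 * k) * (k * 12)) ^ 2) := Real.exp_pos _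
  have q1 : (0 : ℝ) ≤ (if Success N a κ ε n then Real.exp (-(α * ε)) else 1) * V := by
    split_ifs <;> positivity
  have q2 : (0 : ℝ) ≤ if ¬ SpecialSource N a n ∧ 3 / 5 * wideGap N a κ n < stepLen N a n then
        Real.exp (α * ((4 * k : ℝ) ^ (4 * k) * (k * (2 * wideGap N a κ n))) ^ 2) else 0 := by
    split_ifs <;> positivity
  have q3 : (0 : ℝ) ≤ if 2 * wideGap N a κ n < stepLen N a n then
        Real.exp (α * ((4 * k : ℝ) ^ (4 * k) * (k * stepLen N a n)) ^ 2) else 0 := by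
    split_ifs <;> positivity
  have hns : 2 * wideGap N a κ n < stepLen N a n → ¬ Success N a κ ε n := by
    rintro h (⟨-, h'⟩ | ⟨-, h', -⟩) <;> linarith
  rcases lt_or_ge (2 * wideGap N a κ n) (stepLen N a n) with hb | hb
  · rw [if_neg (hns hb), one_mul, if_pos hb]
    rw [if_neg (hns hb), one_mul] at q1
    rw [if_pos hb] at q3
    rcases le_max_iff.1 (energy_succ_le (N := N) (κ := κ) ha n) with h | h
    · linarith [mono h]
    · linarith [mono h]
  rcases lt_or_ge (gap N a κ n) 6 with hg | hg
  · have hw : wideGap N a κ n = 6 := max_eq_right hg.le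
    have := mono (energy_succ_le_of_gap_le ha hg.le (by rw [hw] at hb; linarith))
    linarith
  have hw : wideGap N a κ n = gap N a κ n := max_eq_left hg
  by_cases hs : Success N a κ ε n
  · have h2 := hN.energy_sq_succ hκ ha h0 h1 hg hs
    rw [if_pos hs]
    have : V' ≤ Real.exp (-(α * ε)) * V := by
      rw [hV, hV', ← Real.exp_add, Real.exp_le_exp]
      nlinarith
    linarith
  rw [if_neg hs, one_mul]
  rcases le_or_gt (stepLen N a n) (gap N a κ n) with hR' | hR'
  · linarith [mono (energy_succ_le_of_le ha hR')]
  have hsp : ¬ SpecialSource N a n := fun h => hs (Or.inl ⟨h, hb⟩)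
  rw [if_pos ⟨hsp, by rw [hw]; linarith⟩]
  rw [if_pos ⟨hsp, by rw [hw]; linarith⟩] at q2
  rcases le_max_iff.1 (energy_succ_le (N := N) (κ := κ) ha n) with h | h
  · linarith [mono h]
  · have : energy N a κ (n + 1) ≤ (4 * k : ℝ) ^ (4 * k) * (k * (2 * wideGap N a κ n)) :=
      h.trans (by gcongr)
    linarith [mono this]

end Energy

/-! ### Estimates for one step -/

section Law

variable {L : Measure Conf} {lam : ℝ} [IsProbabilityMeasure L]

open Classical in
/-- The contribution of the long steps. -/
def tail (x : Plane) (D β : ℝ) (c : Conf) : ENNReal :=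
  (if c.1 ∩ cusp x D = ∅ then ENNReal.ofReal (Real.exp (β * (2 * D) ^ 2)) else 0) +
    ∑' j : ℕ, if c.1 ∩ highDisc x D (2 * D + j) = ∅ then
      ENNReal.ofReal (Real.exp (β * (2 * D + j + 1) ^ 2)) else 0

theorem lintegral_ite_const {Ω : Type*} [MeasurableSpace Ω] {P : Measure Ω} {A : Set Ω}
    [∀ ω, Decidable (ω ∈ A)] (hA : MeasurableSet A) (b : ENNReal) :
    ∫⁻ ω, (if ω ∈ A then b else 0) ∂P = b * P A := by
  rw [← lintegral_indicator_const hA]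
  exact lintegral_congr fun ω => by simp [indicator_apply]

/-- The cusp has area `π D² / 100`, and its void probability absorbs `exp (4 β D²)` because `400 * β
≤ lam * π`. The high discs have radius `(D + j) / 2` and leave a geometric series in `j`. -/
theorem lintegral_tail_le (hL : IsPoissonProcess L lam (fun c : Conf => c.1)) (hlam : 0 < lam)
    (x : Plane) {D β : ℝ} (hD : 6 ≤ D) (hβ : 400 * β ≤ lam * Real.pi) :
    ∫⁻ c, tail x D β c ∂L ≤ ENNReal.ofReal (1 + (1 - Real.exp (-(lam * Real.pi / 5)))⁻¹) := by
  classical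
  have hlp : 0 < lam * Real.pi := mul_pos hlam Real.pi_pos
  have hx1 : Real.exp (-(lam * Real.pi / 5)) < 1 := (Real.exp_lt_exp.2 (by linarith)).trans_eq Real.exp_zero
  have hvoid : ∀ (y : Plane) (r b : ℝ), 0 ≤ r → ∫⁻ c : Conf, (if c.1 ∩ Metric.ball y r = ∅ then
      ENNReal.ofReal (Real.exp b) else 0) ∂L =
      ENNReal.ofReal (Real.exp (b - lam * (Real.pi * r ^ 2))) := by
    intro y r b hr
    have := lintegral_ite_const (P := L) (measurableSet_ball_void y r) (ENNReal.ofReal (Real.exp b))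
    simp only [mem_ofPred_eq] at this
    rw [this, measure_ball_void hL hlam y hr, ← ENNReal.ofReal_mul (Real.exp_nonneg _),
      ← Real.exp_add, sub_eq_add_neg]
  have hm : ∀ (y : Plane) (r : ℝ) (b : ENNReal),
      Measurable fun c : Conf => if c.1 ∩ Metric.ball y r = ∅ then b else 0 := fun y r b =>
    Measurable.ite (measurableSet_ball_void y r) measurable_const measurable_const
  unfold tail cusp highDisc
  rw [lintegral_add_left (hm _ _ _), lintegral_tsum fun j => (hm _ _ _).aemeasurable,
    hvoid _ _ _ (by linarith), ENNReal.ofReal_add zero_le_one (by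
      rw [inv_nonneg]; linarith)]
  gcongr
  · rw [Real.exp_le_one_iff]
    nlinarith [sq_nonneg D]
  · calc _ ≤ ∑' j : ℕ, ENNReal.ofReal (Real.exp (-(lam * Real.pi / 5))) ^ j := by
          refine ENNReal.tsum_le_tsum fun j => ?_
          have hj : (0 : ℝ) ≤ j := Nat.cast_nonneg j
          rw [hvoid _ _ _ (by linarith), ← ENNReal.ofReal_pow (Real.exp_nonneg _), ← Real.exp_nat_mul]
          refine ENNReal.ofReal_le_ofReal (Real.exp_le_exp.2 ?_)
          have h1 : (2 * D + j + 1) ^ 2 ≤ 5 * (D + j) ^ 2 := by nlinarith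
          have h2 : (j : ℝ) ≤ (D + j) ^ 2 := by nlinarith
          have h3 : ((2 * D + j - D) / 2) ^ 2 = (D + j) ^ 2 / 4 := by ring
          rw [h3]
          have h4 : β * (2 * D + j + 1) ^ 2 ≤ lam * Real.pi / 400 * (5 * (D + j) ^ 2) :=
            mul_le_mul (by linarith) h1 (sq_nonneg _) (by positivity)
          have h5 := mul_le_mul_of_nonneg_left h2 hlp.le
          have h6 : lam * (Real.pi * ((D + j) ^ 2 / 4)) = lam * Real.pi * (D + j) ^ 2 / 4 := by ring
          have h7 : 0 ≤ lam * Real.pi * (D + j) ^ 2 := by positivity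
          rw [h6]
          linarith
      _ = _ := by
          rw [ENNReal.tsum_geometric, ← ENNReal.ofReal_one, ← ENNReal.ofReal_sub _ (Real.exp_nonneg _),
            ← ENNReal.ofReal_inv_of_pos (by linarith)]

theorem measurableSet_slab (x : Plane) (D t : ℝ) : MeasurableSet (slab x D t) :=
  measurableSet_rect measurableSet_Icc measurableSet_Ico

theorem measureReal_ball_hit (hL : IsPoissonProcess L lam (fun c : Conf => c.1)) (hlam : 0 < lam)
    (x : Plane) {r : ℝ} (hr : 0 ≤ r) :
    L.real {c | (c.1 ∩ Metric.ball x r).Nonempty} =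
      1 - Real.exp (-(lam * (Real.pi * r ^ 2))) := by
  have : {c : Conf | (c.1 ∩ Metric.ball x r).Nonempty} = {c | c.1 ∩ Metric.ball x r = ∅}ᶜ := by
    ext c
    simp [nonempty_iff_ne_empty]
  rw [this, probReal_compl_eq_one_sub (measurableSet_ball_void x r), Measure.real,
    measure_ball_void hL hlam x hr, ENNReal.toReal_ofReal (Real.exp_nonneg _)]

theorem measurableSet_ball_hit (x : Plane) (r : ℝ) :
    MeasurableSet {c : Conf | (c.1 ∩ Metric.ball x r).Nonempty} := by
  have : {c : Conf | (c.1 ∩ Metric.ball x r).Nonempty} = {c | c.1 ∩ Metric.ball x r = ∅}ᶜ := by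
    ext c
    simp [nonempty_iff_ne_empty]
  rw [this]
  exact (measurableSet_ball_void x r).compl

open Classical in
/-- The configurations of fresh points which guarantee that the next step is a success. -/
def successSet {k : ℕ} (N : Set Plane) (a : Start k) (κ : ℕ) (ε : ℝ) (n : ℕ) (x : Plane) :
    Set Conf :=
  if SpecialSource N a n then
    {c | (c.1 ∩ highDisc x (wideGap N a κ n) (2 * wideGap N a κ n)).Nonempty}
  else {c | (c.1 ∩ cusp x (wideGap N a κ n)).Nonempty} \
    {c | c.1 ∩ slab x (wideGap N a κ n) (ε / wideGap N a κ n) = ∅}ᶜ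

variable {k : ℕ} [NeZero k] {κ : ℕ} {a : Start k}

theorem measurableSet_successSet (N : Set Plane) (a : Start k) (κ : ℕ) (ε : ℝ) (n : ℕ)
    (x : Plane) : MeasurableSet (successSet N a κ ε n x) := by
  unfold successSet
  split_ifs
  · exact measurableSet_ball_hit _ _
  · exact (measurableSet_ball_hit _ _).diff (measurableSet_void (measurableSet_slab _ _ _)).compl

/-- As `D ≥ 6`, the discs have radius at least `3 / 5` and are hit with probability at least `2 *
p`. The slab has area `6 / 5 * ε` whatever `D` is, so it is hit with probability at most `p`. -/
theorem le_measure_successSet (hL : IsPoissonProcess L lam (fun c : Conf => c.1)) (hlam : 0 < lam)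
    {ε p : ℝ} (hε : 0 < ε) (hp : 2 * p = 1 - Real.exp (-(lam * (Real.pi * (3 / 5) ^ 2))))
    (hεp : lam * (6 / 5 * ε) ≤ p) (N : Set Plane) (n : ℕ) (x : Plane) :
    p ≤ L.real (successSet N a κ ε n x) := by
  have hD := six_le_wideGap (N := N) (a := a) (κ := κ) n
  have hp0 : 0 ≤ p := le_trans (by positivity) hεp
  have hball : ∀ (y : Plane) (r : ℝ), 3 / 5 ≤ r →
      2 * p ≤ L.real {c : Conf | (c.1 ∩ Metric.ball y r).Nonempty} := by
    intro y r hr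
    rw [measureReal_ball_hit hL hlam y (by linarith), hp]
    have : lam * (Real.pi * (3 / 5) ^ 2) ≤ lam * (Real.pi * r ^ 2) := by
      have := Real.pi_pos
      gcongr
    linarith [Real.exp_le_exp.2 (neg_le_neg this)]
  unfold successSet
  split_ifs
  · have := hball (lift x (wideGap N a κ n + (2 * wideGap N a κ n - wideGap N a κ n) / 2))
      ((2 * wideGap N a κ n - wideGap N a κ n) / 2) (by linarith)
    unfold highDisc
    linarith
  · have h1 := hball (lift x (wideGap N a κ n / 2)) (wideGap N a κ n / 10) (by linarith)
    set D := wideGap N a κ n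
    have hb : Bornology.IsBounded (slab x D (ε / D)) :=
      isBounded_rect (Metric.isBounded_Icc _ _) (Metric.isBounded_Ico _ _)
    have h2 : L.real {c : Conf | c.1 ∩ slab x D (ε / D) = ∅}ᶜ ≤ p := by
      have h3 := measure_hit_le hL hlam (measurableSet_slab x D (ε / D)) hb
      have h4 : volume.real (slab x D (ε / D)) = 6 / 5 * ε := by
        unfold slab
        rw [Measure.real, volume_rect, Real.volume_Icc, Real.volume_Ico, ENNReal.toReal_mul,
          ENNReal.toReal_ofReal (by linarith), ENNReal.toReal_ofReal (by
            have : 0 < ε / D := by positivity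
            linarith)]
        field_simp
        ring
      rw [h4] at h3
      have h5 : {c : Conf | c.1 ∩ slab x D (ε / D) = ∅}ᶜ =
          {c : Conf | (c.1 ∩ slab x D (ε / D)).Nonempty} := by
        ext c
        simp [nonempty_iff_ne_empty]
      rw [h5]
      refine (ENNReal.toReal_le_of_le_ofReal (by positivity) h3).trans hεp
    have h3 := le_measureReal_sdiff (μ := L) (s₂ := {c : Conf | c.1 ∩ slab x D (ε / D) = ∅}ᶜ)
      (s₁ := {c : Conf | (c.1 ∩ cusp x D).Nonempty})
    unfold cusp at h3 ⊢
    linarith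

end Law

/-! ### One step with resampled fresh points -/

section Step

variable {k : ℕ} [NeZero k] {κ : ℕ} {a : Start k} {n : ℕ} {c c' : Conf} {i : Fin k}

/-- The first `n` steps survive the resampling, and in the fresh region the new points are those of
`c'`. Both discs are fresh; the slab need not be, but only its fresh points could spoil the rise. -/
theorem success_of_mem (hκ : 1 ≤ κ) (ha : a.Good κ) (hX : LocFin a.extra)
    (hc : c ∈ stepAlive a n) (hN : Nice (resample (stepZone a n) (c, c')).1 a)
    (hi : IsMoving (pos c.1 a n) i) {ε : ℝ}
    (h : c' ∈ successSet c.1 a κ ε n (pos c.1 a n i)) :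
    Success (resample (stepZone a n) (c, c')).1 a κ ε n := by
  have hs := sameSteps_resample hX hc c'
  have hmem := fun y hy => mem_resample_of_fresh hc (y := y) hy c'
  have hfr := fresh_resample_iff hX hc c'
  set N' := (resample (stepZone a n) (c, c')).1
  have hpos : pos N' a n = pos c.1 a n := hs.pos le_rfl
  have hw : wideGap N' a κ n = wideGap c.1 a κ n := hs.wideGap le_rfl
  rw [← hpos] at h hi
  unfold successSet at h
  split_ifs at h with hsp
  · obtain ⟨y, hy, hyO⟩ := h
    rw [← hw] at hyO
    obtain ⟨hf, hR⟩ := stepLen_le_of_high hκ ha hi le_rfl (y := y) hyO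
    exact Or.inl ⟨(hs.specialSource le_rfl).2 hsp,
      hR ((hmem y ((hfr y).1 hf)).2 hy)⟩
  · obtain ⟨⟨y, hy, hyO⟩, hslab⟩ := h
    rw [← hw] at hyO hslab
    have hsp' : ¬ SpecialSource N' a n := fun h => hsp ((hs.specialSource le_rfl).1 h)
    obtain ⟨hf, hR⟩ := hN.stepLen_le_of_cusp hκ ha hi hsp' (y := y) hyO
    refine hN.success_of_box hκ ha hi hsp' (hR ((hmem y ((hfr y).1 hf)).2 hy)) ?_
    intro z hz hzf hz0
    by_contra! hlt
    have hz' : z ∈ c'.1 := (hmem z ((hfr z).1 hzf)).1 hz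
    have h1 : c'.1 ∩ slab (pos N' a n i) (wideGap N' a κ n) (ε / wideGap N' a κ n) = ∅ := by
      simpa using hslab
    have : z ∈ c'.1 ∩ slab (pos N' a n i) (wideGap N' a κ n) (ε / wideGap N' a κ n) := by
      refine ⟨hz', ⟨?_, ?_⟩, ?_, hlt⟩
      · linarith [(abs_le.1 hz0).1]
      · linarith [(abs_le.1 hz0).2]
      · rw [hi.moveLevel_eq]
        exact hzf.1.le
    rw [h1] at this
    exact this

open Classical in
-- A long step forces a disc to be empty in `c'`: the cusp if the source is not special and the step
-- exceeds `3 / 5` of the wide gap, a high disc if it exceeds twice the wide gap.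
theorem exp_energy_resample_le (hκ : 1 ≤ κ) (ha : a.Good κ) (hX : LocFin a.extra)
    (hc : c ∈ stepAlive a n) (hN : Nice (resample (stepZone a n) (c, c')).1 a)
    (hi : IsMoving (pos c.1 a n) i) {ε α : ℝ} (hε : 0 < ε) (hε1 : ε ≤ 1) (hα : 0 < α) :
    ENNReal.ofReal (Real.exp (α * energy (resample (stepZone a n) (c, c')).1 a κ (n + 1) ^ 2)) ≤
      ENNReal.ofReal ((if c' ∈ successSet c.1 a κ ε n (pos c.1 a n i) then
        Real.exp (-(α * ε)) else 1) * Real.exp (α * energy c.1 a κ n ^ 2)) +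
      (ENNReal.ofReal (Real.exp (α * ((4 * k : ℝ) ^ (4 * k) * (k * 12)) ^ 2)) +
        tail (pos c.1 a n i) (wideGap c.1 a κ n) (α * ((4 * k : ℝ) ^ (4 * k) * k) ^ 2) c') := by
  have hs := sameSteps_resample hX hc c'
  have hmem := fun y hy => mem_resample_of_fresh hc (y := y) hy c'
  have hfr := fresh_resample_iff hX hc c'
  have hsucc := success_of_mem (ε := ε) hκ ha hX hc hN hi
  set N' := (resample (stepZone a n) (c, c')).1
  have hpos : pos N' a n = pos c.1 a n := hs.pos le_rfl
  have hw : wideGap N' a κ n = wideGap c.1 a κ n := hs.wideGap le_rfl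
  have hen : energy N' a κ n = energy c.1 a κ n := hs.energy le_rfl
  have hD := six_le_wideGap (N := N') (a := a) (κ := κ) n
  have hi' : IsMoving (pos N' a n) i := by rwa [hpos]
  have hx : pos N' a n i = pos c.1 a n i := by rw [hpos]
  have hα1 : Real.exp (-(α * ε)) ≤ 1 := Real.exp_le_one_iff.2 (by nlinarith)
  rw [← add_assoc]
  refine (ENNReal.ofReal_le_ofReal (hN.exp_energy_succ_le hκ ha hε hε1 hα n)).trans ?_
  rw [ENNReal.ofReal_add (by positivity) (by positivity), ENNReal.ofReal_add (by positivity) (by positivity),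
    ENNReal.ofReal_add (by positivity) (by positivity)]
  unfold tail
  rw [← hx, ← hw, ← hen]
  rw [← hx] at hsucc
  gcongr
  · split_ifs with h1 h2 h2
    · exact le_rfl
    · exact hα1
    · exact absurd (hsucc h2) h1
    · exact le_rfl
  · split_ifs with h1 h2 h2
    · refine ENNReal.ofReal_le_ofReal (Real.exp_le_exp.2 (le_of_eq (by ring)))
    · obtain ⟨y, hy, hyO⟩ := nonempty_iff_ne_empty.2 h2
      obtain ⟨hf, hR⟩ := hN.stepLen_le_of_cusp hκ ha hi' h1.1 (y := y) hyO
      exact absurd (hR ((hmem y ((hfr y).1 hf)).2 hy)) (not_le.2 h1.2)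
    · simp
    · simp
  · split_ifs with h1
    -- This choice gives `2 D + j < stepLen ≤ 2 D + j + 1`: the high disc of reach `2 D + j` must be
    -- empty, and the energy is bounded by means of `2 D + j + 1`.
    · set j := ⌈stepLen N' a n - 2 * wideGap N' a κ n⌉₊ - 1 with hj
      have hpos' : 0 < ⌈stepLen N' a n - 2 * wideGap N' a κ n⌉₊ := Nat.ceil_pos.2 (by linarith)
      have hj1 : (j : ℝ) < stepLen N' a n - 2 * wideGap N' a κ n :=
        Nat.lt_ceil.1 (by omega)
      have hj2 : stepLen N' a n - 2 * wideGap N' a κ n ≤ j + 1 := by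
        have := Nat.le_ceil (stepLen N' a n - 2 * wideGap N' a κ n)
        have h3 : ⌈stepLen N' a n - 2 * wideGap N' a κ n⌉₊ = j + 1 := by omega
        rw [h3] at this
        exact_mod_cast this
      refine le_trans ?_ (ENNReal.le_tsum j)
      rw [if_pos]
      · refine ENNReal.ofReal_le_ofReal (Real.exp_le_exp.2 ?_)
        rw [mul_assoc, ← mul_pow]
        have h3 : stepLen N' a n ≤ 2 * wideGap N' a κ n + j + 1 := by linarith
        have h4 := stepLen_nonneg N' a n
        rw [mul_assoc]
        gcongr
      · rw [← not_nonempty_iff_eq_empty]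
        rintro ⟨y, hy, hyO⟩
        obtain ⟨hf, hR⟩ := stepLen_le_of_high (N := N') hκ ha hi'
          (r := 2 * wideGap N' a κ n + j) (by linarith [Nat.cast_nonneg (α := ℝ) j]) (y := y) hyO
        have := hR ((hmem y ((hfr y).1 hf)).2 hy)
        linarith
    · simp

end Step

/-! ### The number of good steps -/

/-- The constants of the potential function. -/
structure DriftParams (k κ : ℕ) (lam : ℝ) where
  p : ℝ
  ε : ℝ
  α : ℝ
  e : ℝ
  ζ : ℝ
  η : ℝ
  B : ℝ
  γ : ℝ
  M : ℕ
  p_pos : 0 < p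
  p_le : p ≤ 1
  p_eq : 2 * p = 1 - Real.exp (-(lam * (Real.pi * (3 / 5) ^ 2)))
  ε_pos : 0 < ε
  ε_le : ε ≤ 1
  ε_p : lam * (6 / 5 * ε) ≤ p
  α_pos : 0 < α
  α_le : 400 * (α * ((4 * k : ℝ) ^ (4 * k) * k) ^ 2) ≤ lam * Real.pi
  B_eq : B = Real.exp (α * ((4 * k : ℝ) ^ (4 * k) * (k * 12)) ^ 2) +
    (1 + (1 - Real.exp (-(lam * Real.pi / 5)))⁻¹)
  e_le : (4 * k : ℝ) ^ (4 * k) * (k * 12) ≤ e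
  ζ_pos : 0 < ζ
  ζ_le : ζ * (3 / p) ^ M ≤ 1 / 2
  η_pos : 0 < η
  η_B : η * B = ζ
  γ_lt : γ < 1
  γ_ζ : 1 - ζ ≤ γ
  γ_drift : 1 - p * (1 - Real.exp (-(α * ε))) / 2 ≤ γ
  V_large : 6 * ζ ≤ η * (p * (1 - Real.exp (-(α * ε)))) * Real.exp (α * e ^ 2)
  M_pos : 1 ≤ M
  run : ∀ (N : Set Plane) (a : Start k), 1 ≤ κ → a.Good κ → Nice N a → ∀ s : ℕ,
    energy N a κ s ≤ e → (∀ j < M, Success N a κ ε (s + j)) →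
      ∃ n : ℕ, s < k * n ∧ k * n ≤ s + M ∧ gap N a κ (k * n) ≤ 6 ∧
        moveLevel N a s + κ + 1 ≤ moveLevel N a (k * n)

/-- The order of choice matters. `p`, `ε`, `α` and `B` come from one step; `e` is such that the
energy contracts above it; `M` is the run length for this `e`; `ζ` is small depending on `M`. As `η
/ ζ = 1 / B` does not depend on `M`, there is no circularity. -/
theorem exists_driftParams {k : ℕ} [NeZero k] (κ : ℕ) {lam : ℝ} (hlam : 0 < lam) :
    Nonempty (DriftParams k κ lam) := by
  have hk := one_le_card (k := k)
  have hlp : 0 < lam * Real.pi := mul_pos hlam Real.pi_pos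
  have hexp : ∀ {t : ℝ}, 0 < t → Real.exp (-t) < 1 := fun ht =>
    (Real.exp_lt_exp.2 (by linarith)).trans_eq Real.exp_zero
  obtain ⟨p, hp⟩ : ∃ p, p = (1 - Real.exp (-(lam * (Real.pi * (3 / 5) ^ 2)))) / 2 := ⟨_, rfl⟩
  have h1 : Real.exp (-(lam * (Real.pi * (3 / 5) ^ 2))) < 1 := hexp (by
    have := Real.pi_pos
    positivity)
  have h2 := Real.exp_pos (-(lam * (Real.pi * (3 / 5) ^ 2)))
  have hp0 : 0 < p := by rw [hp]; linarith
  have hp1 : p ≤ 1 := by rw [hp]; linarith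
  obtain ⟨ε, hε⟩ : ∃ ε, ε = min 1 (5 * p / (6 * lam)) := ⟨_, rfl⟩
  have hε0 : 0 < ε := by rw [hε]; positivity
  have hε1 : ε ≤ 1 := by rw [hε]; exact min_le_left _ _
  have hεp : lam * (6 / 5 * ε) ≤ p := by
    have : ε ≤ 5 * p / (6 * lam) := by rw [hε]; exact min_le_right _ _
    rw [le_div_iff₀ (by positivity)] at this
    linarith
  obtain ⟨F, hF⟩ : ∃ F, F = (4 * k : ℝ) ^ (4 * k) := ⟨_, rfl⟩
  have hF1 : 1 ≤ F := by rw [hF]; exact one_le_pow₀ (by linarith)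
  obtain ⟨α, hα⟩ : ∃ α, α = lam * Real.pi / (400 * (F * k) ^ 2) := ⟨_, rfl⟩
  have hα0 : 0 < α := by rw [hα]; positivity
  obtain ⟨B, hB⟩ : ∃ B, B = Real.exp (α * (F * (k * 12)) ^ 2) +
    (1 + (1 - Real.exp (-(lam * Real.pi / 5)))⁻¹) := ⟨_, rfl⟩
  have hB0 : 0 < B := by
    have h3 : Real.exp (-(lam * Real.pi / 5)) < 1 := hexp (by linarith)
    have h4 : 0 ≤ (1 - Real.exp (-(lam * Real.pi / 5)))⁻¹ := inv_nonneg.2 (by linarith)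
    rw [hB]
    positivity
  have hν : Real.exp (-(α * ε)) < 1 := hexp (by positivity)
  have hδ : 0 < p * (1 - Real.exp (-(α * ε))) := mul_pos hp0 (by linarith)
  obtain ⟨δ, hδ'⟩ : ∃ δ, δ = p * (1 - Real.exp (-(α * ε))) := ⟨_, rfl⟩
  rw [← hδ'] at hδ
  -- The second summand gives `α * e ≥ 6 * B / δ`, hence `exp (α * e ^ 2) ≥ 6 * B / δ`, which is
  -- `V_large` for `η = ζ / B`.
  obtain ⟨e, he⟩ : ∃ e, e = F * (k * 12) + 6 * B / (δ * α) := ⟨_, rfl⟩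
  have he0 : F * (k * 12) ≤ e := by
    have : 0 ≤ 6 * B / (δ * α) := by positivity
    linarith
  have he1 : 1 ≤ e := by nlinarith
  obtain ⟨M, hM, hrun⟩ := exists_run k κ hε0 hε1 (hF ▸ he0)
  have hK : 0 < (3 / p) ^ M := by positivity
  obtain ⟨ζ, hζ⟩ : ∃ ζ, ζ = 1 / (2 * (3 / p) ^ M) := ⟨_, rfl⟩
  have hζ0 : 0 < ζ := by rw [hζ]; positivity
  refine ⟨⟨p, ε, α, e, ζ, ζ / B, B, max (1 - ζ) (1 - p * (1 - Real.exp (-(α * ε))) / 2), M,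
    hp0, hp1, by rw [hp]; ring, hε0, hε1, hεp, hα0, ?_, by rw [hB, hF], hF ▸ he0, hζ0, ?_,
    by positivity, ?_, ?_, le_max_left _ _, le_max_right _ _, ?_, hM, hrun⟩⟩
  · rw [← hF, hα]
    have : (F * k) ^ 2 ≠ 0 := by positivity
    field_simp
    exact le_rfl
  · rw [hζ]
    field_simp
    exact le_rfl
  · field_simp
  · rw [← hδ']
    exact max_lt (by linarith) (by linarith)
  · rw [← hδ']
    have h3 : 6 * B / δ ≤ Real.exp (α * e ^ 2) := by
      have h4 : α * e ^ 2 + 1 ≤ Real.exp (α * e ^ 2) := Real.add_one_le_exp _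
      have h5 : 6 * B / (δ * α) ≤ e := by
        have : 0 ≤ F * (k * 12) := by positivity
        linarith
      have h6 : 6 * B / δ = α * (6 * B / (δ * α)) := by
        field_simp
      rw [h6]
      have h7 : α * e ≤ α * e ^ 2 := mul_le_mul_of_nonneg_left (by nlinarith) hα0.le
      have h8 := mul_le_mul_of_nonneg_left h5 hα0.le
      linarith
    rw [div_le_iff₀ hδ] at h3
    have h7 : ζ / B * δ * Real.exp (α * e ^ 2) = ζ * (Real.exp (α * e ^ 2) * δ) / B := by
      field_simp
    rw [h7, le_div_iff₀ hB0]
    nlinarith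

section Potential

variable {k : ℕ} [NeZero k] {κ : ℕ} {lam : ℝ} (Θ : DriftParams k κ lam) {a : Start k}

/-- The current run of successes and the number of completed runs. -/
def DriftParams.run' (N : Set Plane) (a : Start k) (n : ℕ) : ℕ × ℕ :=
  streak N a κ Θ.ε Θ.e Θ.M n

/-- The exponential of the squared energy. -/
def DriftParams.expEnergy (N : Set Plane) (a : Start k) (n : ℕ) : ℝ :=
  Real.exp (Θ.α * energy N a κ n ^ 2)

/-- The potential of the state after `n` steps. -/
def DriftParams.pot (N : Set Plane) (a : Start k) (n : ℕ) : ℝ :=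
  (1 / 2) ^ (Θ.run' N a n).2 *
    (1 - Θ.ζ * (3 / Θ.p) ^ (Θ.run' N a n).1 + Θ.η * Θ.expEnergy N a n)

theorem DriftParams.one_le_K : 1 ≤ 3 / Θ.p := by
  rw [le_div_iff₀ Θ.p_pos]
  linarith [Θ.p_le]

theorem DriftParams.ζK_le {s : ℕ} (hs : s ≤ Θ.M) : Θ.ζ * (3 / Θ.p) ^ s ≤ 1 / 2 :=
  (mul_le_mul_of_nonneg_left (pow_le_pow_right₀ Θ.one_le_K hs) Θ.ζ_pos.le).trans Θ.ζ_le

theorem DriftParams.ζ_le_half : Θ.ζ ≤ 1 / 2 := by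
  have := Θ.ζK_le (Nat.zero_le _)
  simpa using this

theorem DriftParams.pot_ge (N : Set Plane) (n : ℕ) :
    (1 / 2) ^ ((Θ.run' N a n).2 + 1) ≤ Θ.pot N a n := by
  unfold pot
  rw [pow_succ]
  refine mul_le_mul_of_nonneg_left ?_ (by positivity)
  have h1 := Θ.ζK_le (streak_lt (N := N) (a := a) (κ := κ) (ε := Θ.ε) (e := Θ.e) Θ.M_pos n).le
  have h2 : 0 < Θ.η * Θ.expEnergy N a n := mul_pos Θ.η_pos (Real.exp_pos _)
  unfold run'
  linarith

/-- The factor of the potential after a success. -/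
def DriftParams.runFactor (N : Set Plane) (a : Start k) (n : ℕ) : ℝ :=
  open Classical in
  if energy N a κ n ≤ Θ.e then (3 / Θ.p) ^ ((Θ.run' N a n).1 + 1) else 1

theorem DriftParams.one_le_runFactor (N : Set Plane) (n : ℕ) : 1 ≤ Θ.runFactor N a n := by
  unfold runFactor
  split_ifs
  · exact one_le_pow₀ Θ.one_le_K
  · exact le_rfl

theorem DriftParams.runFactor_le (N : Set Plane) (n : ℕ) :
    Θ.ζ * Θ.runFactor N a n ≤ 1 / 2 := by
  unfold runFactor
  split_ifs
  · exact Θ.ζK_le (streak_lt (N := N) (a := a) (κ := κ) (ε := Θ.ε) (e := Θ.e) Θ.M_pos n)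
  · simpa using Θ.ζ_le_half

/-- Completing a run gives up its reward but halves the prefactor, and this is enough because every
reward is at most `1 / 2`. The two values of `σ` cover a step that is known to be a success and a
step about which nothing is known. -/
theorem DriftParams.pot_succ_le (N : Set Plane) (n : ℕ) {σ : ℝ}
    (hσ : σ = 1 ∨ (σ = Θ.runFactor N a n ∧ Success N a κ Θ.ε n)) :
    Θ.pot N a (n + 1) ≤ (1 / 2) ^ (Θ.run' N a n).2 * (1 - Θ.ζ * σ) +
      (1 / 2) ^ (Θ.run' N a n).2 * Θ.η * Θ.expEnergy N a (n + 1) := by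
  have hζ := Θ.ζ_pos
  have hζ2 := Θ.ζ_le_half
  have hσ2 : Θ.ζ * σ ≤ 1 / 2 := by
    rcases hσ with rfl | ⟨rfl, -⟩
    · simpa using hζ2
    · exact Θ.runFactor_le N n
  have hV : 0 < Θ.η * Θ.expEnergy N a (n + 1) := mul_pos Θ.η_pos (Real.exp_pos _)
  have hg : (0 : ℝ) < (1 / 2) ^ (Θ.run' N a n).2 := by positivity
  have hrun : Θ.run' N a (n + 1) = (open Classical in
    if Success N a κ Θ.ε n ∧ energy N a κ n ≤ Θ.e then
      if (Θ.run' N a n).1 + 1 = Θ.M then (0, (Θ.run' N a n).2 + 1)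
      else ((Θ.run' N a n).1 + 1, (Θ.run' N a n).2)
    else (0, (Θ.run' N a n).2)) := rfl
  unfold pot
  rw [hrun]
  split_ifs with h1 h2
  · simp only [pow_succ, pow_zero]
    nlinarith [mul_pos hg hV, mul_pos hg hζ, mul_nonneg hg.le (sub_nonneg.2 hσ2)]
  · have h3 : σ ≤ (3 / Θ.p) ^ ((Θ.run' N a n).1 + 1) := by
      rcases hσ with rfl | ⟨rfl, -⟩
      · exact one_le_pow₀ Θ.one_le_K
      · unfold runFactor
        rw [if_pos h1.2]
    simp only
    nlinarith [mul_nonneg hg.le (mul_nonneg hζ.le (sub_nonneg.2 h3))]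
  · have h3 : σ = 1 := by
      rcases hσ with h | ⟨h, h'⟩
      · exact h
      · rw [h]
        unfold runFactor
        rw [if_neg fun h2 => h1 ⟨h', h2⟩]
    rw [h3]
    simp only [pow_zero]
    exact le_of_eq (by ring)

/-- At low energy a success multiplies the reward by `3 / p`, so its contribution with weight `p` is
three times the present reward. This pays for the reset after a failure, the constant `η * B = ζ`
and the factor `γ`. At high energy no run is in progress, and the mean drop of the exponential term
is at least `6 * ζ`. -/
theorem DriftParams.drift {N : Set Plane} (hN : Nice N a) (hκ : 1 ≤ κ) (ha : a.Good κ) (n : ℕ) :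
    Θ.p * (1 - Θ.ζ * Θ.runFactor N a n + Θ.η * (Real.exp (-(Θ.α * Θ.ε)) * Θ.expEnergy N a n)) +
      (1 - Θ.p) * (1 - Θ.ζ + Θ.η * Θ.expEnergy N a n) + Θ.η * Θ.B ≤
    Θ.γ * (1 - Θ.ζ * (3 / Θ.p) ^ (Θ.run' N a n).1 + Θ.η * Θ.expEnergy N a n) := by
  have hζ := Θ.ζ_pos
  have hp := Θ.p_pos
  have hp1 := Θ.p_le
  have hη := Θ.η_pos
  have hγ1 := Θ.γ_ζ
  have hγ2 := Θ.γ_drift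
  have hs := Θ.ζK_le (streak_lt (N := N) (a := a) (κ := κ) (ε := Θ.ε) (e := Θ.e) Θ.M_pos n).le
  have hV0 : 0 < Θ.expEnergy N a n := Real.exp_pos _
  have hηV := mul_pos hη hV0
  have hν : Real.exp (-(Θ.α * Θ.ε)) ≤ 1 :=
    Real.exp_le_one_iff.2 (by nlinarith [mul_pos Θ.α_pos Θ.ε_pos])
  have hδ : 0 ≤ Θ.p * (1 - Real.exp (-(Θ.α * Θ.ε))) := mul_nonneg hp.le (by linarith)
  rw [Θ.η_B]
  by_cases he : energy N a κ n ≤ Θ.e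
  · unfold runFactor
    rw [if_pos he, pow_succ]
    change Θ.ζ * (3 / Θ.p) ^ (Θ.run' N a n).1 ≤ 1 / 2 at hs
    have hK : 1 ≤ (3 / Θ.p) ^ (Θ.run' N a n).1 := one_le_pow₀ Θ.one_le_K
    set K := (3 / Θ.p) ^ (Θ.run' N a n).1
    have h3 : Θ.p * (Θ.ζ * (K * (3 / Θ.p))) = 3 * (Θ.ζ * K) := by field_simp
    have h4 : Θ.ζ ≤ Θ.ζ * K := le_mul_of_one_le_right hζ.le hK
    have h5 : (1 - Θ.ζ) * (1 - Θ.ζ * K) ≤ Θ.γ * (1 - Θ.ζ * K) :=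
      mul_le_mul_of_nonneg_right hγ1 (by linarith)
    have h6 : (1 - Θ.p * (1 - Real.exp (-(Θ.α * Θ.ε))) / 2) * (Θ.η * Θ.expEnergy N a n) ≤
        Θ.γ * (Θ.η * Θ.expEnergy N a n) := mul_le_mul_of_nonneg_right hγ2 hηV.le
    have h7 : 0 ≤ Θ.p * (1 - Real.exp (-(Θ.α * Θ.ε))) * (Θ.η * Θ.expEnergy N a n) :=
      mul_nonneg hδ hηV.le
    have h8 : 0 ≤ Θ.p * Θ.ζ := by positivity
    have h9 : Θ.p * Θ.ζ ≤ Θ.ζ := mul_le_of_le_one_left hζ.le hp1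
    have h10 : 0 ≤ Θ.ζ * (Θ.ζ * K) := by positivity
    nlinarith
  · have hs0 : (Θ.run' N a n).1 = 0 := by
      by_contra h0
      exact he (hN.energy_le_of_streak hκ ha Θ.ε_pos Θ.ε_le Θ.e_le h0)
    unfold runFactor
    rw [if_neg he, hs0, pow_zero]
    have hV : Real.exp (Θ.α * Θ.e ^ 2) ≤ Θ.expEnergy N a n := by
      have he0 : 0 ≤ Θ.e := le_trans (by positivity) Θ.e_le
      refine Real.exp_le_exp.2 (mul_le_mul_of_nonneg_left ?_ Θ.α_pos.le)
      exact pow_le_pow_left₀ he0 (not_le.1 he).le 2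
    have h5 : (1 - Θ.ζ) * (1 - Θ.ζ) ≤ Θ.γ * (1 - Θ.ζ) :=
      mul_le_mul_of_nonneg_right hγ1 (by linarith [Θ.ζ_le_half])
    have h6 : (1 - Θ.p * (1 - Real.exp (-(Θ.α * Θ.ε))) / 2) * (Θ.η * Θ.expEnergy N a n) ≤
        Θ.γ * (Θ.η * Θ.expEnergy N a n) := mul_le_mul_of_nonneg_right hγ2 hηV.le
    have h7 : 6 * Θ.ζ ≤ Θ.p * (1 - Real.exp (-(Θ.α * Θ.ε))) * (Θ.η * Θ.expEnergy N a n) := by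
      refine Θ.V_large.trans ?_
      have := mul_le_mul_of_nonneg_left hV (mul_nonneg hη.le hδ)
      linarith
    nlinarith [sq_nonneg Θ.ζ]

/-- A lower bound for the probability of `A` suffices because the smaller value is taken on `A`. -/
theorem lintegral_ite_le {Ω : Type*} [MeasurableSpace Ω] {P : Measure Ω} [IsProbabilityMeasure P]
    {A : Set Ω} [∀ ω, Decidable (ω ∈ A)] (hA : MeasurableSet A) {p x y : ℝ} (hp : p ≤ P.real A)
    (hx : 0 ≤ x) (hxy : x ≤ y) :
    ∫⁻ ω, ENNReal.ofReal (if ω ∈ A then x else y) ∂P ≤ ENNReal.ofReal (p * x + (1 - p) * y) := by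
  have hy : 0 ≤ y := hx.trans hxy
  have h1 : ∀ ω, ENNReal.ofReal (if ω ∈ A then x else y) =
      (if ω ∈ A then ENNReal.ofReal x else 0) + if ω ∈ Aᶜ then ENNReal.ofReal y else 0 := by
    intro ω
    by_cases h : ω ∈ A <;> simp [h]
  simp only [h1]
  rw [lintegral_add_left (f := fun ω => if ω ∈ A then ENNReal.ofReal x else 0)
    (Measurable.ite hA measurable_const measurable_const), lintegral_ite_const hA, lintegral_ite_const hA.compl, ← ofReal_measureReal (s := A),
    ← ofReal_measureReal (s := Aᶜ), ← ENNReal.ofReal_mul hx, ← ENNReal.ofReal_mul hy,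
    ← ENNReal.ofReal_add (by positivity) (by positivity), probReal_compl_eq_one_sub hA]
  refine ENNReal.ofReal_le_ofReal ?_
  nlinarith

variable {L : Measure Conf} [IsProbabilityMeasure L]

/-- With the first `n` steps frozen, `c'` falls in the success set with probability at least `p`;
there the run goes on (at low energy) and the exponential energy contracts. All other contributions
integrate to at most `B`, and the outcome is the left side of `drift`. -/
theorem DriftParams.lintegral_pot_resample_le (hL : IsPoissonProcess L lam (fun c : Conf => c.1))
    (hlam : 0 < lam) (hκ : 1 ≤ κ) (ha : a.Good κ) (hX : LocFin a.extra) {n : ℕ} {c : Conf}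
    (hc : c ∈ stepAlive a n) (hN : Nice c.1 a)
    (hN' : ∀ᵐ c' ∂L, Nice (resample (stepZone a n) (c, c')).1 a) :
    ∫⁻ c', ENNReal.ofReal (Θ.pot (resample (stepZone a n) (c, c')).1 a (n + 1)) ∂L ≤
      ENNReal.ofReal Θ.γ * ENNReal.ofReal (Θ.pot c.1 a n) := by
  classical
  obtain ⟨i, hi⟩ := exists_isMoving (pos c.1 a n)
  set x := pos c.1 a n i
  set D := wideGap c.1 a κ n
  set β := Θ.α * ((4 * k : ℝ) ^ (4 * k) * k) ^ 2
  set S := successSet c.1 a κ Θ.ε n x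
  set V := Θ.expEnergy c.1 a n with hV
  set σ := Θ.runFactor c.1 a n
  set ν := Real.exp (-(Θ.α * Θ.ε))
  set g : ℝ := (1 / 2) ^ (Θ.run' c.1 a n).2
  set b := Real.exp (Θ.α * ((4 * k : ℝ) ^ (4 * k) * (k * 12)) ^ 2) with hb
  have hS : MeasurableSet S := measurableSet_successSet _ _ _ _ _ _
  have hg : 0 < g := by positivity
  have hη := Θ.η_pos
  have hζ := Θ.ζ_pos
  have hV0 : 0 < V := Real.exp_pos _
  have hν0 : 0 < ν := Real.exp_pos _
  have hσ2 : Θ.ζ * σ ≤ 1 / 2 := Θ.runFactor_le c.1 n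
  have hζ2 := Θ.ζ_le_half
  have hB1 : 0 ≤ 1 + (1 - Real.exp (-(lam * Real.pi / 5)))⁻¹ := by
    have : Real.exp (-(lam * Real.pi / 5)) ≤ 1 := Real.exp_le_one_iff.2 (by
      have := mul_pos hlam Real.pi_pos
      linarith)
    have : 0 ≤ (1 - Real.exp (-(lam * Real.pi / 5)))⁻¹ := inv_nonneg.2 (by linarith)
    linarith
  have hpt : ∀ᵐ c' ∂L, ENNReal.ofReal (Θ.pot (resample (stepZone a n) (c, c')).1 a (n + 1)) ≤
      ENNReal.ofReal (if c' ∈ S then g * (1 - Θ.ζ * σ + Θ.η * (ν * V))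
        else g * (1 - Θ.ζ + Θ.η * V)) +
      ENNReal.ofReal (g * Θ.η) * (ENNReal.ofReal b + tail x D β c') := by
    filter_upwards [hN'] with c' hc'
    have hs := sameSteps_resample hX hc c'
    have hen := exp_energy_resample_le hκ ha hX hc hc' hi Θ.ε_pos Θ.ε_le Θ.α_pos
    have hsucc := success_of_mem (ε := Θ.ε) hκ ha hX hc hc' hi
    set N' := (resample (stepZone a n) (c, c')).1
    have hrun : Θ.run' N' a n = Θ.run' c.1 a n := hs.streak le_rfl
    have hfac : Θ.runFactor N' a n = σ := by
      unfold runFactor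
      rw [hs.energy le_rfl, hrun]
      rfl
    have h1 := Θ.pot_succ_le (a := a) N' n (σ := if c' ∈ S then σ else 1) (by
      split_ifs with h
      · exact Or.inr ⟨hfac.symm, hsucc h⟩
      · exact Or.inl rfl)
    rw [hrun] at h1
    have h2 : (0 : ℝ) ≤ g * (1 - Θ.ζ * if c' ∈ S then σ else 1) := by
      refine mul_nonneg hg.le ?_
      split_ifs <;> linarith
    have hE0 : 0 ≤ Θ.expEnergy N' a (n + 1) := (Real.exp_pos _).le
    calc ENNReal.ofReal (Θ.pot N' a (n + 1)) ≤
        ENNReal.ofReal (g * (1 - Θ.ζ * if c' ∈ S then σ else 1)) +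
          ENNReal.ofReal (g * Θ.η) * ENNReal.ofReal (Θ.expEnergy N' a (n + 1)) := by
          rw [← ENNReal.ofReal_mul (by positivity), ← ENNReal.ofReal_add h2
            (mul_nonneg (by positivity) hE0)]
          exact ENNReal.ofReal_le_ofReal h1
      _ ≤ ENNReal.ofReal (g * (1 - Θ.ζ * if c' ∈ S then σ else 1)) +
          ENNReal.ofReal (g * Θ.η) * (ENNReal.ofReal ((if c' ∈ S then ν else 1) * V) +
            (ENNReal.ofReal b + tail x D β c')) := by
          gcongr
          exact hen
      _ = _ := by
          rw [mul_add, ← add_assoc, ← ENNReal.ofReal_mul (by positivity),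
            ← ENNReal.ofReal_add h2 (by split_ifs <;> positivity)]
          congr 2
          split_ifs <;> ring
  refine (lintegral_mono_ae hpt).trans ?_
  rw [lintegral_add_left (by
      exact ENNReal.measurable_ofReal.comp (Measurable.ite hS measurable_const measurable_const)),
    lintegral_const_mul' _ _ ENNReal.ofReal_ne_top, lintegral_add_left measurable_const,
    lintegral_const, measure_univ, mul_one]
  have hx0 : 0 ≤ g * (1 - Θ.ζ * σ + Θ.η * (ν * V)) :=
    mul_nonneg hg.le (by nlinarith [mul_pos hη (mul_pos hν0 hV0)])
  have hxy : g * (1 - Θ.ζ * σ + Θ.η * (ν * V)) ≤ g * (1 - Θ.ζ + Θ.η * V) := by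
    have h1 : Θ.ζ ≤ Θ.ζ * σ := le_mul_of_one_le_right hζ.le (Θ.one_le_runFactor c.1 n)
    have h2 : ν ≤ 1 := Real.exp_le_one_iff.2 (by nlinarith [mul_pos Θ.α_pos Θ.ε_pos])
    have h3 : Θ.η * (ν * V) ≤ Θ.η * V :=
      mul_le_mul_of_nonneg_left (mul_le_of_le_one_left hV0.le h2) hη.le
    exact mul_le_mul_of_nonneg_left (by linarith) hg.le
  refine (add_le_add (lintegral_ite_le hS (le_measure_successSet hL hlam Θ.ε_pos Θ.p_eq Θ.ε_p c.1 n x)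
    hx0 hxy) (mul_le_mul_right (add_le_add_right (lintegral_tail_le hL hlam x
      (six_le_wideGap n) Θ.α_le) _) _)).trans ?_
  have hp1 := Θ.p_le
  have hp0 := Θ.p_pos
  have hy0 := hx0.trans hxy
  have hγ : 0 ≤ Θ.γ := by linarith [Θ.γ_ζ]
  rw [← ENNReal.ofReal_add (Real.exp_pos _).le hB1, ← ENNReal.ofReal_mul (by positivity),
    ← ENNReal.ofReal_add (add_nonneg (by positivity) (mul_nonneg (by linarith) hy0))
      (mul_nonneg (by positivity) (add_nonneg (Real.exp_pos _).le hB1)), ← ENNReal.ofReal_mul hγ]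
  refine ENNReal.ofReal_le_ofReal ?_
  have hd := mul_le_mul_of_nonneg_left (Θ.drift hN hκ ha n) hg.le
  rw [Θ.B_eq, ← hb] at hd
  have hpot : Θ.pot c.1 a n =
    g * (1 - Θ.ζ * (3 / Θ.p) ^ (Θ.run' c.1 a n).1 + Θ.η * V) := rfl
  rw [hpot]
  refine le_trans (le_of_eq ?_) (hd.trans (le_of_eq ?_))
  · ring
  · ring

end Potential

section GoodSteps

variable {k : ℕ} [NeZero k] {κ : ℕ} {lam : ℝ} {a : Start k}
  {L : Measure Conf} [IsProbabilityMeasure L]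

theorem Nice.mem_stepAlive {c : Conf} (hN : Nice c.1 a) (hκ : 1 ≤ κ) (ha : a.Good κ) (n : ℕ) :
    c ∈ stepAlive a n := fun j _ => hN.hasCand hκ ha j

/-- A property that holds almost surely still does after resampling. -/
theorem ae_resample (hL : IsPoissonProcess L lam (fun c : Conf => c.1)) {Z : Conf → Set Plane}
    {Q : Type*} [MeasurableSpace Q] [Countable Q] [MeasurableSingletonClass Q]
    (h : Explorable Z Q) {q : Conf → Prop}
    (hq : ∀ᵐ c ∂L, q c) : ∀ᵐ c ∂L, ∀ᵐ c' ∂L, q (resample Z (c, c')) := by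
  rw [← h.map_resample hL] at hq
  exact Measure.ae_ae_of_ae_prod (ae_of_ae_map h.measurable_resample.aemeasurable hq)

/-- Only an inequality is claimed; it holds for arbitrary functions, so `f` need not be shown
measurable. -/
theorem lintegral_resample_le (hL : IsPoissonProcess L lam (fun c : Conf => c.1))
    {Z : Conf → Set Plane} {Q : Type*} [MeasurableSpace Q] [Countable Q]
    [MeasurableSingletonClass Q] (h : Explorable Z Q)
    (f : Conf → ENNReal) : ∫⁻ c, f c ∂L ≤ ∫⁻ c, ∫⁻ c', f (resample Z (c, c')) ∂L ∂L := by
  calc ∫⁻ c, f c ∂L = ∫⁻ c, f c ∂((L.prod L).map (resample Z)) := by rw [h.map_resample hL]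
    _ ≤ ∫⁻ p, f (resample Z p) ∂(L.prod L) := lintegral_map_le _ _
    _ ≤ _ := lintegral_prod_le _

theorem DriftParams.lintegral_pot_succ_le (Θ : DriftParams k κ lam)
    (hL : IsPoissonProcess L lam (fun c : Conf => c.1)) (hlam : 0 < lam) (hκ : 1 ≤ κ)
    (ha : a.Good κ) (hH : MeasurableSet a.hist) (hX : a.extra.encard ≤ k) (n : ℕ) :
    ∫⁻ c, ENNReal.ofReal (Θ.pot c.1 a (n + 1)) ∂L ≤
      ENNReal.ofReal Θ.γ * ∫⁻ c, ENNReal.ofReal (Θ.pot c.1 a n) ∂L := by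
  have hXl : LocFin a.extra := locFin_of_finite (finite_of_encard_le_coe hX)
  have hn := ae_nice (a := a) hL hlam hX
  refine (lintegral_resample_le hL (stepExplorable hH hXl n) _).trans ?_
  rw [← lintegral_const_mul' _ _ ENNReal.ofReal_ne_top]
  refine lintegral_mono_ae ?_
  filter_upwards [hn, ae_resample hL (stepExplorable hH hXl n) hn] with c h1 h2
  exact Θ.lintegral_pot_resample_le hL hlam hκ ha hXl (h1.mem_stepAlive hκ ha n) h1 h2

/-- The bound on the initial potential. -/
def DriftParams.initial (Θ : DriftParams k κ lam) : ℝ :=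
  1 + Θ.η * Real.exp (Θ.α * ((4 * k : ℝ) ^ (4 * k) * (k * κ)) ^ 2)

theorem DriftParams.initial_pos (Θ : DriftParams k κ lam) : 0 < Θ.initial :=
  add_pos zero_lt_one (mul_pos Θ.η_pos (Real.exp_pos _))

theorem DriftParams.pot_zero_le (Θ : DriftParams k κ lam) (N : Set Plane) (ha : a.Good κ) :
    Θ.pot N a 0 ≤ Θ.initial := by
  have h0 : Θ.run' N a 0 = (0, 0) := rfl
  have hg : gap N a κ 0 = κ := by
    unfold gap
    change level a.pts + κ - level a.pts = κ
    ring
  have h1 := energy_le (N := N) ha 0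
  rw [hg] at h1
  have h2 : Θ.expEnergy N a 0 ≤ Real.exp (Θ.α * ((4 * k : ℝ) ^ (4 * k) * (k * κ)) ^ 2) := by
    refine Real.exp_le_exp.2 (mul_le_mul_of_nonneg_left ?_ Θ.α_pos.le)
    exact pow_le_pow_left₀ (energy_nonneg ha 0) h1 2
  have h3 := mul_le_mul_of_nonneg_left h2 Θ.η_pos.le
  unfold pot initial
  rw [h0]
  simp only [pow_zero]
  linarith [Θ.ζ_pos]

theorem DriftParams.lintegral_pot_le (Θ : DriftParams k κ lam)
    (hL : IsPoissonProcess L lam (fun c : Conf => c.1)) (hlam : 0 < lam) (hκ : 1 ≤ κ)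
    (ha : a.Good κ) (hH : MeasurableSet a.hist) (hX : a.extra.encard ≤ k) (n : ℕ) :
    ∫⁻ c, ENNReal.ofReal (Θ.pot c.1 a n) ∂L ≤
      ENNReal.ofReal Θ.γ ^ n * ENNReal.ofReal Θ.initial := by
  induction n with
  | zero =>
    refine (lintegral_mono fun c => ENNReal.ofReal_le_ofReal (Θ.pot_zero_le c.1 ha)).trans ?_
    simp
  | succ n ih =>
    refine (Θ.lintegral_pot_succ_le hL hlam hκ ha hH hX n).trans ?_
    rw [pow_succ', mul_assoc]
    gcongr

theorem DriftParams.γ_nonneg (Θ : DriftParams k κ lam) : 0 ≤ Θ.γ := by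
  linarith [Θ.γ_ζ, Θ.ζ_le_half]

/-- The `J`-th good step comes early with high probability. -/
theorem DriftParams.measure_goodStep_gt_le (Θ : DriftParams k κ lam)
    (hL : IsPoissonProcess L lam (fun c : Conf => c.1)) (hlam : 0 < lam) (hκ : 6 ≤ κ)
    (ha : a.Good κ) (hH : MeasurableSet a.hist) (hX : a.extra.encard ≤ k) (J n : ℕ) :
    L {c | (n : ℕ∞) < goodStep κ c.1 a J} ≤
      ENNReal.ofReal (2 ^ J * (Θ.γ ^ n * Θ.initial)) := by
  have hκ1 : 1 ≤ κ := by omega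
  have hXl : LocFin a.extra := locFin_of_finite (finite_of_encard_le_coe hX)
  have := borelSpace_enat
  set E := {c : Conf | (n : ℕ∞) < goodStep κ c.1 a J}
  have hE : MeasurableSet E := measurableSet_lt measurable_const
    (measurable_goodStep (a := fun _ => a) countMeas_conf (fun c => c.2)
      (measStart_const hH hXl) (fun _ => ha) hκ1 J)
  have h1 : ENNReal.ofReal ((1 / 2) ^ J) * L E ≤
      ∫⁻ c, ENNReal.ofReal (Θ.pot c.1 a n) ∂L := by
    rw [← lintegral_indicator_const hE]
    refine lintegral_mono_ae ?_
    filter_upwards [ae_nice (a := a) hL hlam hX] with c hc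
    by_cases hcE : c ∈ E
    · rw [indicator_of_mem hcE]
      refine ENNReal.ofReal_le_ofReal (le_trans ?_ (Θ.pot_ge c.1 n))
      refine pow_le_pow_of_le_one (by norm_num) (by norm_num) ?_
      -- Each completed run provides a good step by time `n`, so fewer than `J` runs are completed
      -- on this event.
      by_contra! hlt
      have h2 := goodStep_streak_le hκ ha Θ.M_pos (Θ.run c.1 a hκ1 ha hc) n
      have h3 : goodStep κ c.1 a J ≤ goodStep κ c.1 a (Θ.run' c.1 a n).2 :=
        goodStep_mono (by omega)
      have h4 : ((n - (streak c.1 a κ Θ.ε Θ.e Θ.M n).1 : ℕ) : ℕ∞) ≤ n := by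
        exact_mod_cast Nat.sub_le _ _
      exact absurd (h3.trans (h2.trans h4)) (not_le.2 hcE)
    · rw [indicator_of_notMem hcE]
      exact zero_le
  have h2 := h1.trans (Θ.lintegral_pot_le hL hlam hκ1 ha hH hX n)
  have h3 : L E = ENNReal.ofReal (2 ^ J) * (ENNReal.ofReal ((1 / 2) ^ J) * L E) := by
    rw [← mul_assoc, ← ENNReal.ofReal_mul (by positivity), ← mul_pow]
    norm_num
  rw [h3, ENNReal.ofReal_mul (by positivity),
    ENNReal.ofReal_mul (pow_nonneg Θ.γ_nonneg _), ENNReal.ofReal_pow Θ.γ_nonneg]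
  gcongr

end GoodSteps

/-! ### Clusters of abscissas -/

/-- A bad scale `s` has a pair at a distance in `(s, C * s]`. These intervals are disjoint for
different `m`, so a pair spoils at most one scale, and there is one scale more than there are
ordered pairs. -/
theorem exists_scale {k : ℕ} (x : Fin k → ℝ) {C : ℝ} (hC : 1 < C) :
    ∃ m ≤ k * k, ∀ i j, |x i - x j| ≤ C * (1 / 4 * (1 / C) ^ m) →
      |x i - x j| ≤ 1 / 4 * (1 / C) ^ m := by
  by_contra! hcon
  have hcon' : ∀ m : Fin (k * k + 1), ∃ p : Fin k × Fin k,
      |x p.1 - x p.2| ≤ C * (1 / 4 * (1 / C) ^ (m : ℕ)) ∧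
        1 / 4 * (1 / C) ^ (m : ℕ) < |x p.1 - x p.2| := by
    intro m
    obtain ⟨i, j, h⟩ := hcon m (Nat.lt_succ_iff.1 m.2)
    exact ⟨(i, j), h⟩
  choose f hf using hcon'
  have key : ∀ m m' : Fin (k * k + 1), m < m' → f m ≠ f m' := by
    intro m m' hlt he
    have h1 := (hf m).2
    have h2 := (hf m').1
    rw [← he] at h2
    have h3 : C * (1 / 4 * (1 / C) ^ (m' : ℕ)) ≤ 1 / 4 * (1 / C) ^ (m : ℕ) := by
      have h4 : (1 / C) ^ (m' : ℕ) ≤ (1 / C) ^ ((m : ℕ) + 1) := by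
        refine pow_le_pow_of_le_one (by positivity) ?_ hlt
        rw [div_le_one (by linarith)]
        exact hC.le
      calc C * (1 / 4 * (1 / C) ^ (m' : ℕ)) ≤ C * (1 / 4 * (1 / C) ^ ((m : ℕ) + 1)) := by gcongr
        _ = _ := by
          rw [pow_succ]
          field_simp
    linarith
  obtain ⟨m, m', hne, he⟩ := Fintype.exists_ne_map_eq_of_card_lt f (by simp)
  rcases lt_or_gt_of_ne hne with h | h
  · exact key m m' h he
  · exact key m' m h he.symm

/-! ### Points near the top of a semi-ball. -/

section Geometry

variable {x z w m e : ℝ} {y : Plane}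

/-- A small disc just below the top of a semi-ball of radius `m`. -/
def topDisc (x w m e : ℝ) : Set Plane := Metric.ball !₂[x, w + m - e ^ 2] (e ^ 2 / 4)

theorem abs_of_mem_topDisc (hy : y ∈ topDisc x w m e) :
    |y 0 - x| ≤ e ^ 2 / 4 ∧ |y 1 - (w + m - e ^ 2)| ≤ e ^ 2 / 4 := by
  have h : dist y (!₂[x, w + m - e ^ 2]) < e ^ 2 / 4 := hy
  have h0 := abs_coord_le_dist y (!₂[x, w + m - e ^ 2]) 0
  have h1 := abs_coord_le_dist y (!₂[x, w + m - e ^ 2]) 1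
  simp at h0 h1
  exact ⟨h0.trans h.le, h1.trans h.le⟩

/-- Near the top, a horizontal offset of about `e` lowers the boundary by less than the depth of the
disc, which is at least `3 / 4 * e ^ 2`. The radius `1` is the worst case. -/
theorem mem_semiBall_of_topDisc (hm : 1 ≤ m) (he : 0 < e) (he4 : e ≤ 1 / 4)
    (hy : y ∈ topDisc x w m e) (hz : |x - z| ≤ e) :
    w + m - 1 < y 1 ∧ y ∈ semiBall !₂[z, w] m ∧ y ∈ semiBall !₂[z, w + m - 1] 1 := by
  obtain ⟨h0, h1⟩ := abs_of_mem_topDisc hy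
  have h2 := abs_le.1 h1
  have he2 : e ^ 2 ≤ 1 / 16 := by nlinarith
  have he2' : 0 < e ^ 2 := by positivity
  have h3 : |y 0 - z| ≤ 17 / 16 * e := by
    have := abs_sub_le (y 0) x z
    nlinarith
  have h4 : (y 0 - z) ^ 2 ≤ (17 / 16 * e) ^ 2 := sq_le_sq' (by linarith [(abs_le.1 h3).1])
    (abs_le.1 h3).2
  have h5 : w + m - 1 < y 1 := by linarith
  refine ⟨h5, ⟨?_, ?_⟩, ⟨?_, ?_⟩⟩
  · rw [Metric.mem_closedBall, dist_le_iff (by linarith)]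
    simp
    nlinarith
  · simp [upperHalf]
    linarith
  · rw [Metric.mem_closedBall, dist_le_iff (by linarith)]
    simp
    nlinarith
  · simp [upperHalf]
    linarith

/-- At a horizontal distance beyond `2 * m * e`, the boundary of the semi-ball has fallen by about
`2 * m * e ^ 2` or more, below the whole disc, whose depth is at most `5 / 4 * e ^ 2`. -/
theorem not_mem_semiBall_of_topDisc (hm : 1 ≤ m) (he : 0 < e) (he4 : e ≤ 1 / 4)
    (hy : y ∈ topDisc x w m e) (hz : 2 * m * e < |x - z|) : y ∉ semiBall !₂[z, w] m := by
  intro h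
  obtain ⟨h0, h1⟩ := abs_of_mem_topDisc hy
  have h2 := abs_le.1 h1
  have he2 : e ^ 2 ≤ 1 / 4 * e := by nlinarith
  have h3 : (2 * m - 1 / 16) * e ≤ |y 0 - z| := by
    have := abs_sub_le x (y 0) z
    rw [abs_sub_comm x (y 0)] at this
    nlinarith
  have h4 : ((2 * m - 1 / 16) * e) ^ 2 ≤ (y 0 - z) ^ 2 := by
    rw [← sq_abs (y 0 - z)]
    exact pow_le_pow_left₀ (by nlinarith) h3 2
  have h5 := h.1
  rw [Metric.mem_closedBall, dist_le_iff (by linarith)] at h5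
  simp at h5
  have h6 : m - 5 / 4 * e ^ 2 ≤ y 1 - w := by linarith
  have h7 : (m - 5 / 4 * e ^ 2) ^ 2 ≤ (y 1 - w) ^ 2 := pow_le_pow_left₀ (by nlinarith) h6 2
  nlinarith [sq_nonneg (e ^ 2), mul_pos he he, mul_nonneg (sub_nonneg.2 hm) (sub_nonneg.2 hm),
    mul_nonneg (sub_nonneg.2 hm) (mul_pos he he).le, mul_nonneg (mul_nonneg (sub_nonneg.2 hm)
      (sub_nonneg.2 hm)) (mul_pos he he).le]

theorem measurableSet_semiBall (c : Plane) (r : ℝ) : MeasurableSet (semiBall c r) :=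
  measurableSet_closedBall.inter (measurableSet_le measurable_const (measurable_coord 1))

theorem volume_real_semiBall_le (c : Plane) {r : ℝ} (hr : 0 ≤ r) :
    volume.real (semiBall c r) ≤ Real.pi * r ^ 2 := by
  have h : volume.real (Metric.closedBall c r) = volume.real (Metric.ball c r) := by
    rw [Measure.real, Measure.real, Measure.addHaar_closedBall_eq_addHaar_ball]
  rw [← volume_real_ball c hr, ← h]
  exact measureReal_mono inter_subset_left measure_closedBall_lt_top.ne

end Geometry

/-! ### A favourable pattern of points and its probability. -/

section Pattern

variable {lam : ℝ} {k : ℕ}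

/-- Every semi-ball of radius `m`, and every semi-ball of radius `1` with the same top, contains
exactly one point. -/
def Pattern (x : Fin k → ℝ) (w m : ℝ) (S : Set Plane) : Prop :=
  ∀ j, ∃ y : Plane, w + m - 1 < y 1 ∧ S ∩ semiBall !₂[x j, w] m = {y} ∧
    y ∈ semiBall !₂[x j, w + m - 1] 1

/-- Being within `e` is transitive, since no distance lies between `e` and `2 * m * e`, and its
classes are the clusters. A point in the disc of a representative belongs to all the semi-balls of
its cluster and to no other. -/
theorem exists_pattern_set (x : Fin k → ℝ) (w : ℝ) {m : ℝ} (hm : 1 ≤ m) {e : ℝ} (he : 0 < e)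
    (he4 : e ≤ 1 / 4) (hsc : ∀ i j, |x i - x j| ≤ 2 * m * e → |x i - x j| ≤ e) :
    ∃ (ι : Type) (_ : Fintype ι) (r : ι → Fin k), Fintype.card ι ≤ k ∧
      (Pairwise fun q q' => Disjoint (topDisc (x (r q)) w m e) (topDisc (x (r q')) w m e)) ∧
      ∀ S : Set Plane, (∀ q, (S ∩ topDisc (x (r q)) w m e).encard = 1) →
        (S ∩ ((⋃ j, semiBall !₂[x j, w] m) \ ⋃ q, topDisc (x (r q)) w m e) = ∅) →
        Pattern x w m S := by
  classical
  let s : Setoid (Fin k) :=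
    { r := fun i j => |x i - x j| ≤ e
      iseqv := ⟨fun i => by simpa using he.le, fun {i j} h => by rwa [abs_sub_comm],
        fun {i j l} h h' => hsc i l (by
          have := abs_sub_le (x i) (x j) (x l)
          nlinarith)⟩ }
  have hrel : ∀ i j, s.r i j ↔ |x i - x j| ≤ e := fun _ _ => Iff.rfl
  have hfar : ∀ q q' : Quotient s, q ≠ q' → 2 * m * e < |x q.out - x q'.out| := by
    intro q q' hne
    by_contra! hle
    refine hne ?_
    rw [← q.out_eq, ← q'.out_eq]
    exact Quotient.sound (hsc _ _ hle)
  have hcl : ∀ j, |x (Quotient.mk s j).out - x j| ≤ e := fun j => Quotient.mk_out (s := s) j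
  have hfar' : ∀ (q : Quotient s) (j : Fin k), q ≠ Quotient.mk s j →
      2 * m * e < |x q.out - x j| := by
    intro q j hne
    by_contra! hle
    refine hne ?_
    rw [← q.out_eq]
    exact Quotient.sound (hsc _ _ hle)
  refine ⟨Quotient s, inferInstance, fun q => q.out, ?_, ?_, ?_⟩
  · have := Fintype.card_quotient_le s
    simpa using this
  · intro q q' hne
    rw [Set.disjoint_left]
    intro y hy hy'
    obtain ⟨h0, -⟩ := abs_of_mem_topDisc hy
    obtain ⟨h0', -⟩ := abs_of_mem_topDisc hy'
    have h1 := hfar q q' hne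
    have h2 := abs_sub_le (x q.out) (y 0) (x q'.out)
    rw [abs_sub_comm (x q.out) (y 0)] at h2
    nlinarith
  · intro S hS hS0 j
    obtain ⟨y, hy⟩ := encard_eq_one.1 (hS (Quotient.mk s j))
    have hyS : y ∈ S ∩ topDisc (x (Quotient.mk s j).out) w m e := by
      rw [hy]
      exact mem_singleton y
    obtain ⟨h1, h2, h3⟩ := mem_semiBall_of_topDisc hm he he4 hyS.2 (hcl j)
    refine ⟨y, h1, ?_, h3⟩
    ext z
    rw [mem_singleton_iff]
    constructor
    · rintro ⟨hzS, hz⟩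
      by_cases hzd : z ∈ ⋃ q : Quotient s, topDisc (x q.out) w m e
      · obtain ⟨q, hq⟩ := mem_iUnion.1 hzd
        have hqj : q = Quotient.mk s j := by
          by_contra hne
          exact not_mem_semiBall_of_topDisc hm he he4 hq (hfar' q j hne) hz
        rw [hqj] at hq
        have : z ∈ S ∩ topDisc (x (Quotient.mk s j).out) w m e := ⟨hzS, hq⟩
        rw [hy] at this
        exact this
      · have : z ∈ S ∩ ((⋃ j, semiBall !₂[x j, w] m) \ ⋃ q : Quotient s, topDisc (x q.out) w m e) :=
          ⟨hzS, mem_iUnion.2 ⟨j, hz⟩, hzd⟩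
        rw [hS0] at this
        exact absurd this (notMem_empty z)
    · rintro rfl
      exact ⟨hyS.1, h2⟩

theorem isBounded_semiBall (c : Plane) (r : ℝ) : Bornology.IsBounded (semiBall c r) :=
  Metric.isBounded_closedBall.subset inter_subset_left

/-- Only finitely many scales are used, so the discs have radius bounded below uniformly in `x`;
there are at most `k` of them, and the semi-balls have total area at most `k * π * m ^ 2`.
Independence of the counts in disjoint sets gives the product bound. -/
theorem exists_pattern_prob (k : ℕ) {m : ℝ} (hm : 1 ≤ m) (hlam : 0 < lam) :
    ∃ p : ℝ, 0 < p ∧ p ≤ 1 ∧ ∀ (L : Measure Conf) [IsProbabilityMeasure L],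
      IsPoissonProcess L lam (fun c : Conf => c.1) → ∀ (x : Fin k → ℝ) (w : ℝ),
        ∃ S : Set Conf, MeasurableSet S ∧ p ≤ L.real S ∧ ∀ c ∈ S, Pattern x w m c.1 := by
  have hpi := Real.pi_pos
  obtain ⟨e0, he0⟩ : ∃ e0, e0 = 1 / 4 * (1 / (2 * m)) ^ (k * k) := ⟨_, rfl⟩
  have he0p : 0 < e0 := by rw [he0]; positivity
  obtain ⟨p1, hp1⟩ : ∃ p1, p1 = min 1 (Real.exp (-(lam * Real.pi)) *
    (lam * (Real.pi * (e0 ^ 2 / 4) ^ 2))) := ⟨_, rfl⟩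
  have hp1p : 0 < p1 := by rw [hp1]; positivity
  have hp11 : p1 ≤ 1 := by rw [hp1]; exact min_le_left _ _
  have hb1 : Real.exp (-(lam * (k * (Real.pi * m ^ 2)))) ≤ 1 :=
    Real.exp_le_one_iff.2 (neg_nonpos.2 (by positivity))
  refine ⟨Real.exp (-(lam * (k * (Real.pi * m ^ 2)))) * p1 ^ k, by positivity,
    mul_le_one₀ hb1 (by positivity) (pow_le_one₀ hp1p.le hp11), fun L _ hL x w => ?_⟩
  obtain ⟨j, hj, hsc⟩ := exists_scale x (show 1 < 2 * m by linarith)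
  set e := 1 / 4 * (1 / (2 * m)) ^ j with he
  have h2m : 1 / (2 * m) ≤ 1 := by
    rw [div_le_one (by linarith)]
    linarith
  have hep : 0 < e := by positivity
  have he4 : e ≤ 1 / 4 := by
    have : (1 / (2 * m)) ^ j ≤ 1 := pow_le_one₀ (by positivity) h2m
    linarith
  have hee : e0 ≤ e := by
    rw [he0, he]
    have : (1 / (2 * m)) ^ (k * k) ≤ (1 / (2 * m)) ^ j :=
      pow_le_pow_of_le_one (by positivity) h2m hj
    linarith
  obtain ⟨ι, _, r, hcard, hdisj, hpat⟩ := exists_pattern_set x w hm hep he4 hsc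
  set U : Set Plane := ⋃ j, semiBall !₂[x j, w] m with hU
  have hUm : MeasurableSet U := MeasurableSet.iUnion fun j => measurableSet_semiBall _ _
  have hUb : Bornology.IsBounded U :=
    (Bornology.isBounded_iUnion).2 fun j => isBounded_semiBall _ _
  have hUv : volume.real U ≤ k * (Real.pi * m ^ 2) := by
    refine (measureReal_iUnion_fintype_le _).trans ?_
    refine (Finset.sum_le_sum fun j _ => volume_real_semiBall_le _ (by linarith)).trans ?_
    simp
  let B : Option ι → Set Plane := fun o =>
    o.elim (U \ ⋃ q, topDisc (x (r q)) w m e) fun q => topDisc (x (r q)) w m e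
  let s : Option ι → Set ℕ∞ := fun o => o.elim {0} fun _ => {1}
  have hDm : ∀ q, MeasurableSet (topDisc (x (r q)) w m e) := fun q => measurableSet_ball
  have hBm : ∀ o, MeasurableSet (B o) := by
    rintro (_ | q)
    · exact hUm.diff (MeasurableSet.iUnion hDm)
    · exact hDm q
  have hBd : Pairwise fun o o' => Disjoint (B o) (B o') := by
    rintro (_ | q) (_ | q') hne
    · exact absurd rfl hne
    · exact disjoint_sdiff_left.mono_right (subset_iUnion (fun q => topDisc (x (r q)) w m e) q')
    · exact (disjoint_sdiff_left.mono_right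
        (subset_iUnion (fun q => topDisc (x (r q)) w m e) q)).symm
    · exact hdisj fun h => hne (by rw [h])
  have hind := iIndepFun_counts hL B hBm hBd
  have hsm : ∀ o, MeasurableSet (s o) := by
    have := borelSpace_enat
    rintro (_ | q)
    · exact measurableSet_singleton _
    · exact measurableSet_singleton _
  have hprod := hind.measure_inter_preimage_eq_mul Finset.univ (sets := s) fun o _ => hsm o
  have hone : ∀ q, p1 ≤ L.real ((fun c : Conf => (c.1 ∩ B (some q)).encard) ⁻¹' s (some q)) := by
    intro q
    have h1 := measure_encard_eq hL hlam (hDm q) Metric.isBounded_ball 1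
    have h2 : volume.real (topDisc (x (r q)) w m e) = Real.pi * (e ^ 2 / 4) ^ 2 :=
      volume_real_ball _ (by positivity)
    have h3 : (fun c : Conf => (c.1 ∩ B (some q)).encard) ⁻¹' s (some q) =
        {c : Conf | (c.1 ∩ topDisc (x (r q)) w m e).encard = (1 : ℕ)} := by
      ext c
      simp [B, s]
    rw [h3, Measure.real, h1, h2, ENNReal.toReal_ofReal (by positivity)]
    simp only [pow_one, Nat.factorial_one, Nat.cast_one, div_one]
    rw [hp1]
    refine (min_le_right _ _).trans (mul_le_mul (Real.exp_le_exp.2 (neg_le_neg ?_)) ?_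
      (by positivity) (by positivity))
    · have : (e ^ 2 / 4) ^ 2 ≤ 1 := by
        have : e ^ 2 / 4 ≤ 1 := by nlinarith
        exact pow_le_one₀ (by positivity) this
      have h5 : Real.pi * (e ^ 2 / 4) ^ 2 ≤ Real.pi := mul_le_of_le_one_right hpi.le this
      gcongr
    · gcongr
  have hzero : Real.exp (-(lam * (k * (Real.pi * m ^ 2)))) ≤
      L.real ((fun c : Conf => (c.1 ∩ B none).encard) ⁻¹' s none) := by
    have h3 : (fun c : Conf => (c.1 ∩ B none).encard) ⁻¹' s none =
        {c : Conf | c.1 ∩ (U \ ⋃ q, topDisc (x (r q)) w m e) = ∅} := by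
      ext c
      simp [B, s]
    rw [h3, Measure.real, measure_void hL hlam (hUm.diff (MeasurableSet.iUnion hDm))
      (hUb.subset sdiff_subset),
      ENNReal.toReal_ofReal (Real.exp_nonneg _)]
    refine Real.exp_le_exp.2 (neg_le_neg (mul_le_mul_of_nonneg_left ?_ hlam.le))
    exact (measureReal_mono sdiff_subset hUb.measure_lt_top.ne).trans hUv
  refine ⟨⋂ o ∈ Finset.univ, (fun c : Conf => (c.1 ∩ B o).encard) ⁻¹' s o, ?_, ?_, ?_⟩
  · exact MeasurableSet.biInter (Finset.countable_toSet _) fun o _ => measurable_count (hBm o) (hsm o)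
  · rw [Measure.real, hprod, Fintype.prod_option, ENNReal.toReal_mul, ENNReal.toReal_prod]
    refine mul_le_mul hzero ?_ (by positivity) ENNReal.toReal_nonneg
    calc p1 ^ k ≤ p1 ^ Fintype.card ι := pow_le_pow_of_le_one hp1p.le hp11 hcard
      _ = ∏ _q : ι, p1 := by rw [Finset.prod_const, Finset.card_univ]
      _ ≤ _ := Finset.prod_le_prod (fun _ _ => hp1p.le) fun q _ => hone q
  · intro c hc
    simp only [Finset.mem_univ, iInter_true, mem_iInter] at hc
    refine hpat c.1 (fun q => hc (some q)) ?_
    have := hc none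
    rw [← encard_eq_zero]
    exact this

end Pattern

/-! ### A renewal trial at each good step. -/

section Renewal

variable {k : ℕ} [NeZero k] {κ : ℕ} {a : Start k}

/-- `explored` is made of full balls and the history set of semi-balls, but above the current level
there is no difference. -/
theorem fresh_of_not_mem_hist {N : Set Plane} (ha : a.Good κ) {n : ℕ} {y : Plane}
    (hl : moveLevel N a n < y 1) (hy : y ∉ hist N a n) : Fresh N a n y := by
  refine ⟨hl, fun h' => hy (mem_hist_of_start ha.le_hist h' hl.le), fun h' => hy ?_⟩
  obtain ⟨j, hj, i', hi', hd⟩ := h'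
  refine (mem_hist_iff N a ha.le_hist).2 ⟨Or.inr ⟨j, hj, i', ?_, ?_⟩, hl.le⟩
  · rwa [← stepLen_eq N a hi']
  · rw [hi'.moveLevel_eq]
    exact (moveLevel_mono N a hj.le).trans hl.le

/-- No two points, the second one not being an extra or starting point, have ordinates that differ
by `κ`. -/
def NoShift (κ : ℕ) (N : Set Plane) (a : Start k) : Prop :=
  ∀ x ∈ N ∪ a.special, ∀ y ∈ N, y 1 ≠ x 1 + κ

theorem mem_hist_le {N : Set Plane} (ha : a.Good κ) (hκ : 1 ≤ κ) {n : ℕ} (hn : 1 ≤ n)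
    (hh : height (hist N a n) ≤ κ) {y : Plane} (hy : y ∈ hist N a n) :
    y 1 ≤ moveLevel N a n + κ := by
  obtain ⟨i, hi⟩ := exists_isMoving (pos N a n)
  obtain ⟨m, rfl⟩ : ∃ m, n = m + 1 := ⟨n - 1, by omega⟩
  have h1 := le_csSup (bddAbove_height N a ha.pts_close hκ ha.hist_strip (m + 1))
    ⟨_, pos_mem_hist N a m i, y, hy, rfl⟩
  rw [hi.moveLevel_eq] at h1
  unfold height at hh
  linarith

/-- The pattern points lie more than `κ` above the level, whereas the history set of a good step
does not; hence they are fresh and taken from `c'`. General position and `NoShift` exclude points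
exactly on the base lines of the two kinds of semi-balls, so all the tested points are fresh, and
the pattern allows no others. -/
theorem renewalEvent_of_pattern (hκ : 1 ≤ κ) (ha : a.Good κ) (hX : LocFin a.extra) {n J : ℕ}
    (hn : 1 ≤ n) {c c' : Conf} (hc : c ∈ stepAlive a n)
    (hN : Nice (resample (stepZone a n) (c, c')).1 a)
    (hs : NoShift κ (resample (stepZone a n) (c, c')).1 a)
    (hh : height (hist (resample (stepZone a n) (c, c')).1 a n) ≤ κ)
    (hg : goodStep κ (resample (stepZone a n) (c, c')).1 a J = n)
    (hp : Pattern (fun i => pos c.1 a n i 0) (moveLevel c.1 a n) (κ + 1) c'.1) :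
    RenewalEvent κ (resample (stepZone a n) (c, c')).1 a J := by
  have hss := sameSteps_resample hX hc c'
  have hmem := fun y hy => mem_resample_of_fresh hc (y := y) hy c'
  have hfr := fresh_resample_iff hX hc c'
  have hpos : pos (resample (stepZone a n) (c, c')).1 a n = pos c.1 a n := hss.pos le_rfl
  have hlev : moveLevel (resample (stepZone a n) (c, c')).1 a n = moveLevel c.1 a n :=
    hss.moveLevel le_rfl
  rw [← hpos, ← hlev] at hp
  set N := (resample (stepZone a n) (c, c')).1
  have hκ0 : (0 : ℝ) < κ := by exact_mod_cast hκ
  have hmem' : ∀ y, Fresh N a n y → (y ∈ N ↔ y ∈ c'.1) := fun y hy => hmem y ((hfr y).1 hy)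
  refine ⟨by rw [hg]; exact ENat.natCast_ne_top n, ?_⟩
  rw [hg, ENat.toNat_natCast]
  intro s i
  have hsp : s.pos = pos N a n := rfl
  have hsh : s.hist = hist N a n := rfl
  rw [hsp, hsh]
  obtain ⟨y, hy1, hy2, hy3⟩ := hp i
  have hdown : down (pos N a n) i = !₂[pos N a n i 0, moveLevel N a n] := rfl
  have hup : up κ (pos N a n) i = !₂[pos N a n i 0, moveLevel N a n + (κ + 1) - 1] := by
    unfold up
    rw [add_sub_assoc, add_sub_cancel_right]
    rfl
  have hyy : y ∈ c'.1 ∩ semiBall !₂[pos N a n i 0, moveLevel N a n] (κ + 1) := by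
    rw [hy2]
    exact mem_singleton y
  have hyh : y ∉ hist N a n := fun h => by
    have := mem_hist_le ha hκ hn hh h
    linarith
  have hyf : Fresh N a n y := fresh_of_not_mem_hist ha (by linarith) hyh
  have hyN : y ∈ N := (hmem' y hyf).2 hyy.1
  have huniq : ∀ z ∈ N, z ∈ semiBall (down (pos N a n) i) (κ + 1) → moveLevel N a n < z 1 →
      z ∉ hist N a n → z = y := by
    intro z hz hzb hzl hzh
    have : z ∈ c'.1 ∩ semiBall !₂[pos N a n i 0, moveLevel N a n] (κ + 1) :=
      ⟨(hmem' z (fresh_of_not_mem_hist ha hzl hzh)).1 hz, hzb⟩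
    rw [hy2] at this
    exact this
  obtain ⟨i0, hi0⟩ := exists_isMoving (pos N a n)
  have hi0l := hi0.moveLevel_eq
  have hi0h : pos N a n i0 ∈ hist N a n := by
    obtain ⟨m, rfl⟩ : ∃ m, n = m + 1 := ⟨n - 1, by omega⟩
    exact pos_mem_hist N a m i0
  constructor
  · refine encard_eq_one.2 ⟨y, ?_⟩
    ext z
    rw [mem_singleton_iff]
    constructor
    · rintro ⟨⟨hzb, hzh⟩, hz⟩
      refine huniq z hz hzb ?_ hzh
      refine lt_of_le_of_ne ?_ fun h => ?_
      · have := (le_of_mem_semiBall hzb).1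
        rwa [down_one] at this
      · have hne : z ≠ pos N a n i0 := fun h' => hzh (h' ▸ hi0h)
        rcases pos_mem (N := N) (a := a) n i0 with h' | h'
        · exact hN.ordinate _ h' _ hz hne.symm (by rw [← h, hi0l])
        · exact hN.special _ hz _ h' (by rw [← h, hi0l])
    · rintro rfl
      exact ⟨⟨hyy.2, hyh⟩, hyN⟩
  · refine encard_eq_one.2 ⟨y, ?_⟩
    ext z
    rw [mem_singleton_iff]
    constructor
    · rintro ⟨hzb, hz⟩
      obtain ⟨h1, h2⟩ := mem_ball_of_mem_up hzb
      have h3 : moveLevel N a n + κ < z 1 := by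
        refine lt_of_le_of_ne h2 fun h => ?_
        refine hs _ (pos_mem n i0) z hz ?_
        rw [hi0l, ← h]
      refine huniq z hz h1 (by linarith) fun h => ?_
      have := mem_hist_le ha hκ hn hh h
      linarith
    · rintro rfl
      exact ⟨by rw [hup]; exact hy3, hyN⟩

/-- The `J`-th good step is finite, and there is no renewal until then. -/
def NoRenewal (κ : ℕ) (a : Start k) (J : ℕ) : Set Conf :=
  {c | goodStep κ c.1 a J ≠ ⊤ ∧ ∀ j < J, ¬ RenewalEvent κ c.1 a (j + 1)}

theorem measurableSet_noRenewal (hκ : 1 ≤ κ) (ha : a.Good κ) (hH : MeasurableSet a.hist)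
    (hX : LocFin a.extra) (J : ℕ) : MeasurableSet (NoRenewal κ a J) := by
  have := borelSpace_enat
  have h1 : MeasurableSet {c : Conf | goodStep κ c.1 a J ≠ ⊤} :=
    (measurable_goodStep (a := fun _ => a) countMeas_conf (fun c => c.2)
      (measStart_const hH hX) (fun _ => ha) hκ J (measurableSet_singleton ⊤)).compl
  have h2 : NoRenewal κ a J = {c : Conf | goodStep κ c.1 a J ≠ ⊤} ∩
      ⋂ j : Fin J, {c : Conf | RenewalEvent κ c.1 a (j + 1)}ᶜ := by
    ext c
    simp only [NoRenewal, mem_ofPred_eq, mem_inter_iff, mem_iInter, mem_compl_iff]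
    exact and_congr_right fun _ => ⟨fun h j => h j j.2, fun h j hj => h ⟨j, hj⟩⟩
  rw [h2]
  exact h1.inter (MeasurableSet.iInter fun j => (measurableSet_renewalEvent (a := fun _ => a)
    countMeas_conf (fun c => c.2) (measStart_const hH hX) (fun _ => ha) hκ (j + 1)).compl)

/-- Renewals before the good step `n` are decided by the points explored until then. -/
theorem noRenewal_of_resample (hX : LocFin a.extra) {n J : ℕ} {c c' : Conf}
    (hc : c ∈ stepAlive a n)
    (hg : goodStep κ (resample (stepZone a n) (c, c')).1 a (J + 1) = n)
    (h : resample (stepZone a n) (c, c') ∈ NoRenewal κ a (J + 1)) :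
    c ∈ NoRenewal κ a J ∧ goodStep κ c.1 a (J + 1) = n := by
  have hss := sameSteps_resample hX hc c'
  have hnf := fun y hy => mem_resample_of_not_fresh hc (y := y) hy c'
  set c2 := resample (stepZone a n) (c, c')
  have hss' : ∀ j ≤ n, explore c.1 a j = explore c2.1 a j := fun j hj => (hss j hj).symm
  have hgj : ∀ j ≤ J + 1, goodStep κ c2.1 a j ≤ n := fun j hj => (goodStep_mono hj).trans hg.le
  have hcg : ∀ j ≤ J + 1, goodStep κ c.1 a j = goodStep κ c2.1 a j := fun j hj =>
    goodStep_congr hss' (hgj j hj)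
  refine ⟨⟨?_, fun j hj hR => h.2 j (by omega) ?_⟩, by rw [hcg _ le_rfl, hg]⟩
  · rw [hcg _ (by omega)]
    exact ((hgj J (by omega)).trans_lt (ENat.natCast_lt_top n)).ne
  · have hle : (goodStep κ c2.1 a (j + 1)).toNat ≤ n := by
      have := ENat.toNat_le_toNat (hgj (j + 1) (by omega)) (ENat.natCast_ne_top n)
      simpa using this
    refine (renewalEvent_congr (hcg (j + 1) (by omega)) (hss' _ hle) fun i y hy => ?_).1 hR
    refine hnf y fun hf => ?_
    -- The events of earlier good steps only test points that are not above the present level, and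
    -- these are not fresh.
    have h1 := level_goodStep_lt (κ := κ) (N := c2.1) (a := a) (show j + 1 < J + 1 by omega) (by
      rw [hg]; exact ENat.natCast_ne_top n)
    rw [hg, ENat.toNat_natCast] at h1
    have h2 := (le_of_mem_semiBall hy).2
    rw [down_one] at h2
    have h3 := hf.1
    rw [← hss.moveLevel le_rfl] at h3
    change y 1 ≤ moveLevel c2.1 a _ + (κ + 1) at h2
    linarith

variable {lam : ℝ} {L : Measure Conf} [IsProbabilityMeasure L]

theorem ae_noShift (hL : IsPoissonProcess L lam (fun c : Conf => c.1)) (hlam : 0 < lam)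
    (hκ : 1 ≤ κ) (hX : a.extra.encard ≤ k) : ∀ᵐ c ∂L, NoShift κ c.1 a := by
  have h1 : ∀ᵐ c ∂L, ∀ y ∈ a.special, ∀ x ∈ (c : Conf).1, x 1 ≠ y 1 + κ :=
    (ae_ball_iff (special_finite hX).countable).2 fun y _ => ae_level_ne hL hlam _
  have hκ0 : (0 : ℝ) < κ := by exact_mod_cast hκ
  filter_upwards [h1, ae_ordinate_ne hL hlam (Nat.cast_nonneg κ)] with c h1 h2
  rintro x (hx | hx) y hy h
  · refine h2 x hx y hy ?_ h
    rintro rfl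
    linarith
  · exact h1 x hx y hy h

/-- Split by the value `n` of the next good step and resample at step `n`. The earlier failures and
this value are decided by the explored region, while the new trial succeeds whenever the fresh
points realise the pattern. -/
theorem measure_noRenewal_succ_le (hL : IsPoissonProcess L lam (fun c : Conf => c.1))
    (hlam : 0 < lam) (hκ : 1 ≤ κ) (ha : a.Good κ) (hH : MeasurableSet a.hist)
    (hX : a.extra.encard ≤ k) {p : ℝ}
    (hp : ∀ (x : Fin k → ℝ) (w : ℝ), ∃ S : Set Conf, MeasurableSet S ∧ p ≤ L.real S ∧
      ∀ c ∈ S, Pattern x w (κ + 1) c.1) (J : ℕ) :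
    L (NoRenewal κ a (J + 1)) ≤ ENNReal.ofReal (1 - p) * L (NoRenewal κ a J) := by
  have := borelSpace_enat
  have hXl : LocFin a.extra := locFin_of_finite (finite_of_encard_le_coe hX)
  have hgm : ∀ n : ℕ, MeasurableSet {c : Conf | goodStep κ c.1 a (J + 1) = n} := fun n =>
    measurable_goodStep (a := fun _ => a) countMeas_conf (fun c => c.2)
      (measStart_const hH hXl) (fun _ => ha) hκ (J + 1) (measurableSet_singleton (n : ℕ∞))
  have hm := fun J => measurableSet_noRenewal hκ ha hH hXl J
  have hstep : ∀ n : ℕ, L (NoRenewal κ a (J + 1) ∩ {c : Conf | goodStep κ c.1 a (J + 1) = n}) ≤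
      ENNReal.ofReal (1 - p) *
        L (NoRenewal κ a J ∩ {c : Conf | goodStep κ c.1 a (J + 1) = n}) := by
    intro n
    have hE := stepExplorable hH hXl n
    have hnice := ae_nice (a := a) hL hlam hX
    have hA := (hm (J + 1)).inter (hgm n)
    have hB := (hm J).inter (hgm n)
    rw [← lintegral_indicator_one hA, ← lintegral_indicator_const hB]
    refine (lintegral_resample_le hL hE _).trans (lintegral_mono_ae ?_)
    filter_upwards [hnice, ae_resample hL hE hnice,
      ae_resample hL hE (ae_noShift (a := a) hL hlam hκ hX)] with c h1 h2 h3
    have hc := h1.mem_stepAlive hκ ha n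
    obtain ⟨S, hS, hpS, hSp⟩ := hp (fun i => pos c.1 a n i 0) (moveLevel c.1 a n)
    by_cases hcB : c ∈ NoRenewal κ a J ∩ {c : Conf | goodStep κ c.1 a (J + 1) = n}
    · rw [indicator_of_mem hcB]
      have h4 : ∫⁻ c', (NoRenewal κ a (J + 1) ∩ {c : Conf | goodStep κ c.1 a (J + 1) = n}).indicator
          1 (resample (stepZone a n) (c, c')) ∂L ≤ ∫⁻ c', Sᶜ.indicator 1 c' ∂L := by
        refine lintegral_mono_ae ?_
        filter_upwards [h2, h3] with c' h2 h3
        by_cases hA' : resample (stepZone a n) (c, c') ∈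
            NoRenewal κ a (J + 1) ∩ {c : Conf | goodStep κ c.1 a (J + 1) = n}
        · rw [indicator_of_mem hA', indicator_of_mem]
          · exact le_rfl
          · intro hcS
            obtain ⟨m, hm1, hgm', -, hh, -⟩ := goodStep_succ_spec hA'.1.1
            have hg' : goodStep κ (resample (stepZone a n) (c, c')).1 a (J + 1) = n := hA'.2
            rw [hg'] at hgm'
            have hnm : n = k * m := by exact_mod_cast hgm'
            refine hA'.1.2 J (Nat.lt_succ_self J) (renewalEvent_of_pattern hκ ha hXl ?_ hc h2 h3
              ?_ hg' (hSp c' hcS))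
            · rw [hnm]
              exact Nat.mul_pos (Nat.pos_of_ne_zero (NeZero.ne k)) hm1
            · rwa [← hnm] at hh
        · rw [indicator_of_notMem hA']
          exact zero_le
      refine h4.trans ?_
      rw [lintegral_indicator_one hS.compl, ← ofReal_measureReal, probReal_compl_eq_one_sub hS]
      exact ENNReal.ofReal_le_ofReal (by linarith)
    · rw [indicator_of_notMem hcB]
      refine le_of_eq ((lintegral_congr fun c' => ?_).trans lintegral_zero)
      refine indicator_of_notMem (fun hA' => hcB ?_) _
      exact noRenewal_of_resample hXl hc hA'.2 hA'.1
  have hU : NoRenewal κ a (J + 1) =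
      ⋃ n : ℕ, NoRenewal κ a (J + 1) ∩ {c : Conf | goodStep κ c.1 a (J + 1) = n} := by
    rw [← inter_iUnion, eq_comm, inter_eq_left]
    intro c hc
    exact mem_iUnion.2 ⟨_, (ENat.natCast_toNat hc.1).symm⟩
  have hd : Pairwise fun n n' : ℕ => Disjoint
      (NoRenewal κ a J ∩ {c : Conf | goodStep κ c.1 a (J + 1) = n})
      (NoRenewal κ a J ∩ {c : Conf | goodStep κ c.1 a (J + 1) = n'}) := by
    intro n n' hne
    rw [Set.disjoint_left]
    rintro c ⟨-, h1⟩ ⟨-, h2⟩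
    refine hne ?_
    rw [mem_ofPred_eq] at h1 h2
    rw [h1] at h2
    exact_mod_cast h2
  rw [hU]
  refine (measure_iUnion_le _).trans ((ENNReal.tsum_le_tsum hstep).trans ?_)
  rw [ENNReal.tsum_mul_left, ← measure_iUnion hd fun n => (hm J).inter (hgm n)]
  gcongr
  exact iUnion_subset fun n => inter_subset_left

theorem measure_noRenewal_le (hL : IsPoissonProcess L lam (fun c : Conf => c.1))
    (hlam : 0 < lam) (hκ : 1 ≤ κ) (ha : a.Good κ) (hH : MeasurableSet a.hist)
    (hX : a.extra.encard ≤ k) {p : ℝ}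
    (hp : ∀ (x : Fin k → ℝ) (w : ℝ), ∃ S : Set Conf, MeasurableSet S ∧ p ≤ L.real S ∧
      ∀ c ∈ S, Pattern x w (κ + 1) c.1) (J : ℕ) :
    L (NoRenewal κ a J) ≤ ENNReal.ofReal (1 - p) ^ J := by
  induction J with
  | zero =>
    rw [pow_zero]
    exact prob_le_one
  | succ J ih =>
    refine (measure_noRenewal_succ_le hL hlam hκ ha hH hX hp J).trans ?_
    rw [pow_succ']
    gcongr

theorem firstRenewal_gt_subset (a : Start k) (n J : ℕ) :
    {c : Conf | (n : ℕ∞) < firstRenewal κ c.1 a} ⊆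
      {c : Conf | (n : ℕ∞) < goodStep κ c.1 a J} ∪ NoRenewal κ a J := by
  intro c hc
  by_cases h : (n : ℕ∞) < goodStep κ c.1 a J
  · exact Or.inl h
  · rw [not_lt] at h
    refine Or.inr ⟨(h.trans_lt (ENat.natCast_lt_top n)).ne, fun j hj hR => ?_⟩
    have h1 := (firstRenewal_le hR).trans ((goodStep_mono (by omega)).trans h)
    exact absurd h1 (not_le.2 hc)

end Renewal

/-! ### The tail of the first renewal step -/

/-- There is a law on `ℕ` with an exponential tail that dominates a given exponential tail. -/
theorem exists_dominating_law {A r : ℝ} (hr : 0 < r) (hr1 : r < 1) :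
    ∃ (ρ : Measure ℕ) (C₀ C₁ : ℝ), IsProbabilityMeasure ρ ∧ 0 < C₀ ∧ 0 < C₁ ∧
      (∀ n : ℕ, ρ.real {j | n ≤ j} ≤ C₀ * Real.exp (-C₁ * n)) ∧
      ∀ n : ℕ, min 1 (A * r ^ n) ≤ ρ.real {j | n ≤ j} := by
  -- The geometric law shifted by `n0` has tail `1` up to `n0` and `r ^ (n - n0)` afterwards, which
  -- is at least `A * r ^ n`.
  obtain ⟨n0, hn0⟩ : ∃ n0 : ℕ, A ≤ (1 / r) ^ n0 :=
    (pow_unbounded_of_one_lt A (by rwa [lt_div_iff₀ hr, one_mul])).imp fun _ h => h.le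
  let p : unitInterval := ⟨1 - r, by constructor <;> linarith⟩
  have hp0 : p ≠ 0 := fun h => by
    have : (1 - r : ℝ) = 0 := congrArg Subtype.val h
    linarith
  have hμ : ∀ n : ℕ, (geometricMeasure p).real {j | n ≤ j} = r ^ n := by
    intro n
    induction n with
    | zero => simp
    | succ n ih =>
      have h1 : {j : ℕ | n ≤ j} = {n} ∪ {j | n + 1 ≤ j} := by
        ext j
        simp only [mem_ofPred_eq, mem_union, mem_singleton_iff]
        omega
      have h2 : Disjoint ({n} : Set ℕ) {j | n + 1 ≤ j} := by
        rw [disjoint_singleton_left]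
        simp
      rw [h1, measureReal_union h2 (by measurability), geometricMeasure_real_singleton hp0] at ih
      have h3 : (1 - (p : ℝ)) = r := by simp [p]
      have h4 : (p : ℝ) = 1 - r := rfl
      rw [h3, h4] at ih
      rw [pow_succ]
      linarith
  have hmap : ∀ n : ℕ, ((geometricMeasure p).map (n0 + ·)).real {j | n ≤ j} = r ^ (n - n0) := by
    intro n
    rw [map_measureReal_apply (by fun_prop) (by measurability), ← hμ]
    congr 1
    ext j
    simp
    omega
  refine ⟨(geometricMeasure p).map (n0 + ·), (1 / r) ^ n0, -Real.log r,
    Measure.isProbabilityMeasure_map (by fun_prop), by positivity,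
    neg_pos.2 (Real.log_neg hr hr1), fun n => ?_, fun n => ?_⟩
  · rw [hmap, neg_neg, mul_comm (Real.log r), ← Real.log_pow, Real.exp_log (by positivity),
      one_div, inv_pow]
    rw [inv_mul_eq_div, le_div_iff₀ (by positivity), ← pow_add]
    exact pow_le_pow_of_le_one hr.le hr1.le (by omega)
  · rw [hmap]
    rcases le_total n n0 with h | h
    · rw [Nat.sub_eq_zero_of_le h, pow_zero]
      exact min_le_left _ _
    · refine (min_le_right _ _).trans ?_
      calc A * r ^ n ≤ (1 / r) ^ n0 * r ^ n := by gcongr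
        _ = r ^ (n - n0) := by
          rw [one_div, inv_pow, inv_mul_eq_div, div_eq_iff (by positivity), ← pow_add]
          congr 1
          omega

variable {k : ℕ} [NeZero k]

variable (k) in
/-- The first renewal step has an exponential tail, uniformly in the starting configuration. -/
theorem exists_renewal_tail {κ : ℕ} (hκ : 6 ≤ κ) {lam : ℝ} (hlam : 0 < lam) :
    ∃ A r : ℝ, 0 < r ∧ r < 1 ∧ ∀ (L : Measure Conf) [IsProbabilityMeasure L],
      IsPoissonProcess L lam (fun c : Conf => c.1) → ∀ a : Start k, a.Good κ →
        MeasurableSet a.hist → a.extra.encard ≤ k → ∀ n : ℕ, 1 ≤ n →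
          L.real {c | (n : ℕ∞) ≤ firstRenewal κ c.1 a} ≤ A * r ^ n := by
  obtain ⟨Θ⟩ := exists_driftParams (k := k) κ hlam
  have hκ0 : (0 : ℝ) ≤ κ := Nat.cast_nonneg κ
  obtain ⟨p, hp0, hp1, hp⟩ := exists_pattern_prob k (show (1 : ℝ) ≤ κ + 1 by linarith) hlam
  -- One good step is asked for every `m` steps: `γ ^ m ≤ 1 / 4` beats the factor `2 ^ J` of the
  -- bound on good steps and leaves `(1 / 2) ^ J`. Adding `1` to `m0` keeps `m` positive.
  obtain ⟨m0, hm0⟩ := exists_pow_lt_of_lt_one (show (0 : ℝ) < 1 / 4 by norm_num) Θ.γ_lt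
  obtain ⟨m, hm⟩ : ∃ m, m = m0 + 1 := ⟨_, rfl⟩
  have hγ := Θ.γ_nonneg
  have hmγ : Θ.γ ^ m ≤ 1 / 4 := (pow_le_pow_of_le_one hγ Θ.γ_lt.le (by omega)).trans hm0.le
  obtain ⟨q, hq⟩ : ∃ q, q = max (1 / 2) (1 - p) := ⟨_, rfl⟩
  have hq2 : 1 / 2 ≤ q := by rw [hq]; exact le_max_left _ _
  have hqp : 1 - p ≤ q := by rw [hq]; exact le_max_right _ _
  have hq1 : q < 1 := by rw [hq]; exact max_lt (by norm_num) (by linarith)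
  have hq0 : 0 < q := by linarith
  obtain ⟨r, hr⟩ : ∃ r, r = q ^ ((m : ℝ)⁻¹) := ⟨_, rfl⟩
  have hr0 : 0 < r := by rw [hr]; exact Real.rpow_pos_of_pos hq0 _
  have hrm : r ^ m = q := by rw [hr]; exact Real.rpow_inv_natCast_pow hq0.le (by omega)
  have hr1 : r < 1 := by
    rw [hr]
    exact Real.rpow_lt_one hq0.le hq1 (by rw [hm]; positivity)
  -- The factor `q` pays for rounding `N / m` down, and `r` for passing from `n` to `N = n - 1`.
  refine ⟨(Θ.initial + 1) / (q * r), r, hr0, hr1, fun L _ hL a ha hH hX n hn => ?_⟩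
  have hI := Θ.initial_pos
  obtain ⟨N, rfl⟩ : ∃ N, n = N + 1 := ⟨n - 1, by omega⟩
  set J := N / m with hJ
  have hJm : m * J ≤ N := Nat.mul_div_le N m
  have hNm : N ≤ m * (J + 1) := by
    have := Nat.lt_mul_div_succ N (show 0 < m by omega)
    exact this.le
  have h1 : L {c | ((N + 1 : ℕ) : ℕ∞) ≤ firstRenewal κ c.1 a} ≤
      ENNReal.ofReal ((Θ.initial + 1) * q ^ J) := by
    have hsub : {c : Conf | ((N + 1 : ℕ) : ℕ∞) ≤ firstRenewal κ c.1 a} ⊆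
        {c : Conf | (N : ℕ∞) < goodStep κ c.1 a J} ∪ NoRenewal κ a J := by
      refine Subset.trans (fun c hc => ?_) (firstRenewal_gt_subset a N J)
      have h0 : (N : ℕ∞) < ((N + 1 : ℕ) : ℕ∞) := by exact_mod_cast Nat.lt_succ_self N
      exact h0.trans_le hc
    refine (measure_mono hsub).trans ((measure_union_le _ _).trans ((add_le_add
      (Θ.measure_goodStep_gt_le hL hlam hκ ha hH hX J N)
      (measure_noRenewal_le hL hlam (by omega) ha hH hX (hp L hL) J)).trans ?_))
    rw [← ENNReal.ofReal_pow (by linarith), ← ENNReal.ofReal_add (by positivity)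
      (pow_nonneg (by linarith) _)]
    refine ENNReal.ofReal_le_ofReal ?_
    have h2 : 2 ^ J * (Θ.γ ^ N * Θ.initial) ≤ Θ.initial * q ^ J := by
      have h3 : Θ.γ ^ N ≤ (1 / 4) ^ J := by
        calc Θ.γ ^ N ≤ Θ.γ ^ (m * J) := pow_le_pow_of_le_one hγ Θ.γ_lt.le hJm
          _ = (Θ.γ ^ m) ^ J := pow_mul _ _ _
          _ ≤ _ := by gcongr
      calc (2 : ℝ) ^ J * (Θ.γ ^ N * Θ.initial) ≤ 2 ^ J * ((1 / 4) ^ J * Θ.initial) := by gcongr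
        _ = Θ.initial * (1 / 2) ^ J := by
          rw [← mul_assoc, ← mul_pow, mul_comm]
          norm_num
        _ ≤ _ := by gcongr
    have h3 : (1 - p) ^ J ≤ q ^ J := pow_le_pow_left₀ (by linarith) hqp J
    linarith
  refine (ENNReal.toReal_le_of_le_ofReal (by positivity) h1).trans ?_
  have h2 : q ^ J * q ≤ r ^ N := by
    rw [← pow_succ, ← hrm, ← pow_mul]
    exact pow_le_pow_of_le_one hr0.le hr1.le hNm
  rw [div_mul_eq_mul_div, le_div_iff₀ (by positivity), pow_succ]
  calc (Θ.initial + 1) * q ^ J * (q * r) = (Θ.initial + 1) * ((q ^ J * q) * r) := by ring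
    _ ≤ _ := by gcongr

/-! ### Resampling above a renewal step -/

section Regen

variable {k : ℕ} [NeZero k] {κ : ℕ} {a : Start k}

/-- The region explored up to the `l`-th renewal step. -/
def regenZone (κ : ℕ) (a : Start k) (l : ℕ) (c : Conf) : Set Plane :=
  {y | RegenAlive κ c.1 a l → y ∈ zone (regenStart κ c.1 a l)}

/-- Puts the zone in the form needed by `explorableOfParams`. The centres are the starting points
lowered by `κ`; whatever full balls and `a.hist` add lies in the half-plane already. For `l = 0` the
radius `-1` makes the balls empty. -/
theorem zone_regenStart (hκ : 1 ≤ κ) (ha : a.Good κ) (N : Set Plane) (l : ℕ) :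
    zone (regenStart κ N a l) = region a.hist (level (regenStart κ N a l).pts)
      (fun i : Fin k => !₂[(regenStart κ N a l).pts i 0, (regenStart κ N a l).pts i 1 - κ])
      (fun _ => if l = 0 then -1 else κ + 1) := by
  cases l with
  | zero =>
    have : ∀ i : Fin k, Metric.closedBall (!₂[(regenStart κ N a 0).pts i 0,
        (regenStart κ N a 0).pts i 1 - κ] : Plane) (-1) = ∅ := fun i =>
      Metric.closedBall_eq_empty.2 (by norm_num)
    simp only [region, zone, if_true, this, iUnion_empty, union_empty]
    rfl
  | succ l =>
    have hsub : ∀ m, a.hist ⊆ zone (regenStart κ N a m) := by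
      intro m
      induction m with
      | zero => exact fun y hy => Or.inr hy
      | succ m ih => exact ih.trans (zone_subset hκ (regenStart_good ha N m))
    set b := regenStart κ N a l
    set g := pos N b (firstRenewal κ N b).toNat with hg
    have hpts : (regenStart κ N a (l + 1)).pts = up κ g := rfl
    have hdown : ∀ i, (!₂[(regenStart κ N a (l + 1)).pts i 0,
        (regenStart κ N a (l + 1)).pts i 1 - κ] : Plane) = down g i := by
      intro i
      rw [hpts]
      refine plane_ext ?_ ?_
      · rw [down_zero]
        simp [up_zero]
      · rw [down_one]
        simp [up_one]
    simp only [hdown]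
    ext y
    constructor
    · rintro (h | h)
      · exact Or.inl (Or.inl h)
      · obtain ⟨i, hi⟩ := mem_iUnion.1 h.1
        exact Or.inr (mem_iUnion.2 ⟨i, by rw [if_neg (Nat.succ_ne_zero l)]; exact hi.1⟩)
    · rintro ((h | h) | h)
      · exact Or.inl h
      · exact hsub (l + 1) h
      · obtain ⟨i, hi⟩ := mem_iUnion.1 h
        rw [if_neg (Nat.succ_ne_zero l)] at hi
        exact ball_subset_zone hi

theorem measurableSet_regenAlive (hκ : 1 ≤ κ) (ha : a.Good κ) (hH : MeasurableSet a.hist)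
    (hX : LocFin a.extra) (l : ℕ) : MeasurableSet {c : Conf | RegenAlive κ c.1 a l} := by
  have := borelSpace_enat
  have hms := fun m => measStart_regenStart (a := fun _ : Conf => a) (κ := κ) countMeas_conf
    (fun c => c.2) (measStart_const hH hX) (fun _ => ha) hκ m
  have hgd := fun m => fun c : Conf => regenStart_good ha c.1 m
  have hfr := fun m => measurable_firstRenewal countMeas_conf (fun c => c.2) (hms m) (hgd m) hκ
  have h1 : ∀ m, MeasurableSet {c : Conf | RenewAlive κ c.1 (regenStart κ c.1 a m)} := by
    intro m
    have h2 : {c : Conf | RenewAlive κ c.1 (regenStart κ c.1 a m)} =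
        {c | firstRenewal κ c.1 (regenStart κ c.1 a m) ≠ ⊤} ∩
          {c | c ∈ ⋂ j : ℕ, {c : Conf |
            j < (firstRenewal κ c.1 (regenStart κ c.1 a m)).toNat →
              HasCand c.1 (regenStart κ c.1 a m) j}} := by
      ext c
      simp [RenewAlive]
    rw [h2]
    refine (hfr m (measurableSet_singleton ⊤)).compl.inter (MeasurableSet.iInter fun j => ?_)
    refine MeasurableSet.imp ?_ ?_
    · exact measurableSet_lt measurable_const (measurable_toNat (hfr m))
    · exact measurableSet_hasCand countMeas_conf (fun c => c.2) (hms m) j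
  have h2 : {c : Conf | RegenAlive κ c.1 a l} =
      ⋂ m : Fin l, {c : Conf | RenewAlive κ c.1 (regenStart κ c.1 a m)} := by
    ext c
    simp only [RegenAlive, mem_ofPred_eq, mem_iInter]
    exact ⟨fun h j => h j j.2, fun h j hj => h ⟨j, hj⟩⟩
  rw [h2]
  exact MeasurableSet.iInter fun m => h1 m

/-- The region explored up to a renewal step can be resampled. -/
def regenExplorable (hκ : 1 ≤ κ) (ha : a.Good κ) (hH : MeasurableSet a.hist)
    (hX : LocFin a.extra) (l : ℕ) :
    Explorable (regenZone κ a l) (Bool × ℤ × (Fin k → (ℤ × ℤ) × ℤ)) := by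
  classical
  have hms := measStart_regenStart (a := fun _ : Conf => a) (κ := κ) countMeas_conf
    (fun c => c.2) (measStart_const hH hX) (fun _ => ha) hκ l
  have h1 := measurableSet_regenAlive hκ ha hH hX l
  have h2 : Measurable fun c : Conf => level (regenStart κ c.1 a l).pts := measurable_level hms.pts
  have h3 : ∀ i : Fin k, Measurable fun c : Conf =>
      (!₂[(regenStart κ c.1 a l).pts i 0, (regenStart κ c.1 a l).pts i 1 - κ] : Plane) := fun i =>
    measurable_plane (measurable_coord_comp (hms.pts i) 0)
      ((measurable_coord_comp (hms.pts i) 1).sub_const _)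
  have h4 : ∀ i : Fin k, Measurable fun _ : Conf => (if l = 0 then -1 else (κ : ℝ) + 1) := fun _ =>
    measurable_const
  have h5 := fun (c c' : Conf) (hc : c ∈ {c : Conf | RegenAlive κ c.1 a l})
      (hag : ∀ y ∈ region a.hist (level (regenStart κ c.1 a l).pts)
        (fun i : Fin k => !₂[(regenStart κ c.1 a l).pts i 0, (regenStart κ c.1 a l).pts i 1 - κ])
        (fun _ => if l = 0 then -1 else κ + 1), y ∈ c.1 ↔ y ∈ c'.1) =>
    show c' ∈ {c : Conf | RegenAlive κ c.1 a l} ∧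
      level (regenStart κ c'.1 a l).pts = level (regenStart κ c.1 a l).pts ∧
      (∀ i : Fin k, (!₂[(regenStart κ c'.1 a l).pts i 0,
        (regenStart κ c'.1 a l).pts i 1 - κ] : Plane) =
        !₂[(regenStart κ c.1 a l).pts i 0, (regenStart κ c.1 a l).pts i 1 - κ]) ∧
      ∀ _ : Fin k, (if l = 0 then -1 else (κ : ℝ) + 1) = (if l = 0 then -1 else (κ : ℝ) + 1) from by
    rw [← zone_regenStart hκ ha] at hag
    obtain ⟨e1, e2⟩ := regen_stop hκ ha c.2 hX hc hag
    refine ⟨fun m hm => ?_, by rw [e1], fun i => by rw [e1], fun _ => rfl⟩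
    rw [(e2 m hm).1]
    exact (e2 m hm).2.alive
  have h6 := explorableOfParams h1 hH h2 h3 h4 h5
  have h7 : regenZone κ a l = fun c => {y | c ∈ {c : Conf | RegenAlive κ c.1 a l} →
      y ∈ region a.hist (level (regenStart κ c.1 a l).pts)
        (fun i : Fin k => !₂[(regenStart κ c.1 a l).pts i 0, (regenStart κ c.1 a l).pts i 1 - κ])
        (fun _ => if l = 0 then -1 else κ + 1)} := by
    funext c
    unfold regenZone
    rw [zone_regenStart hκ ha]
    rfl
  rw [h7]
  exact h6

/-- At a renewal step each of the `k` unit semi-balls contains exactly one point. -/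
theorem regenStart_extra_le {c : Conf} (hX : a.extra.encard ≤ k) {l : ℕ}
    (hc : RegenAlive κ c.1 a l) : (regenStart κ c.1 a l).extra.encard ≤ k := by
  cases l with
  | zero => exact hX
  | succ l =>
    obtain ⟨j, hj, hR⟩ := firstRenewal_spec (hc l (Nat.lt_succ_self l)).1
    have hR2 := hR.2
    rw [← hj] at hR2
    set b := regenStart κ c.1 a l
    have h1 : (regenStart κ c.1 a (l + 1)).extra ⊆ ⋃ i ∈ (Finset.univ : Finset (Fin k)),
        (semiBall (up κ (explore c.1 b (firstRenewal κ c.1 b).toNat).pos i) 1 ∩ c.1) := by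
      rintro y ⟨hy, hyU⟩
      obtain ⟨i, hi⟩ := mem_iUnion.1 hyU
      exact mem_iUnion₂.2 ⟨i, Finset.mem_univ i, hi, hy⟩
    refine (encard_le_encard h1).trans ?_
    have h2 : ∀ s : Finset (Fin k), (⋃ i ∈ s,
        (semiBall (up κ (explore c.1 b (firstRenewal κ c.1 b).toNat).pos i) 1 ∩ c.1)).encard ≤
          s.card := by
      intro s
      induction s using Finset.induction_on with
      | empty => simp
      | insert i s hi ih =>
        rw [Finset.set_biUnion_insert, Finset.card_insert_of_notMem hi]
        refine (encard_union_le _ _).trans ?_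
        rw [(hR2 i).2]
        push_cast
        rw [add_comm]
        gcongr
    have := h2 Finset.univ
    rwa [Finset.card_univ, Fintype.card_fin] at this

theorem measurableSet_regenStart_hist (hH : MeasurableSet a.hist) (N : Set Plane) (l : ℕ) :
    MeasurableSet (regenStart κ N a l).hist := by
  cases l with
  | zero => exact hH
  | succ l =>
    exact (MeasurableSet.iUnion fun i => measurableSet_semiBall _ _).inter
      (measurableSet_le measurable_const (measurable_coord 1))

variable {lam : ℝ} {L : Measure Conf} [IsProbabilityMeasure L]

/-- The law of the next renewal gap given an event that is decided by the regenerated zone. -/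
theorem measure_renewalGap_inter_le (hL : IsPoissonProcess L lam (fun c : Conf => c.1))
    (hκ : 1 ≤ κ) (ha : a.Good κ) (hH : MeasurableSet a.hist)
    (hX : a.extra.encard ≤ k) {l n : ℕ} (hal : ∀ᵐ c ∂L, RegenAlive κ c.1 a l) {t : ℝ}
    (ht : ∀ b : Start k, b.Good κ → MeasurableSet b.hist → b.extra.encard ≤ k →
      L.real {c | (n : ℕ∞) ≤ firstRenewal κ c.1 b} ≤ t) {D : Set Conf} (hD : MeasurableSet D)
    (hinv : ∀ c c' : Conf, RegenAlive κ c.1 a l →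
      (∀ y ∈ zone (regenStart κ c.1 a l), (y ∈ c.1 ↔ y ∈ c'.1)) → (c' ∈ D → c ∈ D)) :
    L ({c | (n : ℕ∞) ≤ renewalGap κ c.1 a (l + 1)} ∩ D) ≤ ENNReal.ofReal t * L D := by
  have := borelSpace_enat
  have hXl : LocFin a.extra := locFin_of_finite (finite_of_encard_le_coe hX)
  have hE := regenExplorable hκ ha hH hXl l
  have hgm : MeasurableSet {c : Conf | (n : ℕ∞) ≤ renewalGap κ c.1 a (l + 1)} :=
    measurableSet_le measurable_const (measurable_renewalGap (a := fun _ : Conf => a)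
      countMeas_conf (fun c => c.2) (measStart_const hH hXl) (fun _ => ha) hκ (l + 1))
  rw [← lintegral_indicator_one (hgm.inter hD), ← lintegral_indicator_const hD]
  refine (lintegral_resample_le hL hE _).trans (lintegral_mono_ae ?_)
  filter_upwards [hal] with c hc
  have hag : ∀ c' : Conf, ∀ y ∈ zone (regenStart κ c.1 a l),
      (y ∈ c.1 ↔ y ∈ (resample (regenZone κ a l) (c, c')).1) := by
    intro c' y hy
    have : y ∈ regenZone κ a l c := fun _ => hy
    unfold resample
    rw [mem_glue_iff]
    simp [this]
  have hag' : ∀ c' : Conf, ∀ y ∉ zone (regenStart κ c.1 a l),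
      (y ∈ c'.1 ↔ y ∈ (resample (regenZone κ a l) (c, c')).1) := by
    intro c' y hy
    have : y ∉ regenZone κ a l c := fun h => hy (h hc)
    unfold resample
    rw [mem_glue_iff]
    simp [this]
  by_cases hcD : c ∈ D
  · rw [indicator_of_mem hcD]
    have hbg := regenStart_good ha c.1 l
    have hbX := regenStart_extra_le hX hc
    have hbH := measurableSet_regenStart_hist (κ := κ) hH c.1 l
    have hgm' : MeasurableSet {c' : Conf | (n : ℕ∞) ≤ firstRenewal κ c'.1 (regenStart κ c.1 a l)} :=
      measurableSet_le measurable_const (measurable_firstRenewal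
        (a := fun _ : Conf => regenStart κ c.1 a l) countMeas_conf (fun c => c.2)
        (measStart_const hbH (locFin_of_finite (finite_of_encard_le_coe hbX))) (fun _ => hbg) hκ)
    calc _ ≤ ∫⁻ c', {c' : Conf | (n : ℕ∞) ≤
            firstRenewal κ c'.1 (regenStart κ c.1 a l)}.indicator 1 c' ∂L := by
          refine lintegral_mono fun c' => ?_
          by_cases h : resample (regenZone κ a l) (c, c') ∈
              {c | (n : ℕ∞) ≤ renewalGap κ c.1 a (l + 1)} ∩ D
          swap
          · rw [indicator_of_notMem h]
            exact zero_le
          have h1 : (n : ℕ∞) ≤ firstRenewal κ (resample (regenZone κ a l) (c, c')).1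
            (regenStart κ (resample (regenZone κ a l) (c, c')).1 a l) := h.1
          -- The regenerated start does not see the resampling, and its first renewal step sees only
          -- `c'`: the bound for a deterministic start applies.
          rw [(regen_stop hκ ha c.2 hXl hc (hag c')).1, firstRenewal_fresh hbg hκ (hag' c')] at h1
          rw [indicator_of_mem h, indicator_of_mem (show c' ∈ {c' : Conf | (n : ℕ∞) ≤
            firstRenewal κ c'.1 (regenStart κ c.1 a l)} from h1)]
          exact le_rfl
      _ = L {c' : Conf | (n : ℕ∞) ≤ firstRenewal κ c'.1 (regenStart κ c.1 a l)} :=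
          lintegral_indicator_one hgm'
      _ ≤ ENNReal.ofReal t := by
          rw [← ofReal_measureReal]
          exact ENNReal.ofReal_le_ofReal (ht _ hbg hbH hbX)
  · rw [indicator_of_notMem hcD]
    refine le_of_eq ((lintegral_congr fun c' => ?_).trans lintegral_zero)
    exact indicator_of_notMem (fun h => hcD (hinv c _ hc (hag c') h.2)) _

/-- By induction, the tail bound for the next gap holds for every `n`, which makes that gap finite.
Candidates are never lacking, since there are Poisson points at arbitrary heights. -/
theorem ae_regenAlive (hL : IsPoissonProcess L lam (fun c : Conf => c.1)) (hlam : 0 < lam)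
    (hκ : 1 ≤ κ) (ha : a.Good κ) (hH : MeasurableSet a.hist) (hX : a.extra.encard ≤ k) {A r : ℝ}
    (hr : 0 < r) (hr1 : r < 1)
    (ht : ∀ b : Start k, b.Good κ → MeasurableSet b.hist → b.extra.encard ≤ k → ∀ n : ℕ, 1 ≤ n →
      L.real {c | (n : ℕ∞) ≤ firstRenewal κ c.1 b} ≤ A * r ^ n) (l : ℕ) :
    ∀ᵐ c ∂L, RegenAlive κ c.1 a l := by
  induction l with
  | zero => exact Filter.Eventually.of_forall fun c m hm => absurd hm (Nat.not_lt_zero m)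
  | succ l ih =>
    have h1 : ∀ᵐ c ∂L, firstRenewal κ (c : Conf).1 (regenStart κ c.1 a l) ≠ ⊤ := by
      rw [ae_iff]
      have h2 : ∀ n : ℕ, 1 ≤ n → L {c : Conf | ¬ firstRenewal κ c.1 (regenStart κ c.1 a l) ≠ ⊤} ≤
          ENNReal.ofReal (A * r ^ n) := by
        intro n hn
        refine (measure_mono ?_).trans ((measure_renewalGap_inter_le hL hκ ha hH hX ih
          (fun b h1 h2 h3 => ht b h1 h2 h3 n hn) MeasurableSet.univ fun _ _ _ _ _ => mem_univ _).trans
          (le_of_eq (by rw [measure_univ, mul_one])))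
        intro c hc
        have hc' : firstRenewal κ c.1 (regenStart κ c.1 a l) = ⊤ := not_not.1 hc
        refine ⟨?_, mem_univ _⟩
        change (n : ℕ∞) ≤ firstRenewal κ c.1 (regenStart κ c.1 a l)
        rw [hc']
        exact le_top
      have h3 : Filter.Tendsto (fun n : ℕ => ENNReal.ofReal (A * r ^ n)) Filter.atTop
          (nhds (ENNReal.ofReal (A * 0))) :=
        ENNReal.tendsto_ofReal ((tendsto_pow_atTop_nhds_zero_of_lt_one hr.le hr1).const_mul A)
      rw [mul_zero, ENNReal.ofReal_zero] at h3
      exact le_antisymm (ge_of_tendsto h3 (Filter.eventually_atTop.2 ⟨1, h2⟩)) zero_le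
    filter_upwards [ih, h1, ae_exists_above hL hlam] with c h1 h2 h3 m hm
    rcases Nat.lt_succ_iff_lt_or_eq.1 hm with h | rfl
    · exact h1 m h
    · exact ⟨h2, fun j _ => hasCand_of_above h3 hκ (regenStart_good ha c.1 m) j⟩

end Regen

/-! ### Events that are decided by the blocks -/

section Inv

variable {T : Type*} {R : T → T → Prop}

/-- The sigma-field of the sets that are invariant under a relation. -/
@[reducible]
def invSigma (R : T → T → Prop) : MeasurableSpace T where
  MeasurableSet' B := ∀ q q', R q q' → (q' ∈ B ↔ q ∈ B)
  measurableSet_empty := fun _ _ _ => Iff.rfl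
  measurableSet_compl := fun _ h q q' hR => not_congr (h q q' hR)
  measurableSet_iUnion := fun _ h q q' hR => by
    simp only [mem_iUnion]
    exact exists_congr fun i => h i q q' hR

theorem comap_le_invSigma {β : Type*} [mβ : MeasurableSpace β] {f : T → β}
    (h : ∀ q q', R q q' → f q' = f q) : mβ.comap f ≤ invSigma R := by
  rintro _ ⟨B, _, rfl⟩ q q' hR
  rw [mem_preimage, mem_preimage, h q q' hR]

variable {k κ : ℕ} {N : T → Set Plane} {a : T → Start k}

/-- Events of a block are used only through their invariance: configurations that show the same
block are in or out together. As the invariant sets form a sigma-field, the generators suffice. -/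
theorem blockSigma_le_invSigma [NeZero k]
    (h : ∀ q q', R q q' → a q' = a q ∧ SameBlock κ (N q) (N q') (a q)) :
    blockSigma κ N a ≤ invSigma R := by
  refine sup_le (sup_le (sup_le (sup_le ?_ ?_) ?_) ?_) ?_
  · refine iSup₂_le fun n i => comap_le_invSigma fun q q' hR => ?_
    obtain ⟨h1, h2⟩ := h q q' hR
    have h3 : firstRenewal κ (N q) (a q) ≠ ⊤ := by
      rw [← h2.renewal]
      exact h2.alive.1
    rw [h1, h2.renewal, h2.explore _ (ENat.toNat_le_toNat (min_le_right _ _) h3)]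
  · refine comap_le_invSigma fun q q' hR => ?_
    obtain ⟨h1, h2⟩ := h q q' hR
    rw [h1, h2.renewal]
  · refine iSup₂_le fun B _ => comap_le_invSigma fun q q' hR => ?_
    simp only [(h q q' hR).1]
  · refine iSup_le fun j => comap_le_invSigma fun q q' hR => ?_
    obtain ⟨h1, h2⟩ := h q q' hR
    rw [h1, h2.renewal, h2.goodStep]
  · refine MeasurableSpace.generateFrom_le ?_
    rintro _ ⟨j, _, rfl⟩ q q' hR
    obtain ⟨h1, h2⟩ := h q q' hR
    rw [mem_ofPred_eq, mem_ofPred_eq, h1, h2.renewal]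
    exact h2.event j

theorem renewalSigma_le_invSigma [NeZero k] {l : ℕ}
    (h : ∀ q q', R q q' → ∀ m < l,
      regenStart κ (N q') (a q') m = regenStart κ (N q) (a q) m ∧
        SameBlock κ (N q) (N q') (regenStart κ (N q) (a q) m)) :
    renewalSigma κ N a l ≤ invSigma R := by
  refine iSup₂_le fun m hm => blockSigma_le_invSigma fun q q' hR => h q q' hR (m - 1) ?_
  have := Finset.mem_Icc.1 hm
  omega

end Inv

section Comap

variable {Ω T : Type*} {k κ : ℕ} {N : T → Set Plane} {a : T → Start k} (Φ : Ω → T)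

theorem blockSigma_comp_le :
    blockSigma κ (fun ω => N (Φ ω)) (fun ω => a (Φ ω)) ≤ (blockSigma κ N a).comap Φ := by
  simp only [blockSigma, pointSigma, MeasurableSpace.comap_iSup, MeasurableSpace.comap_sup,
    MeasurableSpace.comap_comp, Function.comp_def]
  refine sup_le_sup le_rfl (MeasurableSpace.generateFrom_le ?_)
  rintro _ ⟨j, hj, rfl⟩
  exact ⟨_, MeasurableSpace.measurableSet_generateFrom ⟨j, hj, rfl⟩, rfl⟩

/-- Allows an event of the blocks on `Ω` to be written as the preimage of such an event on the
product of configuration spaces. -/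
theorem renewalSigma_comp_le (l : ℕ) :
    renewalSigma κ (fun ω => N (Φ ω)) (fun ω => a (Φ ω)) l ≤ (renewalSigma κ N a l).comap Φ := by
  simp only [renewalSigma, MeasurableSpace.comap_iSup]
  exact iSup₂_mono fun m _ =>
    blockSigma_comp_le (a := fun q => regenStart κ (N q) (a q) (m - 1)) Φ

end Comap

/-! ### Bounds for conditional probabilities -/

/-- Both sides are measurable for `m`, so comparing their integrals over the sets of `m`, under the
trimmed measure, is enough. -/
theorem condExp_indicator_le {Ω : Type*} {m mΩ : MeasurableSpace Ω} {Q : Measure Ω}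
    [IsFiniteMeasure Q] (hm : m ≤ mΩ) {E : Set Ω} (hE : MeasurableSet E) {t : ℝ} (ht : 0 ≤ t)
    (h : ∀ B, MeasurableSet[m] B → Q (E ∩ B) ≤ ENNReal.ofReal t * Q B) :
    Q⟦E | m⟧ ≤ᵐ[Q] fun _ => t := by
  refine ae_le_of_ae_le_trim (hm := hm) ?_
  refine ae_le_of_forall_setIntegral_le (integrable_condExp.trim hm stronglyMeasurable_condExp)
    (integrable_const t) fun B hB _ => ?_
  rw [← setIntegral_trim hm stronglyMeasurable_condExp hB,
    setIntegral_condExp hm ((integrable_const (1 : ℝ)).indicator hE) hB,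
    integral_indicator_const (μ := Q.restrict B) (1 : ℝ) hE, setIntegral_const, smul_eq_mul, mul_one, smul_eq_mul,
    measureReal_restrict_apply hE, measureReal_def, measureReal_def, trim_measurableSet_eq hm hB,
    mul_comm, ← ENNReal.toReal_ofReal ht, ← ENNReal.toReal_mul]
  exact ENNReal.toReal_mono (ENNReal.mul_ne_top ENNReal.ofReal_ne_top (measure_ne_top _ _)) (h B hB)

/-! ### Random extra points -/

section Product

variable {k : ℕ} [NeZero k] {κ : ℕ} {lam : ℝ} {L M : Measure Conf} [IsProbabilityMeasure L]
  [IsProbabilityMeasure M] {u : Fin k → Plane} {H : Set Plane}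

theorem countMeas_snd : CountMeas fun q : Conf × Conf => q.2.1 :=
  countMeas_of_locFin (fun q => q.2.2) fun _ hB => (measurable_count hB).comp measurable_snd

theorem measStart_randomExtra (hH : MeasurableSet H) :
    MeasStart fun q : Conf × Conf => (⟨u, H, q.1.1⟩ : Start k) where
  pts := fun _ => measurable_const
  hist := measurable_snd hH
  extra := countMeas_of_locFin (fun q => q.1.2) fun _ hB =>
    (measurable_count hB).comp measurable_fst
  locFin := fun q => q.1.2

theorem measurableSet_avoid (hH : MeasurableSet H) : MeasurableSet {c : Conf | c.1 ∩ H = ∅} := by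
  have := measurable_count hH (measurableSet_singleton 0)
  simpa only [preimage, mem_singleton_iff, encard_eq_zero] using this

/-- The law of the next renewal gap when the extra points are random and the Poisson points avoid
the initial history set. -/
theorem prod_renewalGap_inter_le (hL : IsPoissonProcess L lam (fun c : Conf => c.1))
    (hlam : 0 < lam) (hκ : 1 ≤ κ) (ha : ∀ Y, Start.Good κ (⟨u, H, Y⟩ : Start k))
    (hH : MeasurableSet H) (hM : ∀ᵐ x ∂M, (x : Conf).1.encard ≤ k) {A r : ℝ}
    (hr : 0 < r) (hr1 : r < 1)
    (ht : ∀ b : Start k, b.Good κ → MeasurableSet b.hist → b.extra.encard ≤ k → ∀ n : ℕ, 1 ≤ n →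
      L.real {c | (n : ℕ∞) ≤ firstRenewal κ c.1 b} ≤ A * r ^ n) (l : ℕ) {n : ℕ} (hn : 1 ≤ n)
    {B : Set (Conf × Conf)} (hB : MeasurableSet[renewalSigma κ (fun q : Conf × Conf => q.2.1)
      (fun q => (⟨u, H, q.1.1⟩ : Start k)) l] B) :
    M.prod L ({q | q.2.1 ∩ H = ∅} ∩
      ({q | (n : ℕ∞) ≤ renewalGap κ q.2.1 (⟨u, H, q.1.1⟩ : Start k) (l + 1)} ∩ B)) ≤
      ENNReal.ofReal (min 1 (A * r ^ n)) * M.prod L ({q | q.2.1 ∩ H = ∅} ∩ B) := by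
  have := borelSpace_enat
  have hf : ∀ q : Conf × Conf, LocFin q.2.1 := fun q => q.2.2
  have hcount := countMeas_snd
  have hms := measStart_randomExtra (u := u) hH
  have hgood : ∀ q : Conf × Conf, Start.Good κ (⟨u, H, q.1.1⟩ : Start k) := fun q => ha _
  have hBm : MeasurableSet B := renewalSigma_le hcount hf hms hgood hκ l B hB
  have hinv := (renewalSigma_le_invSigma (R := fun q q' : Conf × Conf => ∀ m < l,
      regenStart κ q'.2.1 (⟨u, H, q'.1.1⟩ : Start k) m = regenStart κ q.2.1 ⟨u, H, q.1.1⟩ m ∧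
        SameBlock κ q.2.1 q'.2.1 (regenStart κ q.2.1 (⟨u, H, q.1.1⟩ : Start k) m))
      fun _ _ h => h) B hB
  have hS : MeasurableSet {q : Conf × Conf | q.2.1 ∩ H = ∅} := measurable_snd (measurableSet_avoid hH)
  have hE : MeasurableSet {q : Conf × Conf |
      (n : ℕ∞) ≤ renewalGap κ q.2.1 (⟨u, H, q.1.1⟩ : Start k) (l + 1)} :=
    measurableSet_le measurable_const (measurable_renewalGap hcount hf hms hgood hκ (l + 1))
  rw [Measure.prod_apply (hS.inter (hE.inter hBm)), Measure.prod_apply (hS.inter hBm),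
    ← lintegral_const_mul _ (measurable_measure_prodMk_left (hS.inter hBm))]
  refine lintegral_mono_ae ?_
  -- With the extra points fixed, the start is deterministic and the estimate for a single
  -- configuration applies.
  filter_upwards [hM] with x hx
  have hset : Prod.mk x ⁻¹' ({q : Conf × Conf | q.2.1 ∩ H = ∅} ∩
      ({q | (n : ℕ∞) ≤ renewalGap κ q.2.1 (⟨u, H, q.1.1⟩ : Start k) (l + 1)} ∩ B)) =
      {c | (n : ℕ∞) ≤ renewalGap κ c.1 (⟨u, H, x.1⟩ : Start k) (l + 1)} ∩
        (Prod.mk x ⁻¹' ({q : Conf × Conf | q.2.1 ∩ H = ∅} ∩ B)) := by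
    ext c
    exact and_left_comm
  rw [hset]
  refine measure_renewalGap_inter_le hL hκ (ha x.1) hH hx
    (ae_regenAlive hL hlam hκ (ha x.1) hH hx hr hr1 ht l)
    (fun b h1 h2 h3 => le_min measureReal_le_one (ht b h1 h2 h3 n hn))
    (measurable_prodMk_left (hS.inter hBm)) ?_
  -- The regenerated zone contains `H` and determines the blocks, so it decides both the avoidance
  -- of `H` and the event `B`.
  rintro c c' hc hag ⟨h1, h2⟩
  have hsub : ∀ m, H ⊆ zone (regenStart κ c.1 (⟨u, H, x.1⟩ : Start k) m) := by
    intro m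
    induction m with
    | zero => exact fun y hy => Or.inr hy
    | succ m ih => exact ih.trans (zone_subset hκ (regenStart_good (ha x.1) c.1 m))
  refine ⟨?_, ?_⟩
  · change c'.1 ∩ H = ∅ at h1
    change c.1 ∩ H = ∅
    rw [eq_empty_iff_forall_notMem] at h1 ⊢
    exact fun y hy => h1 y ⟨(hag y (hsub l hy.2)).1 hy.1, hy.2⟩
  · exact (hinv (x, c) (x, c') (regen_stop hκ (ha x.1) c.2 x.2 hc hag).2).1 h2

end Product

/-! ### Transfer to the underlying probability space -/

section Transfer

variable {Ω : Type*} [mΩ : MeasurableSpace Ω] {P : Measure Ω} {lam : ℝ} {N : Ω → Set Plane}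

/-- A random locally finite set as a random element of the space of configurations. -/
def toConf {S : Ω → Set Plane} (hS : ∀ ω, LocFin (S ω)) (ω : Ω) : Conf := ⟨S ω, hS ω⟩

theorem comap_toConf_le {S : Ω → Set Plane} (hS : ∀ ω, LocFin (S ω)) :
    MeasurableSpace.comap (toConf hS) inferInstance ≤ pointSigma S := by
  change MeasurableSpace.comap (toConf hS) (⨆ (B : Set Plane) (_ : MeasurableSet B), _) ≤ _
  simp only [MeasurableSpace.comap_iSup, MeasurableSpace.comap_comp]
  exact le_rfl

theorem IsPoissonProcess.locFin (hN : IsPoissonProcess P lam N) (ω : Ω) : LocFin (N ω) :=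
  hN.locallyFinite ω

theorem IsPoissonProcess.map_toConf (hN : IsPoissonProcess P lam N) :
    IsPoissonProcess (P.map (toConf hN.locFin)) lam (fun c : Conf => c.1) := by
  have hm : Measurable (toConf hN.locFin) := measurable_conf hN.measurable_count
  refine ⟨fun c => c.2, fun B hB => DSF.measurable_count hB, fun B hB hb => ?_, fun m B hB hd => ?_⟩
  · have hn : Measurable fun c : Conf => (c.1 ∩ B).ncard :=
      measurable_toNat (DSF.measurable_count hB)
    rw [Measure.map_map hn hm]
    exact hN.law_count B hB hb
  · rw [iIndepFun_iff_measure_inter_preimage_eq_mul]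
    intro S s hs
    have h1 := iIndepFun_iff_measure_inter_preimage_eq_mul.1 (hN.indep_count m B hB hd) S hs
    rw [Measure.map_apply hm (Finset.measurableSet_biInter S fun i hi =>
      DSF.measurable_count (hB i) (hs i hi))]
    simp only [preimage_iInter]
    refine h1.trans (Finset.prod_congr rfl fun i hi => ?_)
    rw [Measure.map_apply hm (DSF.measurable_count (hB i) (hs i hi))]
    rfl

variable [IsProbabilityMeasure P]

theorem map_toConf_prod {S : Ω → Set Plane} (hS : ∀ ω, LocFin (S ω)) (hSm : pointSigma S ≤ mΩ)
    (hN : IsPoissonProcess P lam N) (hi : Indep (pointSigma S) (pointSigma N) P) :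
    P.map (fun ω => (toConf hS ω, toConf hN.locFin ω)) =
      (P.map (toConf hS)).prod (P.map (toConf hN.locFin)) := by
  have h1 : Measurable (toConf hS) := Measurable.of_comap_le ((comap_toConf_le hS).trans hSm)
  have h2 : Measurable (toConf hN.locFin) := measurable_conf hN.measurable_count
  rw [← indepFun_iff_map_prod_eq_prod_map_map h1.aemeasurable h2.aemeasurable]
  exact indep_of_indep_of_le_left (indep_of_indep_of_le_right hi (comap_toConf_le _))
    (comap_toConf_le _)

end Transfer

end DSF

end

/-! ### Conclusion on the original probability space. -/

theorem mainTheorem7 (k : ℕ) (hk : 1 ≤ k) (κ : ℕ) (hκ : 6 ≤ κ) (lam : ℝ) (hlam : 0 < lam) :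
    ∃ (ρ : Measure ℕ) (C₀ C₁ : ℝ), IsProbabilityMeasure ρ ∧ 0 < C₀ ∧ 0 < C₁ ∧
      (∀ n : ℕ, 1 ≤ n → ρ.real {r | n ≤ r} ≤ C₀ * Real.exp (-C₁ * n)) ∧
      ∀ (Ω : Type*) (mΩ : MeasurableSpace Ω) (P : Measure Ω) (_ : IsProbabilityMeasure P)
        (N : Ω → Set DSF.Plane) (_ : DSF.IsPoissonProcess P lam N)
        (u : Fin k → DSF.Plane) (_ : ∀ i j, |u i 1 - u j 1| ≤ κ)
        (H₀ : Set DSF.Plane) (_ : IsCompact H₀)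
        (_ : ∀ x ∈ H₀, DSF.level u ≤ x 1 ∧ x 1 ≤ DSF.level u + 1)
        (X : Ω → Set DSF.Plane) (_ : DSF.pointSigma X ≤ mΩ)
        (_ : ∀ ω, X ω ⊆ H₀ ∧ (X ω).encard ≤ k)
        (_ : Indep (DSF.pointSigma X) (DSF.pointSigma N) P) (l : ℕ),
        let a : Ω → DSF.Start k := fun ω => ⟨u, H₀, X ω⟩
        let Q : Measure Ω := P[|{ω | N ω ∩ H₀ = ∅}]
        DSF.renewalSigma κ N a l ≤ mΩ ∧
        Measurable (fun ω => DSF.renewalGap κ (N ω) (a ω) (l + 1)) ∧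
        ∀ n : ℕ, 1 ≤ n →
          Q⟦{ω | (n : ℕ∞) ≤ DSF.renewalGap κ (N ω) (a ω) (l + 1)} | DSF.renewalSigma κ N a l⟧
            ≤ᵐ[Q] fun _ => ρ.real {r | n ≤ r} := by
  have : NeZero k := ⟨by omega⟩
  obtain ⟨A, r, hr, hr1, htail⟩ := DSF.exists_renewal_tail (k := k) hκ hlam
  obtain ⟨ρ, C₀, C₁, hρ, h0, h1, hexp, hdom⟩ := DSF.exists_dominating_law (A := A) hr hr1
  refine ⟨ρ, C₀, C₁, hρ, h0, h1, fun n _ => hexp n, ?_⟩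
  intro Ω mΩ P _ N hN u hu H₀ hH hstrip X hXm hX hind l a Q
  have hκ1 : 1 ≤ κ := by omega
  have := DSF.borelSpace_enat
  have hXl : ∀ ω, DSF.LocFin (X ω) := fun ω =>
    DSF.locFin_of_finite (finite_of_encard_le_coe (hX ω).2)
  have hXc : Measurable (DSF.toConf hXl) :=
    Measurable.of_comap_le ((DSF.comap_toConf_le hXl).trans hXm)
  have hNc : Measurable (DSF.toConf hN.locFin) := DSF.measurable_conf hN.measurable_count
  have hcount : DSF.CountMeas N := DSF.countMeas_of_locFin hN.locFin hN.measurable_count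
  have hHm : MeasurableSet H₀ := hH.isClosed.measurableSet
  have hms : DSF.MeasStart a := ⟨fun i => measurable_const, measurable_snd hHm,
    DSF.countMeas_of_locFin hXl fun B hB => (DSF.measurable_count hB).comp hXc, hXl⟩
  have hgood : ∀ Y, DSF.Start.Good κ (⟨u, H₀, Y⟩ : DSF.Start k) := fun Y =>
    ⟨hu, fun x hx => (hstrip x hx).1, fun x hx => (hstrip x hx).2⟩
  have hsig : DSF.renewalSigma κ N a l ≤ mΩ :=
    DSF.renewalSigma_le hcount hN.locFin hms (fun ω => hgood _) hκ1 l
  have hgap : Measurable (fun ω => DSF.renewalGap κ (N ω) (a ω) (l + 1)) :=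
    DSF.measurable_renewalGap hcount hN.locFin hms (fun ω => hgood _) hκ1 (l + 1)
  refine ⟨hsig, hgap, fun n hn => ?_⟩
  have hEm : MeasurableSet {ω | (n : ℕ∞) ≤ DSF.renewalGap κ (N ω) (a ω) (l + 1)} :=
    measurableSet_le measurable_const hgap
  have hSm : MeasurableSet {ω | N ω ∩ H₀ = ∅} := hNc (DSF.measurableSet_avoid hHm)
  refine DSF.condExp_indicator_le hsig hEm measureReal_nonneg fun B hB => ?_
  -- Events of the blocks come from the product of configuration spaces, where independence makes
  -- the joint law of extra and Poisson points a product.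
  obtain ⟨B', hB', rfl⟩ := DSF.renewalSigma_comp_le (N := fun q : DSF.Conf × DSF.Conf => q.2.1)
    (a := fun q => (⟨u, H₀, q.1.1⟩ : DSF.Start k))
    (fun ω => (DSF.toConf hXl ω, DSF.toConf hN.locFin ω)) l B hB
  have hLp := Measure.isProbabilityMeasure_map (μ := P) hNc.aemeasurable
  have hMp := Measure.isProbabilityMeasure_map (μ := P) hXc.aemeasurable
  have hB'm : MeasurableSet B' := DSF.renewalSigma_le DSF.countMeas_snd (fun q => q.2.2)
    (DSF.measStart_randomExtra hHm) (fun q => hgood _) hκ1 l B' hB'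
  have hcard : MeasurableSet {x : DSF.Conf | x.1.encard ≤ k} := by
    have := DSF.measurable_count MeasurableSet.univ
    simp only [inter_univ] at this
    exact measurableSet_le this measurable_const
  have key := DSF.prod_renewalGap_inter_le (M := P.map (DSF.toConf hXl)) hN.map_toConf hlam hκ1
    hgood hHm ((ae_map_iff hXc.aemeasurable hcard).2 (.of_forall fun ω => (hX ω).2)) hr hr1
    (htail _ hN.map_toConf) l hn hB'
  have hSB : MeasurableSet ({q : DSF.Conf × DSF.Conf | q.2.1 ∩ H₀ = ∅} ∩ B') :=
    (measurable_snd (DSF.measurableSet_avoid hHm)).inter hB'm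
  rw [← DSF.map_toConf_prod hXl hXm hN hind, Measure.map_apply (hXc.prodMk hNc) hSB] at key
  -- Conditioning divides both sides by the probability of the same void event.
  rw [cond_apply hSm, cond_apply hSm, mul_left_comm]
  gcongr
  refine (Measure.le_map_apply (hXc.prodMk hNc).aemeasurable _).trans (key.trans ?_)
  exact mul_le_mul_left (ENNReal.ofReal_le_ofReal (hdom n)) _
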